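/- **Setup.** Let $B_m$ be the braid group on $m$ strands with its standard generators $\sigma_1,\dots,\sigma_{m-1}$. Let $n\ge 1$ and let $d,l\ge 0$ be integers with $2l=2n+1-d$. *The Jones representation.* Call $q\in\mathbb C\setminus\{0\}$ $m$-regular if $q^k\neq 1$ for $2\le k\le m$. For $m$-regular $q$ and $m=2n+1$, let $\pi^{m,d}_q$ be the representation of $B_m$ attached to the two-row Young diagram $\lambda=(l+d\ge l)$, in Young's seminormal form, normalized so that the generators have eigenvalues $1$ and $-q^{-1}$. That is, it acts on the complex vector space with basis $v_t$, $t$ a standard tableau of shape $\lambda$, by $\sigma_i\mapsto \mathrm{id}-(1+q^{-1})e_i$, where $$e_iv_t=b_{k}\,(v_t+v_{s_it}),\qquad b_k=\frac{1-q^{k+1}}{(1+q)(1-q^{k})},$$ $k$ is the content (column minus row) of the box of $i$ minus that of the box of $i+1$ in $t$, and $v_{s_it}=0$ if exchanging $i$ and $i+1$ does not give a standard tableau. *The extension.* Let $V^{m,d}$ be the free module on the non-crossing pairings of $m$ top points and $d$ bottom points of a square in which every bottom point is paired with a top point. The Temperley–Lieb generator $e_i$ acts on $V^{m,d}$ by stacking,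 where a closed loop contributes the factor $-A^2-A^{-2}$ and the result is $0$ if two bottom points get connected. For an invertible scalar $A$ put $J_A(\sigma_i)=A^{-1}(A\,\mathrm{id}+A^{-1}e_i)$. *The homological representation.* Let $\Sigma_n^1$ be the compact oriented surface of genus $n$ with one boundary component, let $c_1,\dots,c_{2n}$ be the standard chain of simple closed curves on it ($c_i$ and $c_{i+1}$ meet exactly once, and $c_i\cap c_j=\emptyset$ for $|i-j|\ge2$; the surface is a regular neighbourhood of their union), and let $t_{c_i}$ be the right Dehn twist about $c_i$. Let $\omega\in\Lambda^2H_1(\Sigma_n^1,\mathbb C)$ be the intersection pairing (i.e. $\omega=\sum_k a_k\wedge b_k$ for a symplectic basis $a_k,b_k$). The representation $\rho_{\mathrm{hom}}^{n,l}$ of $B_{2n+1}$ on $$\Lambda^lH_1(\Sigma_n^1,\mathbb C)\big/\big(\omega\wedge\Lambda^{l-2}H_1(\Sigma_n^1,\mathbb C)\big)$$ (where $\Lambda^{k}=0$ for $k<0$) is given by $\sigma_i\cdot[v_1\wedge\dots\wedge v_l]=[(t_{c_i})_*v_1\wedge\dots\wedge(t_{c_i})_*v_l]$. **Theorem.** The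 representation $\pi^{2n+1,d}_q$ has a natural extension to $q=-1$, for which it is equivalent to $\rho_{\mathrm{hom}}^{n,l}$. Precisely: 1. The formulas above define representations $J_A$ of $B_{2n+1}$ on $V^{2n+1,d}$ for all $A\in\mathbb C\setminus\{0\}$, whose matrix entries in the basis of diagrams are specializations of Laurent polynomials in $\mathbb Z[A,A^{-1}]$, namely of the entries of the representation given by the same formulas over $\mathbb Z[A,A^{-1}]$. They also define representations $\pi^{2n+1,d}_q$ (for $(2n+1)$-regular $q$) and $\rho^{n,l}_{\mathrm{hom}}$ of $B_{2n+1}$. 2. If $q=A^4$ is $(2n+1)$-regular, then $J_A$ is equivalent to $\pi_q^{2n+1,d}$. 3. If $A^4=-1$, then $J_A$ is equivalent to $\rho_{\mathrm{hom}}^{n,l}$. -/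

import Mathlib

open scoped unitInterval LaurentPolynomial

/-! ## Braid groups -/

/-- Artin relators for the braid group on `m` strands with generators `σ_0, …, σ_{m-2}`. -/
def braidRelators (m : ℕ) : Set (FreeGroup (Fin (m - 1))) :=
  {r | ∃ i j : Fin (m - 1), (i : ℕ) + 1 = j ∧
      r = FreeGroup.of i * FreeGroup.of j * FreeGroup.of i *
        (FreeGroup.of j * FreeGroup.of i * FreeGroup.of j)⁻¹} ∪
  {r | ∃ i j : Fin (m - 1), (i : ℕ) + 2 ≤ j ∧
      r = FreeGroup.of i * FreeGroup.of j * (FreeGroup.of j * FreeGroup.of i)⁻¹}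

/-- The braid group on `m` strands, by its Artin presentation. -/
abbrev BraidGroup (m : ℕ) : Type := PresentedGroup (braidRelators m)

/-- The standard generator `σ_i` (numbered from `0`), a half twist of the strands `i`, `i + 1`. -/
def BraidGroup.gen {m : ℕ} (i : Fin (m - 1)) : BraidGroup m := PresentedGroup.of i

/-! ## Non-crossing pairings and the Kauffman bracket action -/

/-- A non-crossing pairing of `n` points at the top and `d` points at the bottom of a square in
which every bottom point is paired with a top point. The points are numbered along the boundary of
the square: `0, …, n - 1` are the top points from left to right, `n, …, n + d - 1` are the bottom
points from right to left. -/
@[ext]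
structure LinkDiagram (n d : ℕ) where
  /-- the point which is joined to a given one -/
  partner : Fin (n + d) → Fin (n + d)
  partner_partner : ∀ x, partner (partner x) = x
  partner_ne : ∀ x, partner x ≠ x
  noncrossing : ∀ x y, x < y → y < partner x → partner y < partner x
  through : ∀ x, n ≤ x.val → (partner x).val < n

namespace LinkDiagram

variable {n d : ℕ}

/-- The top point `i`, as a boundary point. -/
def left (d : ℕ) (i : Fin (n - 1)) : Fin (n + d) := ⟨i, by omega⟩
/-- The top point `i + 1`, as a boundary point. -/
def right (d : ℕ) (i : Fin (n - 1)) : Fin (n + d) := ⟨i + 1, by omega⟩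

/-- Stack the Temperley--Lieb generator `e_i` on top of a diagram in which the top points `i` and
`i + 1` are not joined to each other: their partners get joined by the cup of `e_i`, and the cap of
`e_i` joins the new top points `i` and `i + 1`. -/
def reconnect (i : Fin (n - 1)) (D : LinkDiagram n d)
    (x : Fin (n + d)) : Fin (n + d) :=
  if x = left d i then right d i
  else if x = right d i then left d i
  else if x = D.partner (left d i) then D.partner (right d i)
  else if x = D.partner (right d i) then D.partner (left d i)
  else D.partner x

theorem reconnect_cases (i : Fin (n - 1)) (D : LinkDiagram n d) (x : Fin (n + d)) :
    (x = left d i ∧ D.reconnect i x = right d i) ∨ (x = right d i ∧ D.reconnect i x = left d i) ∨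
    (x = D.partner (left d i) ∧ D.reconnect i x = D.partner (right d i)) ∨
    (x = D.partner (right d i) ∧ D.reconnect i x = D.partner (left d i)) ∨
    (x ≠ left d i ∧ x ≠ right d i ∧ x ≠ D.partner (left d i) ∧ x ≠ D.partner (right d i) ∧
      D.reconnect i x = D.partner x) := by
  unfold reconnect
  split_ifs <;> tauto

/-- The diagram obtained by stacking `e_i`, when no loop is created and the points `i` and `i + 1`
are not both joined to the bottom. -/
def cupCap (i : Fin (n - 1)) (D : LinkDiagram n d) (h : D.partner (left d i) ≠ right d i)
    (h' : ¬ (n ≤ (D.partner (left d i)).val ∧ n ≤ (D.partner (right d i)).val)) :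
    LinkDiagram n d where
  partner := D.reconnect i
  partner_partner x := by
    have := D.partner_partner
    have := D.partner_ne
    have : left d i ≠ right d i := by simp [left, right]
    grind [reconnect]
  partner_ne x := by
    have := D.partner_partner
    have := D.partner_ne
    have : left d i ≠ right d i := by simp [left, right]
    grind [reconnect]
  noncrossing x y hx hy := by
    have h1 := D.partner_partner
    have h2 := D.partner_ne
    have h3 := D.noncrossing
    have : left d i < right d i := by simp [left, right, Fin.lt_def]
    have hz : ∀ z, z ≤ left d i ∨ right d i ≤ z := by
      intro z; simp only [left, right, Fin.le_def]; omega
    generalize hl : left d i = l at *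
    generalize hr : right d i = r at *
    have hzx := hz x
    have hzy := hz y
    have hzpx := hz (D.partner x)
    have hzpy := hz (D.partner y)
    have hzl := hz (D.partner l)
    have hzr := hz (D.partner r)
    have h1l := h1 l
    have h1r := h1 r
    have h1x := h1 x
    have h1y := h1 y
    have hx' := D.reconnect_cases i x
    have hy' := D.reconnect_cases i y
    rw [hl, hr] at hx' hy'
    clear hz hl hr
    generalize D.partner = p at *
    generalize D.reconnect i x = x' at *
    generalize D.reconnect i y = y' at *
    clear D
    rcases hx' with ⟨e1, e2⟩ | ⟨e1, e2⟩ | ⟨e1, e2⟩ | ⟨e1, e2⟩ | ⟨e1, e2, e3, e4, e5⟩ <;>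
    rcases hy' with ⟨f1, f2⟩ | ⟨f1, f2⟩ | ⟨f1, f2⟩ | ⟨f1, f2⟩ | ⟨f1, f2, f3, f4, f5⟩ <;>
    try omega
    all_goals grind
  through x hx := by
    have h1 := D.partner_partner
    have h2 := D.partner_ne
    have h3 := D.through
    have : (left d i : ℕ) < n := by simp only [left]; omega
    have : (right d i : ℕ) < n := by simp only [right]; omega
    grind [reconnect]

/-- The free module `V^{n,d}` on the diagrams, over a commutative ring `R`. -/
abbrev Span (R : Type) [CommRing R] (n d : ℕ) : Type := LinkDiagram n d →₀ R

/-- The action of the Temperley--Lieb generator `e_i` on `V^{n,d}` by stacking, where a closed loop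
counts `δ`, and the result is `0` if two bottom points get connected. -/
noncomputable def cupCapMap {R : Type} [CommRing R] (δ : R) (i : Fin (n - 1)) :
    Span R n d →ₗ[R] Span R n d :=
  open Classical in
  Finsupp.linearCombination R fun D : LinkDiagram n d =>
    if h : D.partner (left d i) = right d i then δ • Finsupp.single D 1
    else if h' : n ≤ (D.partner (left d i)).val ∧ n ≤ (D.partner (right d i)).val then 0
    else Finsupp.single (D.cupCap i h h') 1

/-- The operator by which the braid generator `σ_i` acts on `V^{n,d}` for the parameter `A`: the
Kauffman bracket resolution `A id + A⁻¹ e_i` with loop value `-A² - A⁻²`, rescaled by `A⁻¹`. -/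
noncomputable def jonesGen {R : Type} [CommRing R] (A : Rˣ) (i : Fin (n - 1)) :
    Span R n d →ₗ[R] Span R n d :=
  ((A⁻¹ : Rˣ) : R) • ((A : R) • LinearMap.id +
    ((A⁻¹ : Rˣ) : R) • cupCapMap (-(A : R) ^ 2 - ((A⁻¹ : Rˣ) : R) ^ 2) i)

end LinkDiagram

/-- The variable of the ring of Laurent polynomials `ℤ[T, T⁻¹]`, as a unit. -/
noncomputable def laurentVar : ℤ[T;T⁻¹]ˣ where
  val := LaurentPolynomial.T 1
  inv := LaurentPolynomial.T (-1)
  val_inv := by rw [← LaurentPolynomial.T_add]; simp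
  inv_val := by rw [← LaurentPolynomial.T_add]; simp

/-! ## Standard tableaux and the Jones representation at a regular parameter -/

/-- A standard Young tableau of shape `μ` with entries `0, …, m - 1`, increasing along rows and
columns; `cell k` is the box that contains `k`. -/
@[ext]
structure StandardTableau (μ : YoungDiagram) (m : ℕ) where
  /-- the box of an entry -/
  cell : Fin m ≃ μ.cells
  increasing : ∀ x y : μ.cells, x.val ≤ y.val → cell.symm x ≤ cell.symm y

namespace StandardTableau

variable {μ : YoungDiagram} {m : ℕ}

/-- The entry `i`, for `i + 1 < m`. -/
def fst (i : Fin (m - 1)) : Fin m := ⟨i, by omega⟩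

/-- The entry `i + 1`, for `i + 1 < m`. -/
def snd (i : Fin (m - 1)) : Fin m := ⟨i + 1, by omega⟩

/-- The content, column minus row, of the box of the entry `k`. -/
def content (t : StandardTableau μ m) (k : Fin m) : ℤ :=
  ((t.cell k).val.2 : ℤ) - ((t.cell k).val.1 : ℤ)

/-- The axial distance between the entries `i` and `i + 1`. -/
def axialDistance (t : StandardTableau μ m) (i : Fin (m - 1)) : ℤ :=
  t.content (fst i) - t.content (snd i)

/-- Exchanging the entries `i` and `i + 1` gives a standard tableau again. -/
def Exchangeable (t : StandardTableau μ m) (i : Fin (m - 1)) : Prop :=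
  ∀ x y : μ.cells, x.val ≤ y.val →
    ((Equiv.swap (fst i) (snd i)).trans t.cell).symm x ≤
      ((Equiv.swap (fst i) (snd i)).trans t.cell).symm y

/-- The tableau with the entries `i` and `i + 1` exchanged. -/
def exchange (t : StandardTableau μ m) (i : Fin (m - 1)) (h : t.Exchangeable i) :
    StandardTableau μ m :=
  ⟨(Equiv.swap (fst i) (snd i)).trans t.cell, h⟩

/-- The coefficient `(1 - q^{k+1}) / ((1 + q) (1 - q^k))`. -/
noncomputable def weight (q : ℂ) (k : ℤ) : ℂ := (1 - q ^ (k + 1)) / ((1 + q) * (1 - q ^ k))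

/-- Young's seminormal form of the idempotent `e_i` of the Hecke algebra on the span of the standard
tableaux of shape `μ`: `e_i v_t = b (v_t + v_{s_i t})`, where `b` is the weight of the axial
distance and `v_{s_i t}` is read as `0` if `s_i t` is not standard. Up to a rescaling of the basis
vectors this is the symmetric form with the off-diagonal entries `(b_k b_{-k})^{1/2}`. -/
noncomputable def seminormalIdempotent (q : ℂ) (i : Fin (m - 1)) :
    (StandardTableau μ m →₀ ℂ) →ₗ[ℂ] (StandardTableau μ m →₀ ℂ) :=
  open Classical in
  Finsupp.linearCombination ℂ fun t : StandardTableau μ m =>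
    weight q (t.axialDistance i) • (Finsupp.single t 1 +
      if h : t.Exchangeable i then Finsupp.single (t.exchange i h) 1 else 0)

/-- The operator of the braid generator `σ_i` in the representation `π_μ` with parameter `q`,
normalized to have the eigenvalues `1` and `-q⁻¹`: it is `q⁻¹` times the Hecke algebra generator
`q - (1 + q) e_i`, whose eigenvalues are `q` and `-1`. -/
noncomputable def heckeGen (q : ℂ) (i : Fin (m - 1)) :
    (StandardTableau μ m →₀ ℂ) →ₗ[ℂ] (StandardTableau μ m →₀ ℂ) :=
  LinearMap.id - (1 + q⁻¹) • seminormalIdempotent q i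

end StandardTableau

/-- The two-row Young diagram with rows of lengths `l + d ≥ l`. -/
def twoRowDiagram (l d : ℕ) : YoungDiagram :=
  YoungDiagram.ofRowLens [l + d, l] (by simp [List.sortedGE_iff_pairwise])

/-- `q` is `m`-regular: non-zero and not a `k`-th root of unity for any `2 ≤ k ≤ m`. -/
def IsRegularParameter (m : ℕ) (q : ℂ) : Prop :=
  q ≠ 0 ∧ ∀ k : ℕ, 2 ≤ k → k ≤ m → q ^ k ≠ 1

/-! ## The surface with one boundary component and its Dehn twists -/

/-- The annulus `S¹ × [0,1]`, with `S¹ = ℝ/ℤ`, oriented by `dθ ∧ dt`. -/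
abbrev Annulus : Type := UnitAddCircle × I

namespace PlumbedSurface

/-- Coordinates on the square `[1/2, 3/4] × [0,1]` of the annulus. -/
noncomputable def outSquare (s t : I) : Annulus := (((1 / 2 + (s : ℝ) / 4 : ℝ) : UnitAddCircle), t)

/-- Coordinates on the square `[0, 1/4] × [0,1]` of the annulus, turned by a right angle. -/
noncomputable def inSquare (s t : I) : Annulus := ((((t : ℝ) / 4 : ℝ) : UnitAddCircle), σ s)

/-- The point `x` of the square `[1/2, 3/4] × [0,1]` in the `i`-th annulus is to be glued to the point
`y` of the square `[0, 1/4] × [0,1]` in the `(i+1)`-st annulus, by the orientation preserving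
identification that exchanges the circle direction and the interval direction. -/
def Plumbed {N : ℕ} (x y : Fin N × Annulus) : Prop :=
  (x.1 : ℕ) + 1 = y.1 ∧ ∃ s t : I, x.2 = outSquare s t ∧ y.2 = inSquare s t

theorem coe_inj {x y : ℝ} (hx : x ∈ Set.Ico (0 : ℝ) 1) (hy : y ∈ Set.Ico (0 : ℝ) 1)
    (h : (x : UnitAddCircle) = y) : x = y :=
  (AddCircle.coe_eq_coe_iff_of_mem_Ico (p := (1 : ℝ)) (a := 0) (by simpa using hx)
    (by simpa using hy)).1 h

theorem out_mem (s : I) : (1 / 2 + (s : ℝ) / 4) ∈ Set.Ico (0 : ℝ) 1 := by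
  have := s.2.1; have := s.2.2; constructor <;> linarith

theorem in_mem (t : I) : ((t : ℝ) / 4) ∈ Set.Ico (0 : ℝ) 1 := by
  have := t.2.1; have := t.2.2; constructor <;> linarith

theorem outSquare_inj {s t s' t' : I} (h : outSquare s t = outSquare s' t') : s = s' ∧ t = t' := by
  have h1 := coe_inj (out_mem s) (out_mem s') (congrArg Prod.fst h)
  exact ⟨Subtype.ext (by linarith), congrArg Prod.snd h⟩

theorem inSquare_inj {s t s' t' : I} (h : inSquare s t = inSquare s' t') : s = s' ∧ t = t' := by
  have h1 := coe_inj (in_mem t) (in_mem t') (congrArg Prod.fst h)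
  refine ⟨?_, Subtype.ext (by linarith)⟩
  have h2 : σ s = σ s' := congrArg Prod.snd h
  exact unitInterval.symm_bijective.1 h2

theorem outSquare_ne_inSquare (s t s' t' : I) : outSquare s t ≠ inSquare s' t' := by
  intro h
  have h1 := coe_inj (out_mem s) (in_mem t') (congrArg Prod.fst h)
  have := s.2.1; have := t'.2.2
  linarith

/-- The equivalence relation generated by the plumbing of consecutive annuli. -/
def plumbingSetoid (N : ℕ) : Setoid (Fin N × Annulus) where
  r x y := x = y ∨ Plumbed x y ∨ Plumbed y x
  iseqv := by
    refine ⟨fun x => Or.inl rfl, ?_, ?_⟩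
    · rintro x y (h | h | h)
      exacts [Or.inl h.symm, Or.inr (Or.inr h), Or.inr (Or.inl h)]
    · rintro ⟨i, x⟩ ⟨j, y⟩ ⟨k, z⟩ (h | h | h) (h' | h' | h')
      · exact Or.inl (h.trans h')
      · exact h ▸ Or.inr (Or.inl h')
      · exact h ▸ Or.inr (Or.inr h')
      · exact h' ▸ Or.inr (Or.inl h)
      · obtain ⟨-, s, t, -, hy⟩ := h
        obtain ⟨-, s', t', hy', -⟩ := h'
        exact absurd (hy'.symm.trans hy) (outSquare_ne_inSquare _ _ _ _)
      · obtain ⟨hi, s, t, hx, hy⟩ := h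
        obtain ⟨hk, s', t', hz, hy'⟩ := h'
        obtain ⟨rfl, rfl⟩ := inSquare_inj (hy.symm.trans hy')
        exact Or.inl (Prod.ext (Fin.ext (by simp only at hi hk ⊢; omega)) (hx.trans hz.symm))
      · exact h' ▸ Or.inr (Or.inr h)
      · obtain ⟨hi, s, t, hx, hy⟩ := h
        obtain ⟨hk, s', t', hz, hy'⟩ := h'
        obtain ⟨rfl, rfl⟩ := outSquare_inj (hx.symm.trans hz)
        exact Or.inl (Prod.ext (Fin.ext (by simp only at hi hk ⊢; omega)) (hy.trans hy'.symm))
      · obtain ⟨-, s, t, hy, -⟩ := h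
        obtain ⟨-, s', t', -, hy'⟩ := h'
        exact absurd (hy.symm.trans hy') (outSquare_ne_inSquare _ _ _ _)

end PlumbedSurface

open PlumbedSurface in
/-- The oriented surface obtained from `N` annuli by plumbing the `i`-th to the `(i+1)`-st one, for
`i + 1 < N`, so that their cores meet exactly once: a regular neighbourhood of a chain of `N` simple
closed curves. For `N = 2 g` with `g ≥ 1` it is the compact connected oriented surface `Σ_g^1` of
genus `g` with one boundary component (the Euler characteristic is `1 - 2 g`, and the intersection
form of the chain is unimodular), and the cores of the annuli are the chain of curves
`γ_0, β_1, γ_1, …, γ_{g-1}, β_g`, two of which meet, and then in one point, if and only if they are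
consecutive. -/
def PlumbedSurface (N : ℕ) : Type := Quotient (plumbingSetoid N)

instance (N : ℕ) : TopologicalSpace (PlumbedSurface N) :=
  inferInstanceAs (TopologicalSpace (Quotient (PlumbedSurface.plumbingSetoid N)))

namespace PlumbedSurface

variable {N : ℕ}

/-- The embedding of the `i`-th annulus. -/
def annulus (i : Fin N) : C(Annulus, PlumbedSurface N) :=
  ⟨fun a => Quotient.mk (plumbingSetoid N) (i, a),
    continuous_quotient_mk'.comp (by fun_prop)⟩

theorem annulus_eq_iff {i j : Fin N} {a b : Annulus} :
    annulus i a = annulus j b ↔ (i, a) = (j, b) ∨ Plumbed (i, a) (j, b) ∨ Plumbed (j, b) (i, a) :=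
  Quotient.eq (r := plumbingSetoid N)

theorem annulus_injective (i : Fin N) : Function.Injective (annulus i) := by
  intro a b h
  rcases annulus_eq_iff.1 h with h | ⟨h, -⟩ | ⟨h, -⟩
  · exact congrArg Prod.snd h
  · simp at h
  · simp at h

/-- The core of the `i`-th annulus, an oriented simple closed curve `c_i`. The intersection number of
`c_i` with `c_{i+1}` is `1`. -/
noncomputable def core (i : Fin N) : C(UnitAddCircle, PlumbedSurface N) :=
  (annulus i).comp ⟨fun θ => (θ, ⟨1 / 2, by norm_num, by norm_num⟩), by fun_prop⟩

/-- The right twist `(θ, t) ↦ (θ + t, t)` of the annulus; it fixes the boundary pointwise. -/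
def annulusTwist (a : Annulus) : Annulus := (a.1 + ((a.2 : ℝ) : UnitAddCircle), a.2)

open Classical in
/-- The twist of the `i`-th annulus, extended by the identity. -/
noncomputable def twistFun (i : Fin N) (x : PlumbedSurface N) : PlumbedSurface N :=
  if h : ∃ a, annulus i a = x then annulus i (annulusTwist h.choose) else x

theorem twistFun_annulus (i : Fin N) (a : Annulus) :
    twistFun i (annulus i a) = annulus i (annulusTwist a) := by
  have h : ∃ b, annulus i b = annulus i a := ⟨a, rfl⟩
  rw [twistFun, dif_pos h, annulus_injective i h.choose_spec]

theorem twistFun_of_notMem (i : Fin N) {x : PlumbedSurface N} (hx : ∀ a, annulus i a ≠ x) :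
    twistFun i x = x := by
  rw [twistFun, dif_neg (by simpa using hx)]

theorem continuous_annulusTwist : Continuous annulusTwist := by
  unfold annulusTwist
  have : Continuous fun x : ℝ => (x : UnitAddCircle) := AddCircle.continuous_mk' 1
  fun_prop

theorem annulusTwist_of_boundary {a : Annulus} (h : a.2 = 0 ∨ a.2 = 1) : annulusTwist a = a := by
  rcases h with h | h <;> refine Prod.ext ?_ rfl <;> simp only [annulusTwist, h]
  · simp
  · have : (((1 : I) : ℝ) : UnitAddCircle) = 0 := AddCircle.coe_period 1
    rw [this, add_zero]

/-- The gluing step: the twist about `i` is continuous on an annulus `j` which meets the annulus `i`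
in the square `φ`. -/
theorem continuous_twistFun_comp {i j : Fin N} {φ ψ : I × I → Annulus} (hφ : Continuous φ)
    (hφi : Function.Injective φ) (hψ : Continuous ψ) (h : ∀ p, annulus j (φ p) = annulus i (ψ p))
    (hout : ∀ a, a ∉ Set.range φ → ∀ b, annulus i b ≠ annulus j a)
    {C : Set Annulus} (hC : IsClosed C) (hcov : ∀ a, a ∈ Set.range φ ∨ a ∈ C)
    (hbd : ∀ p, φ p ∈ C → (ψ p).2 = 0 ∨ (ψ p).2 = 1) :
    Continuous fun a => twistFun i (annulus j a) := by
  have hemb : Topology.IsClosedEmbedding φ := hφ.isClosedEmbedding hφi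
  rw [← continuousOn_univ]
  have hU : (Set.univ : Set Annulus) = Set.range φ ∪ C := by
    ext a; simpa using hcov a
  rw [hU]
  refine ContinuousOn.union_of_isClosed ?_ ?_ hemb.isClosed_range hC
  · rw [← Set.image_univ, hemb.isInducing.continuousOn_image_iff, continuousOn_univ]
    have : (fun a => twistFun i (annulus j a)) ∘ φ = fun p => annulus i (annulusTwist (ψ p)) := by
      funext p; simp only [Function.comp, h, twistFun_annulus]
    rw [this]
    exact (annulus i).continuous.comp (continuous_annulusTwist.comp hψ)
  · refine ((annulus j).continuous.continuousOn).congr fun a ha => ?_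
    by_cases hr : a ∈ Set.range φ
    · obtain ⟨p, rfl⟩ := hr
      simp only [h, twistFun_annulus, annulusTwist_of_boundary (hbd p ha)]
    · exact twistFun_of_notMem i (hout a hr)

theorem isClosed_arc (a b : ℝ) :
    IsClosed {x : Annulus | x.1 ∈ (fun r : ℝ => (r : UnitAddCircle)) '' Set.Icc a b} := by
  have hc : Continuous fun x : ℝ => (x : UnitAddCircle) := AddCircle.continuous_mk' 1
  exact (isCompact_Icc.image hc).isClosed.preimage continuous_fst

theorem exists_rep (a : ℝ) (θ : UnitAddCircle) : ∃ r ∈ Set.Ico a (a + 1), (r : UnitAddCircle) = θ := by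
  have := AddCircle.coe_image_Ico_eq (1 : ℝ) a
  have h : θ ∈ ((↑) : ℝ → UnitAddCircle) '' Set.Ico a (a + 1) := by rw [this]; trivial
  exact h

theorem arc_boundary {a r : ℝ} {u : I} (hr : r ∈ Set.Icc (a + 1 / 4) (a + 1))
    (h : (r : UnitAddCircle) = ((a + (u : ℝ) / 4 : ℝ) : UnitAddCircle)) : u = 0 ∨ u = 1 := by
  have h0 : ((r - (a + (u : ℝ) / 4) : ℝ) : UnitAddCircle) = 0 := by
    rw [AddCircle.coe_sub, h, sub_self]
  obtain ⟨k, hk⟩ := (AddCircle.coe_eq_zero_iff (1 : ℝ)).1 h0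
  have hu0 := u.2.1
  have hu1 := u.2.2
  obtain ⟨hr0, hr1⟩ := hr
  have hk' : (k : ℝ) = r - (a + (u : ℝ) / 4) := by simpa using hk
  have k0 : (0 : ℤ) ≤ k := by
    have : (-1 : ℝ) < k := by linarith
    have : (-1 : ℤ) < k := by exact_mod_cast this
    omega
  have k1 : k ≤ 1 := by
    have : (k : ℝ) ≤ 1 := by linarith
    exact_mod_cast this
  interval_cases k
  · exact Or.inr (Subtype.ext (show (u : ℝ) = 1 by push_cast at hk'; linarith))
  · exact Or.inl (Subtype.ext (show (u : ℝ) = 0 by push_cast at hk'; linarith))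

theorem arc_cover (a : ℝ) (θ : UnitAddCircle) :
    (∃ u : I, ((a + (u : ℝ) / 4 : ℝ) : UnitAddCircle) = θ) ∨
      θ ∈ (fun r : ℝ => (r : UnitAddCircle)) '' Set.Icc (a + 1 / 4) (a + 1) := by
  obtain ⟨r, ⟨h0, h1⟩, rfl⟩ := exists_rep a θ
  by_cases h : r ≤ a + 1 / 4
  · refine Or.inl ⟨⟨4 * (r - a), by linarith, by linarith⟩, ?_⟩
    congr 1
    ring
  · exact Or.inr ⟨r, ⟨by linarith, h1.le⟩, rfl⟩

theorem continuous_outSquare : Continuous fun p : I × I => outSquare p.1 p.2 := by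
  have hc : Continuous fun x : ℝ => (x : UnitAddCircle) := AddCircle.continuous_mk' 1
  exact (hc.comp (by fun_prop)).prodMk continuous_snd

theorem continuous_inSquare : Continuous fun p : I × I => inSquare p.1 p.2 := by
  have hc : Continuous fun x : ℝ => (x : UnitAddCircle) := AddCircle.continuous_mk' 1
  exact (hc.comp (by fun_prop)).prodMk (unitInterval.continuous_symm.comp continuous_fst)

theorem outSquare_injective : Function.Injective fun p : I × I => outSquare p.1 p.2 :=
  fun _ _ h => Prod.ext (outSquare_inj h).1 (outSquare_inj h).2

theorem inSquare_injective : Function.Injective fun p : I × I => inSquare p.1 p.2 :=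
  fun _ _ h => Prod.ext (inSquare_inj h).1 (inSquare_inj h).2

theorem continuous_twistFun (i : Fin N) : Continuous (twistFun i) := by
  have key : ∀ j, Continuous fun a => twistFun i (annulus j a) := by
    intro j
    rcases eq_or_ne j i with rfl | hne
    · simp only [twistFun_annulus]
      exact (annulus j).continuous.comp continuous_annulusTwist
    by_cases h1 : (i : ℕ) + 1 = j
    · refine continuous_twistFun_comp continuous_inSquare inSquare_injective continuous_outSquare
        (fun p => (annulus_eq_iff.2 (Or.inr (Or.inl ⟨h1, p.1, p.2, rfl, rfl⟩))).symm) ?_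
        (isClosed_arc (0 + 1 / 4) (0 + 1)) ?_ ?_
      · intro a ha b hb
        rcases annulus_eq_iff.1 hb with h | ⟨-, s, t, -, h⟩ | ⟨h, -⟩
        · exact hne (congrArg Prod.fst h).symm
        · exact ha ⟨(s, t), h.symm⟩
        · simp only at h; omega
      · rintro ⟨θ, x⟩
        rcases arc_cover 0 θ with ⟨u, hu⟩ | h
        · refine Or.inl ⟨(σ x, u), Prod.ext ?_ ?_⟩
          · simpa [inSquare] using hu
          · simp [inSquare]
        · exact Or.inr h
      · rintro ⟨s, t⟩ ⟨r, hr, h⟩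
        exact arc_boundary (u := t) hr (by simpa [inSquare] using h)
    by_cases h2 : (j : ℕ) + 1 = i
    · refine continuous_twistFun_comp continuous_outSquare outSquare_injective continuous_inSquare
        (fun p => annulus_eq_iff.2 (Or.inr (Or.inl ⟨h2, p.1, p.2, rfl, rfl⟩))) ?_
        (isClosed_arc (1 / 2 + 1 / 4) (1 / 2 + 1)) ?_ ?_
      · intro a ha b hb
        rcases annulus_eq_iff.1 hb with h | ⟨h, -⟩ | ⟨-, s, t, h, -⟩
        · exact hne (congrArg Prod.fst h).symm
        · simp only at h; omega
        · exact ha ⟨(s, t), h.symm⟩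
      · rintro ⟨θ, x⟩
        rcases arc_cover (1 / 2) θ with ⟨u, hu⟩ | h
        · exact Or.inl ⟨(u, x), Prod.ext hu rfl⟩
        · exact Or.inr h
      · rintro ⟨s, t⟩ ⟨r, hr, h⟩
        rcases arc_boundary (u := s) hr h with rfl | rfl
        · right; simp [inSquare]
        · left; simp [inSquare]
    · refine ((annulus j).continuous).congr fun a => (twistFun_of_notMem i fun b hb => ?_).symm
      rcases annulus_eq_iff.1 hb with h | ⟨h, -⟩ | ⟨h, -⟩
      · exact hne (congrArg Prod.fst h).symm
      · exact h1 h
      · exact h2 h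
  have hq : Topology.IsQuotientMap (Quotient.mk (plumbingSetoid N)) := isQuotientMap_quotient_mk'
  exact hq.continuous_iff.2 (continuous_prod_of_discrete_left.2 key)

/-- The right Dehn twist `t_{c_i}` about the core of the `i`-th annulus. -/
noncomputable def dehnTwist (i : Fin N) : C(PlumbedSurface N, PlumbedSurface N) :=
  ⟨twistFun i, continuous_twistFun i⟩

end PlumbedSurface

/-! ## Homology and its exterior powers -/

/-- The first singular homology of a space with complex coefficients. -/
noncomputable abbrev H1 (X : Type) [TopologicalSpace X] : ModuleCat.{0} ℂ :=
  ((AlgebraicTopology.singularHomologyFunctor (ModuleCat.{0} ℂ) 1).obj (ModuleCat.of ℂ ℂ)).obj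
    (TopCat.of X)

/-- The linear map induced by a continuous map on first homology. -/
noncomputable def H1.map {X Y : Type} [TopologicalSpace X] [TopologicalSpace Y] (f : C(X, Y)) :
    H1 X →ₗ[ℂ] H1 Y :=
  (((AlgebraicTopology.singularHomologyFunctor (ModuleCat.{0} ℂ) 1).obj (ModuleCat.of ℂ ℂ)).map
    (TopCat.ofHom f)).hom

/-- The first homology of the surface `Σ_g^1`. -/
noncomputable abbrev SurfaceH1 (g : ℕ) : ModuleCat.{0} ℂ := H1 (PlumbedSurface (2 * g))

/-- The homology class of the curve `c_i`, where `u` plays the role of the fundamental class of the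
circle. -/
noncomputable def coreClass (g : ℕ) (u : H1 UnitAddCircle) (i : Fin (2 * g)) : SurfaceH1 g :=
  H1.map (PlumbedSurface.core i) u

/-- The intersection pairing `ω`, as the element `∑_k a_k ∧ b_k` of the second exterior power of the
homology for the symplectic basis `a_k = c_0 + c_2 + ⋯ + c_{2k}`, `b_k = c_{2k+1}`, `0 ≤ k < g`.
(Since `c_i · c_{i+1} = 1` and `c_i · c_j = 0` for `|i - j| ≥ 2`, one has `a_k · b_k = 1`, and all
other intersection numbers of these classes vanish.) Here `u` is the class of the circle that is
used to form the classes `c_i`. -/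
noncomputable def omega (g : ℕ) (u : H1 UnitAddCircle) : ExteriorAlgebra ℂ (SurfaceH1 g) :=
  ∑ k : Fin g,
    ExteriorAlgebra.ι ℂ (∑ j ∈ Finset.univ.filter (fun j : Fin g => j ≤ k),
      coreClass g u ⟨2 * j, by omega⟩) *
    ExteriorAlgebra.ι ℂ (coreClass g u ⟨2 * k + 1, by omega⟩)

/-- The subspace `ω ∧ Λ^{l-2} H_1` of `Λ^l H_1`; it is zero for `l < 2`. The homology of the circle is
a line, so the choice of `u` changes `ω` by a scalar only. -/
noncomputable def omegaWedge (g l : ℕ) : Submodule ℂ (⋀[ℂ]^l (SurfaceH1 g)) :=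
  Submodule.span ℂ {y | ∃ (u : H1 UnitAddCircle) (k : ℕ), k + 2 = l ∧
    ∃ x ∈ ⋀[ℂ]^k (SurfaceH1 g), (y : ExteriorAlgebra ℂ (SurfaceH1 g)) = omega g u * x}

/-- The space `Λ^l H_1(Σ_g^1, ℂ) / (ω ∧ Λ^{l-2} H_1(Σ_g^1, ℂ))`. -/
abbrev HomologicalModule (g l : ℕ) : Type := ⋀[ℂ]^l (SurfaceH1 g) ⧸ omegaWedge g l

/-- The map that the Dehn twist about `c_i` induces on `Λ^l H_1(Σ_g^1, ℂ)`. -/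
noncomputable def twistExteriorPower (g l : ℕ) (i : Fin (2 * g)) :
    ⋀[ℂ]^l (SurfaceH1 g) →ₗ[ℂ] ⋀[ℂ]^l (SurfaceH1 g) :=
  exteriorPower.map l (H1.map (PlumbedSurface.dehnTwist i))

/-!
The operators `e_i` of stacking a cap and a cup satisfy the Temperley--Lieb relations
(`cupCapMap_braid`, `cupCapMap_comm`), because stacking is a surgery on fixed point free involutions.
As `A⁻²` is a root of `x² + δ x + 1` for the loop value `δ = -A² - A⁻²`, the operators `1 + A⁻² e_i`
satisfy the braid relations over every ring. This gives all Jones representations at once, and the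
matrix entries specialize because the formulas do.

For the comparisons, a diagram is evaluated as a state sum. A state is a sequence of up and down
steps, one for each point, which takes opposite values at the two ends of every arc; an arc
contributes a weight that depends on the direction of its first step and on the height of the state
before it. If the weights `w` of the cups and the weights `u` of the caps satisfy the relation that a
zigzag can be straightened, and if a closed loop evaluates to `δ`, then `e_i` acts on state sums by a
local rule at the positions `i` and `i + 1` (`LinkDiagram.stateSum_cupCapMap`). A diagram is determined
by its highest state, so the state sums of the diagrams are linearly independent, and nothing is lost
by keeping only the coefficients at these highest states (`LinkDiagram.exists_stateSum_ne_zero`).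

*Regular parameter.* The weight at height `k` is the inverse of the quantum integer `[k]` with
parameter `A`, up to a sign. Then the local rule only involves the paths that stay at positive
height, as the cap from height `1` to height `0` has the factor `[0] = 0`. These paths are the
standard tableaux with two rows, the height is the axial distance, and the local rule is Young's
seminormal form (`LinkDiagram.toTableaux_cupCapMap`). The paths in question are the highest states of
the diagrams, so the dimensions agree.

*Fourth roots of `-1`.* Here `δ = 0`, and weights that do not depend on the height are possible.
A state is sent to the exterior product of vectors attached to its down steps. Then `e_i` becomes an
operator `z ↦ v ∧ (f ⌟ z)` (`LinkDiagram.fockMap_cupCapMap`), where `v` is the sum of the vectors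
attached to the points `i` and `i + 1`. With vectors such that `v` is the class of `c_i`, the linear
form `f` can be replaced by the intersection pairing with `c_i`
(`ChainBasis.fockMap_spinVec_cupCapMap`), and `1 + A⁻² e_i` becomes the map that the transvection along
`c_i` induces on the exterior algebra. The diagrams are generated under stacking by one diagram, which
is sent to the product of pairwise orthogonal vectors; hence all of the image is primitive, that is,
killed by the contraction with the symplectic form (`ChainBasis.lower_fockMap_spinVec`). By the
`sl₂`-commutation relation of the Lefschetz operators, primitive elements of degree at most `n` meet
`ω ∧ Λ^{l-2}` trivially, so that the diagrams embed into the quotient by it. The number of diagrams is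
a ballot number, which is the dimension of the quotient (`ChainBasis.exists_linearEquiv`).

*Topology.* It remains to see that the core curves of the surface, which is plumbed from annuli, are
a basis of its first homology on which the Dehn twists act by the transvections of the chain
(`exists_chainBasis`). Functionals on `H₁` are the same as functions on paths that are additive on
singular triangles (`PathCocycle.exists_eval_eq`), and such a cocycle evaluates to zero if it has a
primitive. A cocycle that vanishes on the cores has a primitive on each annulus, and these glue to a
function on the surface; it is a primitive since there is a deformation of the surface which pushes
it into the interiors of the annuli, on which the statement is local
(`PlumbedSurface.exists_isPrimitive`). Thus the cores span. Maps of the surface to the circle which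
wind around along a single annulus give the dual basis, and the winding numbers of the twisted cores
are read off from lifts to the line (`PlumbedSurface.winding_dehnTwist_core`).
-/

/-! ### Stacking as surgery on matchings -/

namespace TemperleyLieb

/-- Stacking the Temperley--Lieb generator on top of a matching `p` of a set of
points: `l` and `r` get joined, and so do their former partners. -/
def join {X : Type} [DecidableEq X] (l r : X) (p : X → X) (x : X) : X :=
  if x = l then r
  else if x = r then l
  else if x = p l then p r
  else if x = p r then p l
  else p x

/-- A perfect matching, as a fixed point free involution. -/
structure IsMatching {X : Type} (p : X → X) : Prop where
  invol : ∀ x, p (p x) = x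
  ne : ∀ x, p x ≠ x

variable {X : Type} [DecidableEq X]

theorem IsMatching.join {p : X → X} (hp : IsMatching p) {l r : X} (h : l ≠ r) :
    IsMatching (join l r p) := by
  have h1 := hp.invol
  have h2 := hp.ne
  constructor <;> intro x <;> grind [TemperleyLieb.join]

theorem join_of_joined {p : X → X} (hp : IsMatching p) {l r : X} (h : p l = r) :
    join l r p = p := by
  have h1 := hp.invol
  funext x
  grind [join]

theorem join_left {p : X → X} {l r : X} : join l r p l = r := by
  simp [join]

theorem join_join_join {p : X → X} (hp : IsMatching p) {a b c : X} (hab : a ≠ b) (hbc : b ≠ c)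
    (hac : a ≠ c) : join a b (join b c (join a b p)) = join a b p := by
  have h1 := hp.invol
  have h2 := hp.ne
  funext x
  grind [join]

theorem join_join_join' {p : X → X} (hp : IsMatching p) {a b c : X} (hab : a ≠ b) (hbc : b ≠ c)
    (hac : a ≠ c) : join b c (join a b (join b c p)) = join b c p := by
  have h1 := hp.invol
  have h2 := hp.ne
  funext x
  grind [join]

theorem join_comm {p : X → X} (hp : IsMatching p) {a b c e : X} (hab : a ≠ b) (hce : c ≠ e)
    (hac : a ≠ c) (hae : a ≠ e) (hbc : b ≠ c) (hbe : b ≠ e) :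
    join a b (join c e p) = join c e (join a b p) := by
  have h1 := hp.invol
  have h2 := hp.ne
  funext x
  grind (splits := 20) [join]

end TemperleyLieb

namespace LinkDiagram

open TemperleyLieb

variable {n d : ℕ}

theorem isMatching (D : LinkDiagram n d) : IsMatching D.partner :=
  ⟨D.partner_partner, D.partner_ne⟩

theorem left_ne_right (i : Fin (n - 1)) : left d i ≠ right d i := by
  simp [left, right]

theorem left_lt (i : Fin (n - 1)) : (left d i).val < n := by simp only [left]; omega

theorem right_lt (i : Fin (n - 1)) : (right d i).val < n := by simp only [right]; omega

theorem reconnect_eq_join (i : Fin (n - 1)) (D : LinkDiagram n d) :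
    D.reconnect i = join (left d i) (right d i) D.partner := rfl

/-- A matching of the boundary points which is the matching of a diagram, or else joins two bottom
points. -/
def IsDiagramOrZero (p : Fin (n + d) → Fin (n + d)) : Prop :=
  (∃ D : LinkDiagram n d, D.partner = p) ∨ IsMatching p ∧ ∃ x, n ≤ x.val ∧ n ≤ (p x).val

theorem IsDiagramOrZero.isMatching {p : Fin (n + d) → Fin (n + d)} (hp : IsDiagramOrZero p) :
    IsMatching p := by
  rcases hp with ⟨D, rfl⟩ | h
  exacts [D.isMatching, h.1]

variable {R : Type} [CommRing R]

open Classical in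
/-- The basis vector of a matching of the boundary points, read as `0` if the matching is not one of
a diagram, in particular if it joins two bottom points. -/
noncomputable def diagramVector (R : Type) [CommRing R] (p : Fin (n + d) → Fin (n + d)) :
    Span R n d :=
  if h : ∃ D : LinkDiagram n d, D.partner = p then Finsupp.single h.choose 1 else 0

theorem diagramVector_partner (D : LinkDiagram n d) :
    diagramVector R D.partner = Finsupp.single D 1 := by
  have h : ∃ E : LinkDiagram n d, E.partner = D.partner := ⟨D, rfl⟩
  rw [diagramVector, dif_pos h, LinkDiagram.ext h.choose_spec]

theorem diagramVector_of_bottom {p : Fin (n + d) → Fin (n + d)} {x : Fin (n + d)}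
    (h : n ≤ x.val) (h' : n ≤ (p x).val) : diagramVector R p = 0 := by
  rw [diagramVector, dif_neg]
  rintro ⟨D, rfl⟩
  exact absurd (D.through x h) (by omega)

theorem IsDiagramOrZero.join {p : Fin (n + d) → Fin (n + d)} (hp : IsDiagramOrZero p)
    (i : Fin (n - 1)) : IsDiagramOrZero (join (left d i) (right d i) p) := by
  have hl : (left d i).val < n := left_lt i
  have hr : (right d i).val < n := right_lt i
  have hm := hp.isMatching
  have h1 := hm.invol
  have h2 := hm.ne
  rcases hp with ⟨D, rfl⟩ | ⟨-, x, hx, hpx⟩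
  · by_cases h : D.partner (left d i) = right d i
    · exact Or.inl ⟨D, (join_of_joined hm h).symm⟩
    by_cases h' : n ≤ (D.partner (left d i)).val ∧ n ≤ (D.partner (right d i)).val
    · refine Or.inr ⟨hm.join (left_ne_right i), D.partner (left d i), h'.1, ?_⟩
      have : TemperleyLieb.join (left d i) (right d i) D.partner (D.partner (left d i)) =
          D.partner (right d i) := by
        grind [TemperleyLieb.join]
      rw [this]
      exact h'.2
    · exact Or.inl ⟨D.cupCap i h h', rfl⟩
  · refine Or.inr ⟨hm.join (left_ne_right i), x, hx, ?_⟩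
    grind [TemperleyLieb.join]

/-- The factor that stacking `e_i` on the matching `p` produces: the loop value if `i` and `i + 1`
are joined, and `1` otherwise. -/
def loopFactor (δ : R) (i : Fin (n - 1)) (p : Fin (n + d) → Fin (n + d)) : R :=
  if p (left d i) = right d i then δ else 1

theorem cupCapMap_diagramVector (δ : R) (i : Fin (n - 1)) {p : Fin (n + d) → Fin (n + d)}
    (hp : IsDiagramOrZero p) :
    cupCapMap δ i (diagramVector R p) =
      loopFactor δ i p • diagramVector R (join (left d i) (right d i) p) := by
  have hl : (left d i).val < n := left_lt i
  have hr : (right d i).val < n := right_lt i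
  have hm := hp.isMatching
  have h1 := hm.invol
  have h2 := hm.ne
  rcases hp with ⟨D, rfl⟩ | ⟨-, x, hx, hpx⟩
  · rw [diagramVector_partner, cupCapMap, Finsupp.linearCombination_single, one_smul, loopFactor]
    by_cases h : D.partner (left d i) = right d i
    · rw [dif_pos h, if_pos h, join_of_joined hm h, diagramVector_partner]
    rw [dif_neg h, if_neg h, one_smul]
    by_cases h' : n ≤ (D.partner (left d i)).val ∧ n ≤ (D.partner (right d i)).val
    · rw [dif_pos h']
      have : join (left d i) (right d i) D.partner (D.partner (left d i)) =
          D.partner (right d i) := by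
        grind [join]
      exact (diagramVector_of_bottom h'.1 (this ▸ h'.2)).symm
    · rw [dif_neg h', ← diagramVector_partner]
      rfl
  · rw [diagramVector_of_bottom hx hpx, map_zero, diagramVector_of_bottom hx, smul_zero]
    grind [join]

variable (δ : R)

theorem cupCapMap_single (i : Fin (n - 1)) (D : LinkDiagram n d) :
    cupCapMap δ i (Finsupp.single D 1) =
      loopFactor δ i D.partner • diagramVector R (D.reconnect i) := by
  rw [← diagramVector_partner, cupCapMap_diagramVector δ i (Or.inl ⟨D, rfl⟩), reconnect_eq_join]

/-- The relation `e_i ^ 2 = δ e_i`. -/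
theorem cupCapMap_sq (i : Fin (n - 1)) :
    cupCapMap δ i ∘ₗ cupCapMap δ i = δ • (cupCapMap δ i : Span R n d →ₗ[R] Span R n d) := by
  refine Finsupp.lhom_ext' fun D => LinearMap.ext_ring ?_
  have hD : IsDiagramOrZero D.partner := Or.inl ⟨D, rfl⟩
  simp only [LinearMap.comp_apply, Finsupp.lsingle_apply, LinearMap.smul_apply, cupCapMap_single,
    map_smul, reconnect_eq_join, cupCapMap_diagramVector δ i (hD.join i)]
  rw [join_of_joined (hD.join i).isMatching join_left, loopFactor, loopFactor, if_pos join_left,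
    smul_comm]

theorem cupCapMap_braid (i j : Fin (n - 1)) (h : (i : ℕ) + 1 = j) :
    cupCapMap δ i ∘ₗ cupCapMap δ j ∘ₗ cupCapMap δ i =
      (cupCapMap δ i : Span R n d →ₗ[R] Span R n d) := by
  refine Finsupp.lhom_ext' fun D => LinearMap.ext_ring ?_
  have hD : IsDiagramOrZero D.partner := Or.inl ⟨D, rfl⟩
  have hij : right d i = left d j := by simp [left, right, h]
  have h1 := left_ne_right (d := d) i
  have h2 := left_ne_right (d := d) j
  have h3 : left d i ≠ right d j := by simp [left, right]; omega
  have hm := hD.isMatching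
  have e1 := hm.invol
  have e2 := hm.ne
  simp only [LinearMap.comp_apply, Finsupp.lsingle_apply, cupCapMap_single,
    map_smul, reconnect_eq_join, cupCapMap_diagramVector δ _ (hD.join i),
    cupCapMap_diagramVector δ _ ((hD.join i).join j), loopFactor]
  rw [hij] at h1 ⊢
  have a : join (left d i) (left d j) D.partner (left d j) ≠ right d j := by grind [join]
  have b : join (left d j) (right d j) (join (left d i) (left d j) D.partner) (left d i) ≠
      left d j := by grind [join]
  rw [join_join_join hm h1 h2 h3, if_neg a, if_neg b, one_smul, one_smul]

theorem cupCapMap_braid' (i j : Fin (n - 1)) (h : (i : ℕ) + 1 = j) :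
    cupCapMap δ j ∘ₗ cupCapMap δ i ∘ₗ cupCapMap δ j =
      (cupCapMap δ j : Span R n d →ₗ[R] Span R n d) := by
  refine Finsupp.lhom_ext' fun D => LinearMap.ext_ring ?_
  have hD : IsDiagramOrZero D.partner := Or.inl ⟨D, rfl⟩
  have hij : right d i = left d j := by simp [left, right, h]
  have h1 := left_ne_right (d := d) i
  have h2 := left_ne_right (d := d) j
  have h3 : left d i ≠ right d j := by simp [left, right]; omega
  have hm := hD.isMatching
  have e1 := hm.invol
  have e2 := hm.ne
  simp only [LinearMap.comp_apply, Finsupp.lsingle_apply, cupCapMap_single,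
    map_smul, reconnect_eq_join, cupCapMap_diagramVector δ _ (hD.join j),
    cupCapMap_diagramVector δ _ ((hD.join j).join i), loopFactor]
  rw [hij] at h1 ⊢
  have a : join (left d j) (right d j) D.partner (left d i) ≠ left d j := by grind [join]
  have b : join (left d i) (left d j) (join (left d j) (right d j) D.partner) (left d j) ≠
      right d j := by grind [join]
  rw [join_join_join' hm h1 h2 h3, if_neg a, if_neg b, one_smul, one_smul]

theorem cupCapMap_comm (i j : Fin (n - 1)) (h : (i : ℕ) + 2 ≤ j) :
    cupCapMap δ i ∘ₗ cupCapMap δ j =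
      (cupCapMap δ j ∘ₗ cupCapMap δ i : Span R n d →ₗ[R] Span R n d) := by
  refine Finsupp.lhom_ext' fun D => LinearMap.ext_ring ?_
  have hD : IsDiagramOrZero D.partner := Or.inl ⟨D, rfl⟩
  have h1 := left_ne_right (d := d) i
  have h2 := left_ne_right (d := d) j
  have h3 : left d i ≠ left d j := by simp [left]; omega
  have h4 : left d i ≠ right d j := by simp [left, right]; omega
  have h5 : right d i ≠ left d j := by simp [left, right]; omega
  have h6 : right d i ≠ right d j := by simp [right]; omega
  have hm := hD.isMatching
  have e1 := hm.invol
  have e2 := hm.ne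
  simp only [LinearMap.comp_apply, Finsupp.lsingle_apply, cupCapMap_single,
    map_smul, reconnect_eq_join, cupCapMap_diagramVector δ _ (hD.join _), smul_smul]
  rw [join_comm hm h1 h2 h3 h4 h5 h6]
  congr 1
  simp only [loopFactor]
  by_cases a : D.partner (left d i) = right d i
  · rw [join_of_joined hm a, mul_comm, if_pos a, if_pos (by grind [join])]
  by_cases b : D.partner (left d j) = right d j
  · rw [join_of_joined hm b, mul_comm, if_pos b, if_neg a, if_pos (by grind [join])]
  rw [if_neg a, if_neg b, one_mul, one_mul]
  congr 1
  grind [join]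

/-! ### The Jones representation -/

/-- The loop value `-A² - A⁻²` of the Kauffman bracket. -/
def loopValue (A : Rˣ) : R := -(A : R) ^ 2 - ((A⁻¹ : Rˣ) : R) ^ 2

theorem jonesGen_eq (A : Rˣ) (i : Fin (n - 1)) :
    (jonesGen A i : Span R n d →ₗ[R] Span R n d) =
      1 + ((A⁻¹ : Rˣ) : R) ^ 2 • cupCapMap (loopValue A) i := by
  rw [jonesGen, smul_add, smul_smul, smul_smul, Units.inv_mul, one_smul, ← sq]
  rfl

/-- The braid relation follows from `e² = δ e` and `e f e = e`, as `a = A⁻²` is a root of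
`a² + δ a + 1`. -/
theorem braid_of_temperleyLieb {S : Type} [Ring S] [Algebra R S] {e f : S} {a δ : R}
    (he : e * e = δ • e) (hf : f * f = δ • f) (hef : e * (f * e) = e) (hfe : f * (e * f) = f)
    (ha : 1 + δ * a + a ^ 2 = 0) :
    (1 + a • e) * (1 + a • f) * (1 + a • e) = (1 + a • f) * (1 + a • e) * (1 + a • f) := by
  have key : ∀ {e f : S}, e * e = δ • e → e * (f * e) = e →
      (1 + a • e) * (1 + a • f) * (1 + a • e) =
        1 + a • e + a • f + a ^ 2 • (e * f) + a ^ 2 • (f * e) := by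
    intro e f he hef
    have h : (1 + a • e) * (1 + a • f) * (1 + a • e) =
        1 + a • e + a • f + a ^ 2 • (e * f) + a ^ 2 • (f * e) +
          (a • e + (a * a) • (e * e) + (a * a * a) • (e * (f * e))) := by
      simp only [mul_add, add_mul, one_mul, mul_one, smul_mul_smul_comm, mul_assoc, pow_two]
      abel
    have h2 : a + a * a * δ + a * a * a = 0 := by linear_combination a * ha
    rw [h, he, hef, smul_smul, ← add_smul, ← add_smul, h2, zero_smul, add_zero]
  rw [key he hef, key hf hfe]
  abel

theorem inverse_of_temperleyLieb {S : Type} [Ring S] [Algebra R S] {e : S} {a b δ : R}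
    (he : e * e = δ • e) (h : a + b + a * b * δ = 0) : (1 + a • e) * (1 + b • e) = 1 := by
  have : (1 + a • e) * (1 + b • e) = 1 + (a + b + a * b * δ) • e := by
    simp only [mul_add, add_mul, one_mul, mul_one, smul_mul_smul_comm, he, smul_smul, add_smul]
    abel
  rw [this, h, zero_smul, add_zero]

theorem loopValue_root (A : Rˣ) :
    1 + loopValue A * ((A⁻¹ : Rˣ) : R) ^ 2 + (((A⁻¹ : Rˣ) : R) ^ 2) ^ 2 = 0 := by
  have h : (A : R) * ((A⁻¹ : Rˣ) : R) = 1 := Units.mul_inv A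
  rw [loopValue]
  linear_combination (-(A : R) * ((A⁻¹ : Rˣ) : R) - 1) * h

/-- The generator of the Jones representation with its inverse `1 + A² e_i`. -/
noncomputable def jonesUnit (A : Rˣ) (i : Fin (n - 1)) : (Module.End R (Span R n d))ˣ where
  val := jonesGen A i
  inv := 1 + (A : R) ^ 2 • cupCapMap (loopValue A) i
  val_inv := by
    have h : (A : R) * ((A⁻¹ : Rˣ) : R) = 1 := Units.mul_inv A
    rw [jonesGen_eq]
    refine inverse_of_temperleyLieb (S := Module.End R (Span R n d)) (cupCapMap_sq _ i) ?_
    rw [loopValue]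
    linear_combination (-((A⁻¹ : Rˣ) : R) ^ 2 - (A : R) ^ 2) *
      ((A : R) * ((A⁻¹ : Rˣ) : R) + 1) * h
  inv_val := by
    have h : (A : R) * ((A⁻¹ : Rˣ) : R) = 1 := Units.mul_inv A
    rw [jonesGen_eq]
    refine inverse_of_temperleyLieb (S := Module.End R (Span R n d)) (cupCapMap_sq _ i) ?_
    rw [loopValue]
    linear_combination (-((A⁻¹ : Rˣ) : R) ^ 2 - (A : R) ^ 2) *
      ((A : R) * ((A⁻¹ : Rˣ) : R) + 1) * h

theorem jonesUnit_relations (A : Rˣ) (r : FreeGroup (Fin (n - 1))) (hr : r ∈ braidRelators n) :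
    FreeGroup.lift (jonesUnit (d := d) A) r = 1 := by
  rcases hr with ⟨i, j, h, rfl⟩ | ⟨i, j, h, rfl⟩
  · simp only [map_mul, map_inv, FreeGroup.lift_apply_of]
    rw [mul_inv_eq_one]
    ext1
    simp only [Units.val_mul, jonesUnit, jonesGen_eq]
    exact braid_of_temperleyLieb (S := Module.End R (Span R n d)) (cupCapMap_sq _ i)
      (cupCapMap_sq _ j) (cupCapMap_braid _ i j h) (cupCapMap_braid' _ i j h) (loopValue_root A)
  · simp only [map_mul, map_inv, FreeGroup.lift_apply_of]
    rw [mul_inv_eq_one]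
    ext1
    have hc := cupCapMap_comm (d := d) (loopValue A) i j h
    rw [← Module.End.mul_eq_comp, ← Module.End.mul_eq_comp] at hc
    simp only [Units.val_mul, jonesUnit, jonesGen_eq, mul_add, add_mul, one_mul, mul_one,
      smul_mul_smul_comm, hc]
    abel

/-- The Jones representation on the span of the diagrams. -/
noncomputable def jonesRep (n d : ℕ) (A : Rˣ) : Representation R (BraidGroup n) (Span R n d) :=
  (Units.coeHom (Module.End R (Span R n d))).comp
    (PresentedGroup.toGroup (f := jonesUnit A) (jonesUnit_relations A))

theorem jonesRep_gen (A : Rˣ) (i : Fin (n - 1)) :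
    jonesRep n d A (BraidGroup.gen i) = jonesGen A i := by
  simp [jonesRep, BraidGroup.gen, jonesUnit]

/-! ### Specialization of the parameter -/

theorem mapRange_cupCapMap {S : Type} [CommRing S] (φ : R →+* S) (i : Fin (n - 1)) (δ : R)
    (x : Span R n d) :
    Finsupp.mapRange φ (map_zero φ) (cupCapMap δ i x) =
      cupCapMap (φ δ) i (Finsupp.mapRange φ (map_zero φ) x) := by
  induction x using Finsupp.induction_linear with
  | zero => simp
  | add x y hx hy => simp [Finsupp.mapRange_add, hx, hy]
  | single D a =>
    simp only [cupCapMap, Finsupp.linearCombination_single, Finsupp.mapRange_single]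
    split_ifs
    · rw [Finsupp.smul_single', Finsupp.smul_single', Finsupp.smul_single', Finsupp.smul_single',
        Finsupp.mapRange_single]
      simp
    · simp
    · simp

theorem mapRange_jonesGen {S : Type} [CommRing S] (φ : R →+* S) (A : Rˣ) (B : Sˣ)
    (h : Units.map (φ : R →* S) A = B) (i : Fin (n - 1)) (x : Span R n d) :
    Finsupp.mapRange φ (map_zero φ) (jonesGen A i x) =
      jonesGen B i (Finsupp.mapRange φ (map_zero φ) x) := by
  subst h
  have e : φ (loopValue A) = loopValue (Units.map (φ : R →* S) A) := by
    simp [loopValue, ← map_inv]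
  simp only [jonesGen_eq, LinearMap.add_apply, Module.End.one_apply, LinearMap.smul_apply]
  rw [Finsupp.mapRange_add (map_add φ), ← e, ← mapRange_cupCapMap]
  congr 1
  ext D
  simp [← map_inv]

/-- A property of braids that holds for the generators and is stable under products and inverses
holds for all braids. -/
theorem braid_induction {P : BraidGroup n → Prop} (b : BraidGroup n) (one : P 1)
    (gen : ∀ i, P (BraidGroup.gen i)) (mul : ∀ b c, P b → P c → P (b * c))
    (inv : ∀ b, P b → P b⁻¹) : P b := by
  have h : b ∈ Subgroup.closure (Set.range (PresentedGroup.of (rels := braidRelators n))) := by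
    rw [PresentedGroup.closure_range_of]; trivial
  induction h using Subgroup.closure_induction with
  | mem x hx => obtain ⟨i, rfl⟩ := hx; exact gen i
  | one => exact one
  | mul x y _ _ hx hy => exact mul _ _ hx hy
  | inv x _ hx => exact inv _ hx

/-- A map that intertwines the generators of two representations of the braid group intertwines
the representations; no linearity is needed, so that changes of scalars are covered. -/
theorem intertwine_of_gen {S V W : Type} [CommRing S] [AddCommGroup V] [Module R V]
    [AddCommGroup W] [Module S W] (ρ : Representation R (BraidGroup n) V)
    (τ : Representation S (BraidGroup n) W) (f : V → W)
    (h : ∀ i v, f (ρ (BraidGroup.gen i) v) = τ (BraidGroup.gen i) (f v)) (b : BraidGroup n) :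
    ∀ v, f (ρ b v) = τ b (f v) := by
  induction b using braid_induction with
  | one => simp
  | gen i => exact h i
  | mul b c hb hc => intro v; simp [hb, hc]
  | inv b hb =>
    intro v
    have := hb (ρ b⁻¹ v)
    rw [Representation.self_inv_apply] at this
    rw [this, Representation.inv_self_apply]

theorem mapRange_jonesRep {S : Type} [CommRing S] (φ : R →+* S) (A : Rˣ) (B : Sˣ)
    (h : Units.map (φ : R →* S) A = B) (b : BraidGroup n) (x : Span R n d) :
    Finsupp.mapRange φ (map_zero φ) (jonesRep n d A b x) =
      jonesRep n d B b (Finsupp.mapRange φ (map_zero φ) x) :=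
  intertwine_of_gen _ _ _ (fun i v => by
    rw [jonesRep_gen, jonesRep_gen, mapRange_jonesGen φ A B h]) b x

theorem jonesRep_laurent (A : ℂˣ) (b : BraidGroup n) (D E : LinkDiagram n d) :
    jonesRep n d A b (Finsupp.single D 1) E =
      LaurentPolynomial.eval₂ (Int.castRingHom ℂ) A
        (jonesRep n d laurentVar b (Finsupp.single D 1) E) := by
  have h := mapRange_jonesRep (d := d) (LaurentPolynomial.eval₂ (Int.castRingHom ℂ) A)
    laurentVar A (by ext; simp [laurentVar]) b (Finsupp.single D 1)
  rw [Finsupp.mapRange_single, map_one] at h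
  rw [← h, Finsupp.mapRange_apply]

end LinkDiagram

/-! ### State sums of diagrams -/

namespace StateSum

/-- The step of a path, up for `true` and down for `false`. -/
def step (b : Bool) : ℤ := if b then 1 else -1

theorem step_not (b : Bool) : step (!b) = -step b := by cases b <;> rfl

variable {M : ℕ}

/-- The height of the lattice path `s` after `k` steps, when it starts at height `1`. -/
def height (s : Fin M → Bool) (k : ℕ) : ℤ :=
  1 + ∑ y ∈ Finset.univ.filter (fun y : Fin M => y.val < k), step (s y)

theorem height_zero (s : Fin M → Bool) : height s 0 = 1 := by simp [height]

theorem height_succ (s : Fin M → Bool) (x : Fin M) :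
    height s (x + 1) = height s x + step (s x) := by
  have : Finset.univ.filter (fun y : Fin M => y.val < x + 1) =
      insert x (Finset.univ.filter (fun y : Fin M => y.val < x)) := by
    ext y; simp [Fin.ext_iff]; omega
  rw [height, this, Finset.sum_insert (by simp), height]
  ring

theorem height_congr {s t : Fin M → Bool} {k : ℕ} (h : ∀ y : Fin M, y.val < k → s y = t y) :
    height s k = height t k := by
  rw [height, height]
  congr 1
  refine Finset.sum_congr rfl fun y hy => ?_
  rw [h y (by simpa using hy)]

theorem height_le (s : Fin M → Bool) (k : ℕ) : height s k ≤ k + 1 := by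
  rw [height]
  have h : ∀ y ∈ Finset.univ.filter (fun y : Fin M => y.val < k), step (s y) ≤ 1 := by
    intro y _; rw [step]; split_ifs <;> norm_num
  have h1 := Finset.sum_le_sum h
  have h2 : (Finset.univ.filter (fun y : Fin M => y.val < k)).card ≤ k := by
    have := Finset.card_le_card_of_injOn (s := Finset.univ.filter (fun y : Fin M => y.val < k))
      (t := Finset.range k) (fun y => y.val) (by intro y hy; simpa using hy)
      (fun a _ b _ hab => Fin.ext hab)
    simpa using this
  simp only [Finset.sum_const, nsmul_eq_mul, mul_one] at h1
  have : ((Finset.univ.filter (fun y : Fin M => y.val < k)).card : ℤ) ≤ k := by exact_mod_cast h2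
  linarith

/-- The state with the steps `b` and `!b` at two given positions. -/
def setPair (s : Fin M → Bool) (l r : Fin M) (b : Bool) : Fin M → Bool :=
  Function.update (Function.update s r (!b)) l b

theorem setPair_left (s : Fin M → Bool) (l r : Fin M) (b : Bool) : setPair s l r b l = b := by
  simp [setPair]

theorem setPair_right (s : Fin M → Bool) {l r : Fin M} (h : l ≠ r) (b : Bool) :
    setPair s l r b r = !b := by
  simp [setPair, h.symm]

theorem setPair_of_ne (s : Fin M → Bool) {l r x : Fin M} (b : Bool) (hl : x ≠ l) (hr : x ≠ r) :
    setPair s l r b x = s x := by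
  simp [setPair, hl, hr]

theorem setPair_self (s : Fin M → Bool) {l r : Fin M} (h : s r = !s l) :
    setPair s l r (s l) = s := by
  rw [setPair, ← h, Function.update_eq_self, Function.update_eq_self]

theorem height_setPair (s : Fin M → Bool) {l r : Fin M} (b : Bool) (hlr : l.val + 1 = r)
    (hs : s r = !s l) {k : ℕ} (hk : k ≠ r) : height (setPair s l r b) k = height s k := by
  have hne : l ≠ r := fun h => by rw [h] at hlr; omega
  have low : ∀ j : ℕ, j ≤ l → height (setPair s l r b) j = height s j := fun j hj =>
    height_congr fun y hy => setPair_of_ne s b (fun h => by rw [h] at hy; omega)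
      (fun h => by rw [h] at hy; omega)
  rcases Nat.lt_or_gt_of_ne hk with h | h
  · exact low k (by omega)
  · obtain ⟨j, rfl⟩ := Nat.exists_eq_add_of_lt h
    have step2 : ∀ t : Fin M → Bool, t r = !t l → height t (r + 1) = height t l := by
      intro t ht
      rw [height_succ, ← hlr, height_succ, ht, step_not]
      ring
    induction j with
    | zero =>
      simp only [Nat.add_zero]
      rw [step2 _ hs, step2 _ (by rw [setPair_right s hne, setPair_left]), low l le_rfl]
    | succ j ih =>
      by_cases hM : r.val + j + 1 < M
      · have h1 := height_succ s ⟨r.val + j + 1, hM⟩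
        have h2 := height_succ (setPair s l r b) ⟨r.val + j + 1, hM⟩
        simp only at h1 h2
        rw [show r.val + (j + 1) + 1 = r.val + j + 1 + 1 by ring, h1, h2, ih (by omega) (by omega),
          setPair_of_ne s b (fun h => ?_) (fun h => ?_)]
        · rw [Fin.ext_iff] at h; simp only at h; omega
        · rw [Fin.ext_iff] at h; simp only at h; omega
      · have hcut : ∀ t : Fin M → Bool, height t (r.val + (j + 1) + 1) = height t (r.val + j + 1) := by
          intro t
          rw [height, height]
          congr 2
          ext y
          have := y.2
          simp only [Finset.mem_filter, Finset.mem_univ, true_and]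
          omega
        rw [hcut, hcut, ih (by omega) (by omega)]

/-- The state `s` is compatible with the matching `p` if the two ends of each arc carry opposite
steps. -/
def Compatible (p : Fin M → Fin M) (s : Fin M → Bool) : Prop := ∀ x, s (p x) = !s x

variable {R : Type} [CommRing R]

/-- The weight of the arc that starts at `x`, and `1` if an arc ends at `x`. -/
def arcWeight (w : ℤ → Bool → R) (p : Fin M → Fin M) (s : Fin M → Bool) (x : Fin M) : R :=
  if x < p x then w (height s x) (s x) else 1

open Classical in
/-- The coefficient of the state `s` in the state sum of the matching `p`: the product of the
weights of the arcs if `s` is compatible with `p`, and zero otherwise. -/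
noncomputable def coeff (w : ℤ → Bool → R) (p : Fin M → Fin M) (s : Fin M → Bool) : R :=
  if Compatible p s then ∏ x, arcWeight w p s x else 0

theorem coeff_of_compatible {w : ℤ → Bool → R} {p : Fin M → Fin M} {s : Fin M → Bool}
    (h : Compatible p s) : coeff w p s = ∏ x, arcWeight w p s x := if_pos h

theorem coeff_of_not_compatible {w : ℤ → Bool → R} {p : Fin M → Fin M} {s : Fin M → Bool}
    (h : ¬ Compatible p s) : coeff w p s = 0 := if_neg h

end StateSum

namespace LinkDiagram

open StateSum TemperleyLieb

variable {n d : ℕ} {R : Type} [CommRing R]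

theorem noncrossing' (D : LinkDiagram n d) {x y : Fin (n + d)} (h1 : x < y) (h2 : y < D.partner x) :
    x < D.partner y := by
  by_contra h
  rcases (not_lt.1 h).lt_or_eq with h | h
  · have := D.noncrossing (D.partner y) x h (by rwa [D.partner_partner])
    rw [D.partner_partner] at this
    exact absurd this (by simpa using h2.le)
  · rw [← h, D.partner_partner] at h2
    exact lt_irrefl _ h2

/-- The arcs below an arc contribute nothing to the height, so the height before the end of an arc is
the height after its beginning. -/
theorem height_partner (D : LinkDiagram n d) {s : Fin (n + d) → Bool}
    (hs : Compatible D.partner s) {x : Fin (n + d)} (hx : x < D.partner x) :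
    height s (D.partner x) = height s (x + 1) := by
  have hsplit : Finset.univ.filter (fun y : Fin (n + d) => y.val < D.partner x) =
      Finset.univ.filter (fun y : Fin (n + d) => y.val < x + 1) ∪
        Finset.univ.filter (fun y : Fin (n + d) => x < y ∧ y < D.partner x) := by
    ext y
    rw [Fin.lt_def] at hx
    simp only [Finset.mem_filter, Finset.mem_univ, true_and, Finset.mem_union, Fin.lt_def]
    omega
  have hdisj : Disjoint (Finset.univ.filter (fun y : Fin (n + d) => y.val < x + 1))
      (Finset.univ.filter (fun y : Fin (n + d) => x < y ∧ y < D.partner x)) := by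
    rw [Finset.disjoint_left]
    intro y
    simp only [Finset.mem_filter, Finset.mem_univ, true_and, Fin.lt_def]
    omega
  rw [height, hsplit, Finset.sum_union hdisj, height, ← add_assoc, add_eq_left]
  -- the points below the arc cancel in pairs
  refine Finset.sum_involution (fun y _ => D.partner y) ?_ ?_ ?_ ?_
  · intro y _; rw [hs y, step_not]; ring
  · intro y _ _; exact D.partner_ne y
  · intro y hy
    simp only [Finset.mem_filter, Finset.mem_univ, true_and] at hy ⊢
    exact ⟨D.noncrossing' hy.1 hy.2, D.noncrossing x y hy.1 hy.2⟩
  · intro y _; exact D.partner_partner y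

variable (w u : ℤ → Bool → R)

theorem compatible_setPair (D : LinkDiagram n d) (i : Fin (n - 1)) {s : Fin (n + d) → Bool}
    (hs : s (right d i) = !s (left d i)) (h : D.partner (left d i) ≠ right d i) (t : Bool) :
    Compatible D.partner (setPair s (left d i) (right d i) t) ↔
      Compatible (D.reconnect i) s ∧ t = !s (D.partner (left d i)) := by
  have h1 := D.partner_partner
  have h2 := D.partner_ne
  have h3 := left_ne_right (d := d) i
  have e1 := setPair_left s (left d i) (right d i) t
  have e2 := setPair_right s h3 t
  have e3 := fun x => setPair_of_ne s (l := left d i) (r := right d i) (x := x) t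
  have hc := D.reconnect_cases i
  generalize left d i = l at *
  generalize right d i = r at *
  generalize setPair s l r t = s' at *
  generalize D.reconnect i = q at *
  generalize D.partner = p at *
  constructor
  · intro hp
    have hzl : p r ≠ l := fun e => h (by rw [← e, h1])
    have ht : s (p l) = !t := by rw [← e3 _ (h2 l) h, hp, e1]
    have hz : s (p r) = t := by rw [← e3 _ hzl (h2 r), hp, e2, Bool.not_not]
    refine ⟨fun x => ?_, by rw [ht, Bool.not_not]⟩
    rcases hc x with ⟨c1, c2⟩ | ⟨c1, c2⟩ | ⟨c1, c2⟩ | ⟨c1, c2⟩ | ⟨c1, c2, c3, c4, c5⟩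
    · rw [c2, c1, hs]
    · rw [c2, c1, hs, Bool.not_not]
    · rw [c2, c1, hz, ht, Bool.not_not]
    · rw [c2, c1, hz, ht]
    · rw [c5, ← e3 x c1 c2, ← hp x, e3 _ (fun e => c3 (by rw [← e, h1]))
        (fun e => c4 (by rw [← e, h1]))]
  · rintro ⟨hq, ht⟩
    have hzl : p r ≠ l := fun e => h (by rw [← e, h1])
    have hqy : q (p l) = p r := by grind
    have hsz : s (p r) = t := by rw [← hqy, hq, ht]
    have hl : s' (p l) = !s' l := by rw [e3 _ (h2 l) h, e1, ht, Bool.not_not]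
    have hr : s' (p r) = !s' r := by rw [e3 _ hzl (h2 r), hsz, e2, Bool.not_not]
    intro x
    rcases hc x with ⟨c1, c2⟩ | ⟨c1, c2⟩ | ⟨c1, c2⟩ | ⟨c1, c2⟩ | ⟨c1, c2, c3, c4, c5⟩
    · rw [c1, hl]
    · rw [c1, hr]
    · rw [c1, h1, hl, Bool.not_not]
    · rw [c1, h1, hr, Bool.not_not]
    · rw [e3 x c1 c2, e3 (p x) (fun e => c3 (by rw [← e, h1]))
        (fun e => c4 (by rw [← e, h1])), ← c5, hq]

/-- The weights of the arcs before and after stacking `e_i`. The factor `u` of the cap cancels the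
weight of the arc that disappears, by a zigzag relation; this relation is needed only at heights
which the path `s` attains. -/
theorem prod_arcWeight_reconnect (D : LinkDiagram n d) (i : Fin (n - 1)) {s : Fin (n + d) → Bool}
    (hs : s (right d i) = !s (left d i)) (h : D.partner (left d i) ≠ right d i) {t : Bool}
    (ht : t = !s (D.partner (left d i)))
    (hc : Compatible D.partner (setPair s (left d i) (right d i) t))
    (hz : ∀ k : ℕ, height s k = height s i + step t →
      u (height s i) t * w (height s i + step t) (!t) = 1) :
    u (height s i) t * w (height s i) (s (left d i)) *
        ∏ x, arcWeight w D.partner (setPair s (left d i) (right d i) t) x =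
      ∏ x, arcWeight w (D.reconnect i) s x := by
  have h1 := D.partner_partner
  have h2 := D.partner_ne
  have h3 := left_ne_right (d := d) i
  have hlr : (left d i).val + 1 = right d i := rfl
  have hi : (i : ℕ) = left d i := rfl
  rw [hi] at hz ⊢
  have hnc := D.noncrossing
  have hht := fun x => D.height_partner hc (x := x)
  have e1 := setPair_left s (left d i) (right d i) t
  have e2 := setPair_right s h3 t
  have e3 := fun x => setPair_of_ne s (l := left d i) (r := right d i) (x := x) t
  have hh := fun k => height_setPair s t hlr hs (k := k)
  have hsucc := height_succ (setPair s (left d i) (right d i) t)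
  have hrc := D.reconnect_cases i
  generalize left d i = l at *
  generalize right d i = r at *
  generalize setPair s l r t = s' at *
  generalize D.reconnect i = q at *
  generalize D.partner = p at *
  have hyl : p l ≠ l := h2 l
  have hzr : p r ≠ r := h2 r
  have hzl : p r ≠ l := fun e => h (by rw [← e, h1])
  have hyz : p l ≠ p r := fun e => h3 (by rw [← h1 l, e, h1])
  have hql : q l = r := by grind
  have hqr : q r = l := by grind
  have hqy : q (p l) = p r := by grind
  have hqz : q (p r) = p l := by grind
  have hrest : ∀ x, x ∉ ({l, r, p l, p r} : Finset (Fin (n + d))) →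
      arcWeight w p s' x = arcWeight w q s x := by
    intro x hx
    simp only [Finset.mem_insert, Finset.mem_singleton, not_or] at hx
    have : q x = p x := by grind
    rw [arcWeight, arcWeight, this, hh x (fun e => hx.2.1 (Fin.ext e)), e3 x hx.1 hx.2.1]
  have hprod : ∀ f : Fin (n + d) → R, ∏ x ∈ ({l, r, p l, p r} : Finset (Fin (n + d))), f x =
      f l * (f r * (f (p l) * f (p r))) := by
    intro f
    rw [Finset.prod_insert, Finset.prod_insert, Finset.prod_insert, Finset.prod_singleton] <;> grind
  -- only the arcs at `l`, `r` and their partners change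
  rw [← Finset.prod_mul_prod_compl ({l, r, p l, p r} : Finset (Fin (n + d))),
    ← Finset.prod_mul_prod_compl ({l, r, p l, p r} : Finset (Fin (n + d))) (arcWeight w q s),
    ← mul_assoc]
  congr 1
  swap
  · exact Finset.prod_congr rfl fun x hx => hrest x (by simpa using hx)
  rw [hprod, hprod]
  simp only [arcWeight, h1, hql, hqr, hqy, hqz]
  have hlr' : l < r := by rw [Fin.lt_def]; omega
  have hadj : ∀ x : Fin (n + d), x ≠ l → x ≠ r → x < l ∨ r < x := by
    intro x h h'
    rw [Fin.lt_def, Fin.lt_def]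
    have := fun e => h (Fin.ext e)
    have := fun e => h' (Fin.ext e)
    omega
  have hhl : height s' l = height s l := hh l (by omega)
  have hhr : height s' r = height s l + step t := by rw [← hlr, hsucc, hhl, e1]
  have hhr1 : height s' (r + 1) = height s l := by rw [hsucc, hhr, e2, step_not]; ring
  have hy : s (p l) = !t := by rw [ht]; simp
  have hy' : s' (p l) = !t := by rw [e3 _ hyl h, hy]
  have hz' : s' (p r) = t := by rw [hc, e2]; simp
  have hz'' : s (p r) = t := by rw [← e3 _ hzl hzr, hz']
  have hhy : height s' (p l) = height s (p l) := hh _ (fun e => h (Fin.ext e))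
  have hhz : height s' (p r) = height s (p r) := hh _ (fun e => hzr (Fin.ext e))
  rw [if_neg (show ¬ r < l from hlr'.not_gt), if_pos hlr']
  rcases hadj _ hyl h with cy | cy <;> rcases hadj _ hzl hzr with cz | cz
  · -- both partners are to the left
    have hzy : p r < p l := by
      by_contra hcon
      have := hnc (p l) (p r) (lt_of_le_of_ne (not_lt.1 hcon) hyz) (by rw [h1]; exact cz)
      rw [h1, h1] at this
      exact absurd this hlr'.not_gt
    have a1 := hht (p l) (by rw [h1]; exact cy)
    rw [h1, hhl, hsucc, hy', step_not] at a1
    have a2 := hht (p r) (by rw [h1]; exact cz.trans hlr')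
    rw [h1, hhr, hsucc, hz'] at a2
    have b1 : height s' (p l) = height s l + step t := by linarith
    have b2 : height s' (p r) = height s l := by linarith
    rw [if_neg cy.not_gt, if_neg (cz.trans hlr').not_gt, if_pos cy, if_pos (cz.trans hlr'),
      if_neg hzy.not_gt, if_pos hzy, ← hhz, b1, b2, hy', hz', hz'']
    have := hz (p l) (by rw [← hhy, b1])
    linear_combination (w (height s l) (s l) * w (height s l) t) * this
  · -- the arcs go to different sides
    have a1 := hht (p l) (by rw [h1]; exact cy)
    rw [h1, hhl, hsucc, hy', step_not] at a1
    have b1 : height s' (p l) = height s l + step t := by linarith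
    have hyz' : p l < p r := cy.trans (hlr'.trans cz)
    rw [if_neg cy.not_gt, if_pos cz, if_pos cy, if_neg cz.not_gt, if_pos hyz', if_neg hyz'.not_gt,
      ← hhy, b1, hhr, e2, hy', hy]
    have := hz (p l) (by rw [← hhy, b1])
    linear_combination (w (height s l) (s l) * w (height s l + step t) (!t)) * this
  · -- excluded, since the arcs would cross
    have := hnc (p r) l cz (by rw [h1]; exact hlr')
    rw [h1] at this
    exact absurd this cy.not_gt
  · -- both partners are to the right
    have hzy : p r < p l := hnc l r hlr' cy
    have a2 := hht r cz
    rw [hhr1] at a2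
    rw [if_pos (hlr'.trans cy), if_pos cz, if_neg (hlr'.trans cy).not_gt, if_neg cz.not_gt,
      if_neg hzy.not_gt, if_pos hzy, ← hhz, a2, e1, e2, hz'', hhl, hhr]
    have := hz (p r + 1) (by
      rw [← hh _ (by rw [Fin.lt_def] at cz; omega), hsucc, a2, hz'])
    linear_combination (w (height s l) (s l) * w (height s l) t) * this

/-- The Temperley--Lieb generator acts on state sums by a local rule at the positions `i`, `i + 1`. -/
theorem coeff_reconnect (D : LinkDiagram n d) (i : Fin (n - 1)) {s : Fin (n + d) → Bool}
    (hs : s (right d i) = !s (left d i)) (δ : R)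
    (hδ : ∑ t, u (height s i) t * w (height s i) t = δ)
    (hz : ∀ (k : ℕ) (t : Bool), height s k = height s i + step t →
      u (height s i) t * w (height s i + step t) (!t) = 1) :
    w (height s i) (s (left d i)) *
        ∑ t, u (height s i) t * coeff w D.partner (setPair s (left d i) (right d i) t) =
      loopFactor δ i D.partner * coeff w (D.reconnect i) s := by
  have h3 := left_ne_right (d := d) i
  by_cases h : D.partner (left d i) = right d i
  · -- a loop is split off, and the sum over `t` is its value
    have h1 := D.partner_partner
    have h' : D.partner (right d i) = left d i := by rw [← h, h1]
    have hcomp : ∀ t, Compatible D.partner (setPair s (left d i) (right d i) t) ↔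
        Compatible D.partner s := by
      intro t
      have e1 := setPair_left s (left d i) (right d i) t
      have e2 := setPair_right s h3 t
      have e3 := fun x => setPair_of_ne s (l := left d i) (r := right d i) (x := x) t
      refine forall_congr' fun x => ?_
      by_cases hl : x = left d i
      · rw [hl, h, hs, e1, e2]; simp
      by_cases hr : x = right d i
      · rw [hr, h', hs, e1, e2]; simp
      rw [e3 x hl hr, e3 (D.partner x) (fun e => hr (by rw [← h, ← e, h1]))
        (fun e => hl (by rw [← h', ← e, h1]))]
    rw [loopFactor, if_pos h, reconnect_eq_join, join_of_joined D.isMatching h]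
    by_cases hc : Compatible D.partner s
    · have hprod : ∀ t, ∏ x, arcWeight w D.partner (setPair s (left d i) (right d i) t) x =
          w (height s i) t * ∏ x ∈ {left d i}ᶜ, arcWeight w D.partner s x := by
        intro t
        rw [← Finset.prod_mul_prod_compl {left d i}, Finset.prod_singleton]
        congr 1
        · rw [arcWeight, h, if_pos (by simp [left, right, Fin.lt_def]), setPair_left,
            height_setPair s t rfl hs (by simp [left, right])]
          rfl
        · refine Finset.prod_congr rfl fun x hx => ?_
          have hx : x ≠ left d i := by simpa using hx
          by_cases hr : x = right d i
          · have : ¬ right d i < left d i := by simp [left, right, Fin.lt_def]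
            rw [arcWeight, arcWeight, hr, h', if_neg this, if_neg this]
          · rw [arcWeight, arcWeight, setPair_of_ne s t hx hr,
              height_setPair s t rfl hs (fun e => hr (Fin.ext e))]
      have hself := hprod (s (left d i))
      rw [setPair_self s hs] at hself
      rw [coeff_of_compatible hc, hself, ← hδ, Finset.mul_sum, Finset.sum_mul]
      refine Finset.sum_congr rfl fun t _ => ?_
      rw [coeff_of_compatible ((hcomp t).2 hc), hprod]
      ring
    · rw [coeff_of_not_compatible hc, Finset.sum_eq_zero]
      · ring
      · intro t _
        rw [coeff_of_not_compatible (fun e => hc ((hcomp t).1 e)), mul_zero]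
  · -- two arcs are joined, and the state of the joined arc determines `t`
    rw [loopFactor, if_neg h, one_mul]
    have hcomp := D.compatible_setPair i hs h
    by_cases hc : Compatible (D.reconnect i) s
    · have ht := (hcomp _).2 ⟨hc, rfl⟩
      rw [coeff_of_compatible hc, Finset.sum_eq_single (!s (D.partner (left d i)))]
      · rw [coeff_of_compatible ht, ← D.prod_arcWeight_reconnect w u i hs h rfl ht (fun k => hz k _)]
        ring
      · intro t _ ht
        rw [coeff_of_not_compatible (fun e => ht ((hcomp t).1 e).2), mul_zero]
      · simp
    · rw [coeff_of_not_compatible hc, Finset.sum_eq_zero, mul_zero]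
      intro t _
      rw [coeff_of_not_compatible (fun e => hc ((hcomp t).1 e).1), mul_zero]

end LinkDiagram

/-! ### Lattice paths and the zigzag diagram -/

namespace StateSum

variable {M : ℕ}

/-- The sum of the positions of the down steps of a path. -/
def downSum (s : Fin M → Bool) : ℕ := ∑ x : Fin M, if s x then 0 else x.val

theorem downSum_setPair (s : Fin M → Bool) {l r : Fin M} (hlr : l.val + 1 = r) (hl : s l = true)
    (hr : s r = false) : downSum (setPair s l r false) + 1 = downSum s := by
  have hne : l ≠ r := fun h => by rw [h] at hlr; omega
  have h : ∀ t : Fin M → Bool, downSum t = (if t l then 0 else l.val) + ((if t r then 0 else r.val) +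
      ∑ x ∈ {l, r}ᶜ, if t x then 0 else x.val) := by
    intro t
    rw [downSum, ← Finset.sum_add_sum_compl {l, r}, Finset.sum_pair hne, add_assoc]
  have hsum : ∑ x ∈ ({l, r} : Finset (Fin M))ᶜ, (if setPair s l r false x then 0 else x.val) =
      ∑ x ∈ ({l, r} : Finset (Fin M))ᶜ, if s x then 0 else x.val := by
    refine Finset.sum_congr rfl fun x hx => ?_
    simp only [Finset.mem_compl, Finset.mem_insert, Finset.mem_singleton, not_or] at hx
    rw [setPair_of_ne s _ hx.1 hx.2]
  rw [h, h s, setPair_left, setPair_right s hne, hl, hr, hsum]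
  simp
  omega

/-- A path is good if it stays at height at least `1`. -/
def Good (s : Fin M → Bool) : Prop := ∀ k, 1 ≤ height s k

theorem height_add_le (s : Fin M → Bool) (a k : ℕ) : height s (a + k) ≤ height s a + k := by
  induction k with
  | zero => simp
  | succ k ih =>
    by_cases h : a + k < M
    · have h1 := height_succ s ⟨a + k, h⟩
      simp only at h1
      rw [← add_assoc, h1]
      have : step (s ⟨a + k, h⟩) ≤ 1 := by rw [step]; split_ifs <;> norm_num
      push_cast
      linarith
    · have : height s (a + (k + 1)) = height s (a + k) := by
        rw [height, height]
        congr 2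
        ext y
        have := y.2
        simp only [Finset.mem_filter, Finset.mem_univ, true_and]
        omega
      rw [this]
      push_cast
      linarith

theorem height_of_forall_up {s : Fin M → Bool} {a k : ℕ} (hk : a + k ≤ M)
    (h : ∀ x : Fin M, a ≤ x.val → x.val < a + k → s x = true) : height s (a + k) = height s a + k := by
  induction k with
  | zero => simp
  | succ k ih =>
    have h1 := height_succ s ⟨a + k, by omega⟩
    simp only at h1
    rw [← add_assoc, h1, ih (by omega) (fun x h2 h3 => h x h2 (by omega)),
      h ⟨a + k, by omega⟩ (by simp) (by simp), step, if_pos rfl]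
    push_cast
    ring

theorem height_of_forall_down {s : Fin M → Bool} {a k : ℕ} (hk : a + k ≤ M)
    (h : ∀ x : Fin M, a ≤ x.val → x.val < a + k → s x = false) :
    height s (a + k) = height s a - k := by
  induction k with
  | zero => simp
  | succ k ih =>
    have h1 := height_succ s ⟨a + k, by omega⟩
    simp only at h1
    rw [← add_assoc, h1, ih (by omega) (fun x h2 h3 => h x h2 (by omega)),
      h ⟨a + k, by omega⟩ (by simp) (by simp), step, if_neg Bool.false_ne_true]
    push_cast
    ring

/-- The path `(up, down)^l` followed by `d` up steps and, for the bottom points, `d` down steps. -/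
def zigzag (n d l : ℕ) (x : Fin (n + d)) : Bool :=
  if x.val < 2 * l then x.val % 2 = 0 else x.val < n

/-- Among the good paths from height `1` to height `d + 1`, the zigzag path is the only one in which
no two up steps are followed by a down step. -/
theorem eq_zigzag_or_exists {n d l : ℕ} (hn : n = 2 * l + d) {s : Fin (n + d) → Bool} (hs : Good s)
    (hbot : ∀ x, n ≤ x.val → s x = false) (hend : height s (n + d) = 1) :
    s = zigzag n d l ∨ ∃ (j : ℕ) (hj : j + 2 < n), s ⟨j, by omega⟩ = true ∧
      s ⟨j + 1, by omega⟩ = true ∧ s ⟨j + 2, by omega⟩ = false := by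
  by_contra hcon
  obtain ⟨hne, hno⟩ := not_or.1 hcon
  push Not at hno
  have hhn : height s n = d + 1 := by
    have := height_of_forall_down (s := s) (a := n) (k := d) le_rfl (fun x hx _ => hbot x hx)
    linarith
  -- The path begins with `l` peaks: it cannot go down from height `1`, and after two consecutive up
  -- steps it could only go further up, so that it would end too high.
  have key : ∀ k ≤ l, (∀ x : Fin (n + d), x.val < 2 * k → s x = decide (x.val % 2 = 0)) ∧
      height s (2 * k) = 1 := by
    intro k
    induction k with
    | zero => intro _; exact ⟨fun x hx => by omega, height_zero s⟩
    | succ k ih =>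
      intro hk
      obtain ⟨ih1, ih2⟩ := ih (by omega)
      have h1 := height_succ s ⟨2 * k, by omega⟩
      have h2 := height_succ s ⟨2 * k + 1, by omega⟩
      simp only at h1 h2
      have up : s ⟨2 * k, by omega⟩ = true := by
        by_contra h
        have := hs (2 * k + 1)
        rw [h1, ih2, Bool.eq_false_iff.2 h, step] at this
        simp at this
      have down : s ⟨2 * k + 1, by omega⟩ = false := by
        by_contra h
        rw [Bool.not_eq_false] at h
        have all : ∀ j, 2 * k + 1 + j < n → ∀ hj : 2 * k + 1 + j < n + d,
            s ⟨2 * k + 1 + j, hj⟩ = true ∧ s ⟨2 * k + j, by omega⟩ = true := by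
          intro j
          induction j with
          | zero => exact fun _ _ => ⟨h, up⟩
          | succ j ihj =>
            intro hj hj'
            have := ihj (by omega) (by omega)
            have h3 := hno (2 * k + j) (by omega) this.2
              (by simpa only [show 2 * k + j + 1 = 2 * k + 1 + j by ring] using this.1)
            rw [ne_eq, Bool.not_eq_false] at h3
            refine ⟨?_, ?_⟩
            · simpa only [show 2 * k + j + 2 = 2 * k + 1 + (j + 1) by ring] using h3
            · simpa only [show 2 * k + (j + 1) = 2 * k + 1 + j by ring] using this.1
        have := height_of_forall_up (s := s) (a := 2 * k) (k := n - 2 * k) (by omega) (by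
          intro x hx hx'
          rcases hx.eq_or_lt with e | e
          · rw [← up]; congr 1; exact Fin.ext e.symm
          · have := (all (x.val - (2 * k + 1)) (by omega) (by omega)).1
            simpa only [show 2 * k + 1 + (x.val - (2 * k + 1)) = x.val by omega] using this)
        rw [show 2 * k + (n - 2 * k) = n by omega, ih2, hhn] at this
        omega
      refine ⟨fun x hx => ?_, ?_⟩
      · rcases lt_trichotomy x.val (2 * k) with h | h | h
        · exact ih1 x h
        · rw [show x = ⟨2 * k, by omega⟩ from Fin.ext h, up]; simp
        · rw [show x = ⟨2 * k + 1, by omega⟩ from Fin.ext (by simp only; omega), down]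
          simp
      · rw [show 2 * (k + 1) = 2 * k + 1 + 1 by ring, h2, h1, ih2, up, down]
        simp [step]
  -- the remaining `d` steps have to lead from height `1` to height `d + 1`
  obtain ⟨k1, k2⟩ := key l le_rfl
  refine hne (funext fun x => ?_)
  rw [zigzag]
  split_ifs with hx
  · exact k1 x hx
  · by_cases hxn : x.val < n
    · by_contra h
      simp only [hxn, decide_true, Bool.not_eq_true] at h
      have h1 := height_succ s x
      have h2 := height_add_le s (2 * l) (x.val - 2 * l)
      have h3 := height_add_le s (x.val + 1) (n - (x.val + 1))
      rw [show 2 * l + (x.val - 2 * l) = x.val by omega, k2] at h2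
      rw [show x.val + 1 + (n - (x.val + 1)) = n by omega, hhn, h1, h, step] at h3
      simp at h3
      omega
    · rw [hbot x (by omega)]
      simp [hxn]

end StateSum

namespace LinkDiagram

open StateSum TemperleyLieb

variable {n d : ℕ}

/-- The path of a diagram: an arc begins with an up step and ends with a down step. -/
def path (D : LinkDiagram n d) (x : Fin (n + d)) : Bool := x < D.partner x

theorem compatible_path (D : LinkDiagram n d) : Compatible D.partner D.path := by
  intro x
  have := D.partner_ne x
  simp only [path, D.partner_partner]
  rcases lt_or_gt_of_ne this with h | h
  · simp [h, h.not_gt]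
  · simp [h, h.not_gt]

theorem path_bottom (D : LinkDiagram n d) {x : Fin (n + d)} (hx : n ≤ x.val) : D.path x = false := by
  have := D.through x hx
  simp only [path, decide_eq_false_iff_not, Fin.lt_def]
  omega

theorem height_path (D : LinkDiagram n d) (k : ℕ) :
    height D.path k = 1 + (Finset.univ.filter (fun y : Fin (n + d) =>
      y.val < k ∧ k ≤ (D.partner y).val)).card := by
  rw [height]
  congr 1
  rw [← Finset.sum_filter_add_sum_filter_not _ (fun y : Fin (n + d) => k ≤ (D.partner y).val),
    Finset.filter_filter]
  have h1 : ∑ y ∈ Finset.univ.filter (fun y : Fin (n + d) => y.val < k ∧ k ≤ (D.partner y).val),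
      step (D.path y) = (Finset.univ.filter (fun y : Fin (n + d) =>
        y.val < k ∧ k ≤ (D.partner y).val)).card := by
    rw [Finset.card_eq_sum_ones]
    push_cast
    refine Finset.sum_congr rfl fun y hy => ?_
    simp only [Finset.mem_filter, Finset.mem_univ, true_and] at hy
    have : D.path y = true := by
      simp only [path, decide_eq_true_eq, Fin.lt_def]; omega
    rw [this, step]; rfl
  rw [h1, add_eq_left]
  refine Finset.sum_involution (fun y _ => D.partner y) ?_ ?_ ?_ ?_
  · intro y _; rw [D.compatible_path y, step_not]; ring
  · intro y _ _; exact D.partner_ne y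
  · intro y hy
    simp only [Finset.mem_filter, Finset.mem_univ, true_and, D.partner_partner] at hy ⊢
    omega
  · intro y _; exact D.partner_partner y

theorem good_path (D : LinkDiagram n d) : Good D.path := by
  intro k; rw [height_path]; omega

theorem height_path_end (D : LinkDiagram n d) : height D.path (n + d) = 1 := by
  rw [height_path, Finset.filter_false_of_mem]
  · simp
  · intro y _; have := (D.partner y).2; omega

/-- The sum over all points is a sum over the arcs. -/
theorem sum_arcs (D : LinkDiagram n d) (f : Fin (n + d) → ℕ) :
    ∑ x, f x = ∑ x ∈ Finset.univ.filter (fun x => x < D.partner x), (f x + f (D.partner x)) := by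
  rw [Finset.sum_add_distrib, ← Finset.sum_filter_add_sum_filter_not _ (fun x => x < D.partner x)]
  congr 1
  refine Finset.sum_nbij' D.partner D.partner ?_ ?_ ?_ ?_ ?_
  · intro x hx
    simp only [Finset.mem_filter, Finset.mem_univ, true_and, D.partner_partner] at hx ⊢
    exact lt_of_le_of_ne (not_lt.1 hx) (D.partner_ne x)
  · intro x hx
    simp only [Finset.mem_filter, Finset.mem_univ, true_and, D.partner_partner] at hx ⊢
    exact hx.not_gt
  · intro x _; exact D.partner_partner x
  · intro x _; exact D.partner_partner x
  · intro x _; rw [D.partner_partner]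

/-- A state that is compatible with a diagram lies below the path of the diagram. -/
theorem downSum_le (D : LinkDiagram n d) {s : Fin (n + d) → Bool} (hs : Compatible D.partner s) :
    downSum s ≤ downSum D.path ∧ (downSum s = downSum D.path → s = D.path) := by
  rw [downSum, downSum, D.sum_arcs, D.sum_arcs]
  have hle : ∀ x ∈ Finset.univ.filter (fun x => x < D.partner x),
      ((if s x then 0 else x.val) + if s (D.partner x) then 0 else (D.partner x).val) ≤
      ((if D.path x then 0 else x.val) + if D.path (D.partner x) then 0 else (D.partner x).val) := by
    intro x hx
    simp only [Finset.mem_filter, Finset.mem_univ, true_and] at hx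
    have : D.path x = true := by simp [path, hx]
    rw [hs x, D.compatible_path x, this]
    rw [Fin.lt_def] at hx
    cases s x <;> simp
    omega
  refine ⟨Finset.sum_le_sum hle, fun h => ?_⟩
  rw [Finset.sum_eq_sum_iff_of_le hle] at h
  have h' : ∀ x, x < D.partner x → s x = D.path x := by
    intro x hx
    have h1 := h x (by simpa using hx)
    have : D.path x = true := by simp [path, hx]
    rw [hs x, D.compatible_path x, this] at h1
    rw [Fin.lt_def] at hx
    rw [this]
    cases hsx : s x
    · simp [hsx] at h1; omega
    · rfl
  funext x
  rcases lt_or_gt_of_ne (D.partner_ne x) with hx | hx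
  · have := h' (D.partner x) (by rwa [D.partner_partner])
    rw [hs x, D.compatible_path x] at this
    simpa using this
  · exact h' x hx

/-- If the arc of `E` at `x` were longer than the arc of `D`, then the arc of `E` that ends at the
`D`-partner of `x` would begin at a point between them, where the arc of `E` is again longer than the
arc of `D`. The arcs of `E` that arise in this way get shorter and shorter. -/
theorem path_injective_aux {D E : LinkDiagram n d} (h : D.path = E.path) (k : ℕ) :
    ∀ x, x < D.partner x → (E.partner x).val - x.val ≤ k → ¬ D.partner x < E.partner x := by
  induction k with
  | zero =>
    intro x hx hk hlt
    rw [Fin.lt_def] at hx hlt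
    omega
  | succ k ih =>
    intro x hx hk hlt
    have h1 : E.path (D.partner x) = false := by
      rw [← h, D.compatible_path x]; simp [path, hx]
    have h2 : E.partner (D.partner x) < D.partner x := by
      simp only [path, decide_eq_false_iff_not, not_lt] at h1
      exact lt_of_le_of_ne h1 (E.partner_ne _)
    have h3 : x < E.partner (D.partner x) := E.noncrossing' hx hlt
    have h4 : D.path (E.partner (D.partner x)) = true := by
      rw [h, E.compatible_path, h1]; rfl
    refine ih (E.partner (D.partner x)) (by simpa [path] using h4) ?_ ?_
    · rw [E.partner_partner]
      rw [Fin.lt_def] at hx hlt h2 h3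
      omega
    · rw [E.partner_partner]
      exact D.noncrossing x _ h3 h2

theorem path_injective : Function.Injective (path : LinkDiagram n d → Fin (n + d) → Bool) := by
  intro D E h
  have key : ∀ x, x < D.partner x → D.partner x = E.partner x := by
    intro x hx
    have hx' : x < E.partner x := by
      have := congrFun h x
      simp only [path, decide_eq_decide] at this
      exact this.1 hx
    exact le_antisymm (not_lt.1 (path_injective_aux h.symm _ x hx' le_rfl))
      (not_lt.1 (path_injective_aux h _ x hx le_rfl))
  ext1
  funext x
  rcases lt_or_gt_of_ne (D.partner_ne x) with hx | hx
  · have := key (D.partner x) (by rwa [D.partner_partner])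
    rw [D.partner_partner] at this
    rw [← E.partner_partner (D.partner x), ← this]
  · exact key x hx

/-- The diagram with the arcs `(0, 1), (2, 3), …, (2 l - 2, 2 l - 1)` and `d` through strands. -/
def zigzagDiagram {n d l : ℕ} (hn : n = 2 * l + d) : LinkDiagram n d where
  partner x := ⟨if x.val < 2 * l then (if x.val % 2 = 0 then x.val + 1 else x.val - 1)
    else 2 * l + (n + d) - 1 - x.val, by have := x.2; split_ifs <;> omega⟩
  partner_partner x := by
    have := x.2
    ext1
    simp only
    split_ifs <;> omega
  partner_ne x := by
    have := x.2
    rw [ne_eq, Fin.ext_iff]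
    simp only
    split_ifs <;> omega
  noncrossing x y := by
    have := x.2
    have := y.2
    simp only [Fin.lt_def]
    split_ifs <;> omega
  through x := by
    have := x.2
    simp only
    split_ifs <;> omega

theorem path_zigzagDiagram {n d l : ℕ} (hn : n = 2 * l + d) :
    (zigzagDiagram hn).path = zigzag n d l := by
  funext x
  have := x.2
  rw [path, zigzag]
  simp only [zigzagDiagram, Fin.lt_def]
  split_ifs <;> simp <;> omega

/-- An up step which is followed by a down step is an arc of the diagram. -/
theorem partner_of_peak (D : LinkDiagram n d) {x y : Fin (n + d)} (hxy : x.val + 1 = y)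
    (hx : D.path x = true) (hy : D.path y = false) : D.partner x = y := by
  have hx' : x < D.partner x := by simpa [path] using hx
  have hy' : D.partner y < y :=
    lt_of_le_of_ne (by simpa [path] using hy) (D.partner_ne y)
  by_contra h
  have h1 : D.partner y ≠ x := fun e => h (by rw [← e, D.partner_partner])
  have h2 : D.partner y < x := by
    refine lt_of_le_of_ne ?_ h1
    rw [Fin.lt_def] at hy'
    rw [Fin.le_def]
    omega
  have h3 := D.noncrossing (D.partner y) x h2 (by
    rw [D.partner_partner, Fin.lt_def]; omega)
  rw [D.partner_partner] at h3
  rw [Fin.lt_def] at hx' h3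
  omega

variable {R : Type} [CommRing R]

/-- A diagram in which two up steps are followed by a down step is obtained by stacking from one with
a lower path. -/
theorem exists_lower (D : LinkDiagram n d) {j : ℕ} (hj : j + 2 < n)
    (h0 : D.path ⟨j, by omega⟩ = true) (h1 : D.path ⟨j + 1, by omega⟩ = true)
    (h2 : D.path ⟨j + 2, by omega⟩ = false) :
    ∃ E : LinkDiagram n d, downSum E.path < downSum D.path ∧ ∀ δ : R,
      cupCapMap δ (⟨j + 1, by omega⟩ : Fin (n - 1)) (Finsupp.single E 1) = Finsupp.single D 1 := by
  set i : Fin (n - 1) := ⟨j, by omega⟩ with hi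
  set i' : Fin (n - 1) := ⟨j + 1, by omega⟩ with hi'
  change D.path (left d i) = true at h0
  change D.path (right d i) = true at h1
  change D.path (right d i') = false at h2
  have hp : D.partner (right d i) = right d i' := D.partner_of_peak rfl h1 h2
  have hp' : D.partner (right d i') = right d i := by rw [← hp, D.partner_partner]
  have hne : left d i ≠ right d i := left_ne_right i
  have hne' : right d i ≠ right d i' := by simp [right, hi, hi']
  have hne'' : left d i ≠ right d i' := by simp [right, left, hi, hi', add_assoc]
  have a1 : D.partner (left d i) ≠ right d i := by
    intro e
    exact hne'' (by rw [← hp, ← e, D.partner_partner])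
  have a2 : ¬ (n ≤ (D.partner (left d i)).val ∧ n ≤ (D.partner (right d i)).val) := by
    rintro ⟨-, h⟩
    rw [hp] at h
    have := right_lt (d := d) i'
    omega
  have hm := D.isMatching
  have e1 := hm.invol
  have e2 := hm.ne
  refine ⟨D.cupCap i a1 a2, ?_, fun δ => ?_⟩
  · rw [← downSum_setPair D.path (l := right d i) (r := right d i') rfl h1 h2, Nat.lt_succ_iff]
    refine le_of_eq (congrArg _ (funext fun x => ?_))
    have hD0 : left d i < D.partner (left d i) := by simpa [path] using h0
    have hlt : left d i < right d i := by simp [left, right, Fin.lt_def]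
    have hlt' : right d i < right d i' := by simp [right, Fin.lt_def, hi, hi']
    have hz : right d i' < D.partner (left d i) := by
      have := fun e => a1 (Fin.ext e)
      have h5 : D.partner (left d i) ≠ right d i' := fun e => hne (by rw [← e1 (left d i), e, hp'])
      have := fun e => h5 (Fin.ext e)
      rw [Fin.lt_def] at hD0 ⊢
      have h6 : (left d i).val = j := rfl
      have h7 : (right d i).val = j + 1 := rfl
      have h8 : (right d i').val = j + 2 := rfl
      omega
    show decide (x < D.reconnect i x) = _
    rcases D.reconnect_cases i x with ⟨c1, c2⟩ | ⟨c1, c2⟩ | ⟨c1, c2⟩ | ⟨c1, c2⟩ | ⟨c1, c2, c3, c4, c5⟩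
    · rw [c2, c1, setPair_of_ne _ _ hne hne'', h0]
      simpa using hlt
    · rw [c2, c1, setPair_left]
      simpa using hlt.le
    · rw [c2, c1, hp, setPair_of_ne _ _ a1 (hz.ne'), D.compatible_path, h0]
      simpa using hz.le
    · rw [c2, c1, hp, setPair_right _ hne']
      simpa using hz
    · rw [c5, setPair_of_ne _ _ c2 (by rwa [← hp]), path]
  · have hl : left d i' = right d i := by simp [left, right, hi, hi']
    rw [cupCapMap_single, ← diagramVector_partner]
    have hE : (D.cupCap i a1 a2).partner = join (left d i) (right d i) D.partner := rfl
    have hb : loopFactor δ i' (D.cupCap i a1 a2).partner = 1 := by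
      rw [loopFactor, if_neg]
      rw [hE, hl]
      grind [join]
    rw [hb, one_smul, reconnect_eq_join, hE, hl]
    congr 1
    funext x
    grind [join]

/-- The zigzag diagram generates the span of the diagrams under stacking. -/
theorem mem_of_zigzagDiagram_mem {l : ℕ} (hn : n = 2 * l + d) (δ : R)
    (W : Submodule R (Span R n d)) (h0 : Finsupp.single (zigzagDiagram hn) 1 ∈ W)
    (hW : ∀ i, ∀ x ∈ W, cupCapMap δ i x ∈ W) (x : Span R n d) : x ∈ W := by
  have key : ∀ k, ∀ D : LinkDiagram n d, downSum D.path = k → Finsupp.single D 1 ∈ W := by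
    intro k
    induction k using Nat.strong_induction_on with
    | _ k ih =>
      intro D hD
      rcases eq_zigzag_or_exists hn D.good_path (fun x hx => D.path_bottom hx) D.height_path_end with
        h | ⟨j, hj, h1, h2, h3⟩
      · rw [← path_zigzagDiagram hn] at h
        rw [path_injective h]
        exact h0
      · obtain ⟨E, hE, h⟩ := D.exists_lower (R := R) hj h1 h2 h3
        rw [← h δ]
        exact hW _ _ (ih _ (hD ▸ hE) E rfl)
  induction x using Finsupp.induction_linear with
  | zero => exact W.zero_mem
  | add x y hx hy => exact W.add_mem hx hy
  | single D a =>
    have := W.smul_mem a (key _ D rfl)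
    rwa [Finsupp.smul_single', mul_one] at this

end LinkDiagram

/-! ### State sums as linear maps -/

namespace LinkDiagram

open StateSum TemperleyLieb

variable {n d : ℕ} {R : Type} [CommRing R]

/-- The linear extension of the state sum of diagrams. -/
noncomputable def stateSum (w : ℤ → Bool → R) : Span R n d →ₗ[R] ((Fin (n + d) → Bool) → R) :=
  Finsupp.linearCombination R fun D => coeff w D.partner

theorem stateSum_single (w : ℤ → Bool → R) (D : LinkDiagram n d) :
    stateSum w (Finsupp.single D 1) = coeff w D.partner := by
  rw [stateSum, Finsupp.linearCombination_single, one_smul]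

theorem stateSum_diagramVector (w : ℤ → Bool → R) {p : Fin (n + d) → Fin (n + d)}
    (hp : IsDiagramOrZero p) {s : Fin (n + d) → Bool} (hs : ∀ x, n ≤ x.val → s x = false) :
    stateSum w (diagramVector R p) s = coeff w p s := by
  rcases hp with ⟨D, rfl⟩ | ⟨-, x, hx, hpx⟩
  · rw [diagramVector_partner, stateSum_single]
  · rw [diagramVector_of_bottom hx hpx, map_zero, coeff_of_not_compatible, Pi.zero_apply]
    intro h
    have := h x
    rw [hs x hx, hs _ hpx] at this
    simp at this

/-- The Temperley--Lieb generator in terms of state sums: a cap at the positions `i`, `i + 1`,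
followed by a cup. -/
theorem stateSum_cupCapMap (w u : ℤ → Bool → R) (δ : R) (i : Fin (n - 1))
    {s : Fin (n + d) → Bool} (hbot : ∀ x, n ≤ x.val → s x = false)
    (hδ : ∑ t, u (height s i) t * w (height s i) t = δ)
    (hz : ∀ (k : ℕ) (t : Bool), height s k = height s i + step t →
      u (height s i) t * w (height s i + step t) (!t) = 1) (v : Span R n d) :
    stateSum w (cupCapMap δ i v) s = if s (right d i) = s (left d i) then 0 else
      w (height s i) (s (left d i)) *
        ∑ t, u (height s i) t * stateSum w v (setPair s (left d i) (right d i) t) := by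
  induction v using Finsupp.induction_linear with
  | zero => simp
  | add x y hx hy =>
    rw [map_add, map_add, Pi.add_apply, hx, hy, map_add]
    split_ifs
    · simp
    · simp only [Pi.add_apply, mul_add, Finset.sum_add_distrib]
  | single D a =>
    have ha : Finsupp.single D a = a • Finsupp.single D (1 : R) := by simp
    have hD : IsDiagramOrZero D.partner := Or.inl ⟨D, rfl⟩
    rw [ha, map_smul, map_smul, map_smul, cupCapMap_single, map_smul, Pi.smul_apply, Pi.smul_apply,
      reconnect_eq_join, stateSum_diagramVector w (hD.join i) hbot, ← reconnect_eq_join,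
      stateSum_single]
    split_ifs with h
    · rw [coeff_of_not_compatible, smul_zero, smul_zero]
      intro hc
      have := hc (left d i)
      rw [reconnect_eq_join, join_left, h] at this
      simp at this
    · have hs : s (right d i) = !s (left d i) := by
        revert h; cases s (right d i) <;> cases s (left d i) <;> simp
      rw [smul_eq_mul, smul_eq_mul, ← D.coeff_reconnect w u i hs δ hδ hz, Finset.mul_sum,
        Finset.mul_sum, Finset.mul_sum]
      refine Finset.sum_congr rfl fun t _ => ?_
      simp only [Pi.smul_apply, smul_eq_mul]
      ring

/-- The state sums of diagrams are linearly independent, as the path of a diagram is the highest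
state that is compatible with it. -/
theorem exists_stateSum_ne_zero [IsDomain R] (w : ℤ → Bool → R)
    (hw : ∀ (D : LinkDiagram n d) (x : Fin (n + d)), x < D.partner x →
      w (height D.path x) true ≠ 0)
    {v : Span R n d} (hv : v ≠ 0) : ∃ D : LinkDiagram n d, stateSum w v D.path ≠ 0 := by
  obtain ⟨D, hD, hmax⟩ := Finset.exists_max_image v.support (fun D => downSum D.path)
    (Finsupp.support_nonempty_iff.2 hv)
  refine ⟨D, ?_⟩
  rw [stateSum, Finsupp.linearCombination_apply, Finsupp.sum, Finset.sum_apply,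
    Finset.sum_eq_single D]
  · rw [Pi.smul_apply, smul_eq_mul, coeff_of_compatible D.compatible_path]
    refine mul_ne_zero (Finsupp.mem_support_iff.1 hD) (Finset.prod_ne_zero_iff.2 fun x _ => ?_)
    rw [arcWeight]
    split_ifs with h
    · have : D.path x = true := by simp [path, h]
      rw [this]
      exact hw D x h
    · exact one_ne_zero
  · intro E hE hne
    rw [Pi.smul_apply, coeff_of_not_compatible, smul_zero]
    intro hc
    have h := E.downSum_le hc
    exact hne (path_injective (h.2 (le_antisymm h.1 (hmax E hE))).symm)
  · intro h
    exact absurd hD h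

end LinkDiagram

/-! ### Counting steps -/

namespace StateSum

variable {M : ℕ}

/-- The number of up steps among the first `k` steps. -/
def upCount (s : Fin M → Bool) (k : ℕ) : ℕ :=
  (Finset.univ.filter fun y : Fin M => y.val < k ∧ s y = true).card

/-- The number of down steps among the first `k` steps. -/
def downCount (s : Fin M → Bool) (k : ℕ) : ℕ :=
  (Finset.univ.filter fun y : Fin M => y.val < k ∧ s y = false).card

theorem height_eq_counts (s : Fin M → Bool) (k : ℕ) :
    height s k = 1 + upCount s k - downCount s k := by
  rw [height, upCount, downCount, add_sub_assoc]
  congr 1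
  have : ∀ y : Fin M, step (s y) = (if s y = true then 1 else 0) - if s y = false then 1 else 0 := by
    intro y; cases s y <;> simp [step]
  simp only [this, Finset.sum_sub_distrib]
  rw [← Finset.sum_filter, ← Finset.sum_filter, Finset.filter_filter, Finset.filter_filter]
  simp

theorem filter_lt_succ (s : Fin M → Bool) (x : Fin M) (b : Bool) :
    (Finset.univ.filter fun y : Fin M => y.val < x + 1 ∧ s y = b) =
      if s x = b then insert x (Finset.univ.filter fun y : Fin M => y.val < x ∧ s y = b)
      else Finset.univ.filter fun y : Fin M => y.val < x ∧ s y = b := by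
  split_ifs with h
  · ext y
    simp only [Finset.mem_filter, Finset.mem_univ, true_and, Finset.mem_insert, Fin.ext_iff]
    constructor
    · rintro ⟨h1, h2⟩
      rcases Nat.lt_succ_iff_lt_or_eq.1 h1 with h3 | h3
      exacts [Or.inr ⟨h3, h2⟩, Or.inl h3]
    · rintro (h1 | ⟨h1, h2⟩)
      · exact ⟨by omega, by rw [Fin.ext h1, h]⟩
      · exact ⟨by omega, h2⟩
  · ext y
    simp only [Finset.mem_filter, Finset.mem_univ, true_and]
    constructor
    · rintro ⟨h1, h2⟩
      refine ⟨?_, h2⟩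
      rcases Nat.lt_succ_iff_lt_or_eq.1 h1 with h3 | h3
      · exact h3
      · exact absurd (Fin.ext h3 ▸ h2) h
    · exact fun h1 => ⟨by omega, h1.2⟩

theorem upCount_succ (s : Fin M → Bool) (x : Fin M) :
    upCount s (x + 1) = upCount s x + if s x then 1 else 0 := by
  rw [upCount, filter_lt_succ]
  split_ifs with h
  · rw [Finset.card_insert_of_notMem (by simp)]; rfl
  · rfl

theorem downCount_succ (s : Fin M → Bool) (x : Fin M) :
    downCount s (x + 1) = downCount s x + if s x then 0 else 1 := by
  rw [downCount, filter_lt_succ]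
  cases h : s x
  · rw [if_pos rfl, Finset.card_insert_of_notMem (by simp)]; simp [downCount]
  · simp [downCount]

theorem upCount_mono (s : Fin M → Bool) {j k : ℕ} (h : j ≤ k) : upCount s j ≤ upCount s k := by
  refine Finset.card_le_card fun y hy => ?_
  simp only [Finset.mem_filter, Finset.mem_univ, true_and] at hy ⊢
  exact ⟨by omega, hy.2⟩

theorem downCount_mono (s : Fin M → Bool) {j k : ℕ} (h : j ≤ k) :
    downCount s j ≤ downCount s k := by
  refine Finset.card_le_card fun y hy => ?_
  simp only [Finset.mem_filter, Finset.mem_univ, true_and] at hy ⊢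
  exact ⟨by omega, hy.2⟩

theorem upCount_add_downCount (s : Fin M → Bool) {k : ℕ} (hk : k ≤ M) :
    upCount s k + downCount s k = k := by
  induction k with
  | zero => simp [upCount, downCount]
  | succ k ih =>
    have h1 := upCount_succ s ⟨k, by omega⟩
    have h2 := downCount_succ s ⟨k, by omega⟩
    have h3 := ih (by omega)
    simp only at h1 h2
    rw [h1, h2]
    split_ifs <;> omega

theorem height_of_ge (s : Fin M → Bool) {k : ℕ} (hk : M ≤ k) : height s k = height s M := by
  rw [height, height]
  congr 2
  ext y
  have := y.2
  simp only [Finset.mem_filter, Finset.mem_univ, true_and]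
  omega

end StateSum

/-! ### Standard tableaux with two rows and lattice paths -/

theorem mem_twoRowDiagram {l d : ℕ} {x : ℕ × ℕ} :
    x ∈ (twoRowDiagram l d).cells ↔ (x.1 = 0 ∧ x.2 < l + d) ∨ (x.1 = 1 ∧ x.2 < l) := by
  rw [YoungDiagram.mem_cells, twoRowDiagram, YoungDiagram.mem_ofRowLens]
  obtain ⟨r, c⟩ := x
  constructor
  · rintro ⟨h, h'⟩
    simp only [List.length_cons, List.length_nil, Nat.reduceAdd] at h
    interval_cases r
    · exact Or.inl ⟨rfl, h'⟩
    · exact Or.inr ⟨rfl, h'⟩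
  · rintro (⟨h, h'⟩ | ⟨h, h'⟩) <;> simp only at h h' <;> subst h
    · exact ⟨by simp, h'⟩
    · exact ⟨by simp, h'⟩

theorem card_twoRowDiagram (l d : ℕ) : (twoRowDiagram l d).cells.card = 2 * l + d := by
  have h2 : (twoRowDiagram l d).cells =
      (Finset.range (l + d)).image (fun c => (0, c)) ∪ (Finset.range l).image (fun c => (1, c)) := by
    ext ⟨r, c⟩
    rw [mem_twoRowDiagram]
    simp only [Finset.mem_union, Finset.mem_image, Finset.mem_range, Prod.mk.injEq]
    constructor
    · rintro (h | h)
      · exact Or.inl ⟨c, h.2, h.1.symm, rfl⟩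
      · exact Or.inr ⟨c, h.2, h.1.symm, rfl⟩
    · rintro (⟨c', h, h', rfl⟩ | ⟨c', h, h', rfl⟩)
      · exact Or.inl ⟨h'.symm, h⟩
      · exact Or.inr ⟨h'.symm, h⟩
  rw [h2, Finset.card_union_of_disjoint, Finset.card_image_of_injective,
    Finset.card_image_of_injective, Finset.card_range, Finset.card_range]
  · ring
  · intro a b h; simpa using h
  · intro a b h; simpa using h
  · rw [Finset.disjoint_left]
    rintro ⟨r, c⟩ h h'
    simp only [Finset.mem_image, Prod.mk.injEq] at h h'
    obtain ⟨_, _, h, _⟩ := h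
    obtain ⟨_, _, h', _⟩ := h'
    omega

namespace StandardTableau

open StateSum

variable {l d n : ℕ}

/-- The lattice path of a tableau with two rows, with an up step for each entry of the first row and a
down step for each entry of the second one; it is prolonged by `d` down steps. -/
def path (t : StandardTableau (twoRowDiagram l d) n) (x : Fin (n + d)) : Bool :=
  if h : x.val < n then (t.cell ⟨x, h⟩).val.1 = 0 else false

theorem path_bottom (t : StandardTableau (twoRowDiagram l d) n) {x : Fin (n + d)}
    (h : n ≤ x.val) : t.path x = false := by
  rw [path, dif_neg (by omega)]

theorem row_cases (t : StandardTableau (twoRowDiagram l d) n) (k : Fin n) :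
    (t.cell k).val.1 = 0 ∧ (t.cell k).val.2 < l + d ∨
      (t.cell k).val.1 = 1 ∧ (t.cell k).val.2 < l :=
  mem_twoRowDiagram.1 (t.cell k).2

theorem path_eq_true_iff (t : StandardTableau (twoRowDiagram l d) n) (k : Fin n) :
    t.path (Fin.castAdd d k) = true ↔ (t.cell k).val.1 = 0 := by
  rw [path, dif_pos (by simp)]
  simp

theorem path_eq_false_iff (t : StandardTableau (twoRowDiagram l d) n) (k : Fin n) :
    t.path (Fin.castAdd d k) = false ↔ (t.cell k).val.1 = 1 := by
  rw [← Bool.not_eq_true, path_eq_true_iff]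
  rcases t.row_cases k with h | h <;> omega

theorem cell_injective (t : StandardTableau (twoRowDiagram l d) n) {j k : Fin n}
    (h1 : (t.cell j).val.1 = (t.cell k).val.1) (h2 : (t.cell j).val.2 = (t.cell k).val.2) : j = k :=
  t.cell.injective (Subtype.ext (Prod.ext h1 h2))

theorem lt_iff_col_lt (t : StandardTableau (twoRowDiagram l d) n) {j k : Fin n}
    (h : (t.cell j).val.1 = (t.cell k).val.1) : j < k ↔ (t.cell j).val.2 < (t.cell k).val.2 := by
  have key : ∀ j k : Fin n, (t.cell j).val.1 = (t.cell k).val.1 →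
      (t.cell j).val.2 < (t.cell k).val.2 → j < k := by
    intro j k h h'
    have := t.increasing (t.cell j) (t.cell k) (Prod.mk_le_mk.2 ⟨h.le, h'.le⟩)
    rw [Equiv.symm_apply_apply, Equiv.symm_apply_apply] at this
    refine lt_of_le_of_ne this fun e => ?_
    rw [e] at h'
    exact lt_irrefl _ h'
  refine ⟨fun hjk => ?_, key j k h⟩
  by_contra hcon
  rcases (not_lt.1 hcon).lt_or_eq with h' | h'
  · exact absurd (key k j h.symm h') hjk.not_gt
  · exact hjk.ne (t.cell_injective h h'.symm)

/-- The column of an entry is the number of smaller entries in its row. -/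
theorem col_eq_card (t : StandardTableau (twoRowDiagram l d) n) (k : Fin n) :
    (t.cell k).val.2 = (Finset.univ.filter fun y : Fin (n + d) =>
      y.val < k ∧ t.path y = t.path (Fin.castAdd d k)).card := by
  have hrow : ∀ j : Fin n, t.path (Fin.castAdd d j) = t.path (Fin.castAdd d k) ↔
      (t.cell j).val.1 = (t.cell k).val.1 := by
    intro j
    have h1 := t.row_cases j
    rcases t.row_cases k with ⟨h, -⟩ | ⟨h, -⟩
    · rw [(t.path_eq_true_iff k).2 h, path_eq_true_iff, h]
    · rw [(t.path_eq_false_iff k).2 h, path_eq_false_iff, h]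
  rw [← Finset.card_range (t.cell k).val.2]
  symm
  have hmem : ∀ c < (t.cell k).val.2, ((t.cell k).val.1, c) ∈ (twoRowDiagram l d).cells := by
    intro c hc
    rw [mem_twoRowDiagram]
    rcases t.row_cases k with h | h
    · exact Or.inl ⟨h.1, by simp only; omega⟩
    · exact Or.inr ⟨h.1, by simp only; omega⟩
  refine Finset.card_bij (fun y _ => if h : y.val < n then (t.cell ⟨y, h⟩).val.2 else 0) ?_ ?_ ?_
  · intro y hy
    simp only [Finset.mem_filter, Finset.mem_univ, true_and] at hy
    have hyn : y.val < n := by have := k.2; omega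
    rw [dif_pos hyn, Finset.mem_range]
    exact (t.lt_iff_col_lt ((hrow ⟨y, hyn⟩).1 hy.2)).1 (Fin.lt_def.2 hy.1)
  · intro y hy z hz h
    simp only [Finset.mem_filter, Finset.mem_univ, true_and] at hy hz
    have hyn : y.val < n := by have := k.2; omega
    have hzn : z.val < n := by have := k.2; omega
    rw [dif_pos hyn, dif_pos hzn] at h
    have := t.cell_injective
      (((hrow ⟨y, hyn⟩).1 hy.2).trans ((hrow ⟨z, hzn⟩).1 hz.2).symm) h
    exact Fin.ext (Fin.mk.inj_iff.1 this)
  · intro c hc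
    rw [Finset.mem_range] at hc
    set j := t.cell.symm ⟨_, hmem c hc⟩ with hj
    have hcell : t.cell j = ⟨_, hmem c hc⟩ := by rw [hj, Equiv.apply_symm_apply]
    refine ⟨Fin.castAdd d j, ?_, ?_⟩
    · simp only [Finset.mem_filter, Finset.mem_univ, true_and]
      refine ⟨?_, (hrow j).2 (by rw [hcell])⟩
      exact Fin.lt_def.1 ((t.lt_iff_col_lt (by rw [hcell])).2 (by rw [hcell]; exact hc))
    · rw [dif_pos (by simp)]
      simp [hcell]

theorem col_of_row_zero (t : StandardTableau (twoRowDiagram l d) n) {k : Fin n}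
    (h : (t.cell k).val.1 = 0) : (t.cell k).val.2 = upCount t.path k := by
  rw [col_eq_card, (t.path_eq_true_iff k).2 h, upCount]

theorem col_of_row_one (t : StandardTableau (twoRowDiagram l d) n) {k : Fin n}
    (h : (t.cell k).val.1 = 1) : (t.cell k).val.2 = downCount t.path k := by
  rw [col_eq_card, (t.path_eq_false_iff k).2 h, downCount]

theorem path_injective :
    Function.Injective (path : StandardTableau (twoRowDiagram l d) n → Fin (n + d) → Bool) := by
  intro t t' h
  ext1
  refine Equiv.ext fun k => Subtype.ext ?_
  have h1 := congrFun h (Fin.castAdd d k)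
  rcases t.row_cases k with ⟨e, -⟩ | ⟨e, -⟩
  · have e' : (t'.cell k).val.1 = 0 := by rwa [← path_eq_true_iff, ← h, path_eq_true_iff]
    exact Prod.ext (e.trans e'.symm) (by rw [t.col_of_row_zero e, t'.col_of_row_zero e', h])
  · have e' : (t'.cell k).val.1 = 1 := by rwa [← path_eq_false_iff, ← h, path_eq_false_iff]
    exact Prod.ext (e.trans e'.symm) (by rw [t.col_of_row_one e, t'.col_of_row_one e', h])

instance : Finite (StandardTableau (twoRowDiagram l d) n) :=
  Finite.of_injective _ path_injective

theorem downCount_path_le (t : StandardTableau (twoRowDiagram l d) n) {k : ℕ} (hk : k ≤ n) :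
    downCount t.path k ≤ upCount t.path k := by
  have hmem : ∀ j : Fin n, (t.cell j).val.1 = 1 →
      ((0, (t.cell j).val.2) : ℕ × ℕ) ∈ (twoRowDiagram l d).cells := by
    intro j hj
    rw [mem_twoRowDiagram]
    rcases t.row_cases j with h | h
    · omega
    · exact Or.inl ⟨rfl, by simp only; omega⟩
  -- the entry above an entry of the second row is smaller than it
  refine Finset.card_le_card_of_injOn (fun y => if h : ∃ hy : y.val < n,
    (t.cell ⟨y, hy⟩).val.1 = 1 then Fin.castAdd d (t.cell.symm ⟨_, hmem _ h.choose_spec⟩) else y) ?_ ?_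
  · intro y hy
    simp only [Finset.coe_filter, Finset.mem_univ, true_and, Set.mem_ofPred_eq] at hy ⊢
    have hy' : ∃ hy : y.val < n, (t.cell ⟨y, hy⟩).val.1 = 1 :=
      ⟨by omega, (t.path_eq_false_iff ⟨y, by omega⟩).1 hy.2⟩
    rw [dif_pos hy', path_eq_true_iff, Equiv.apply_symm_apply]
    refine ⟨?_, rfl⟩
    have := t.increasing ⟨_, hmem _ hy'.choose_spec⟩ (t.cell ⟨y, by omega⟩)
      (Prod.mk_le_mk.2 ⟨Nat.zero_le _, le_rfl⟩)
    rw [Equiv.symm_apply_apply, Fin.le_def] at this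
    simp only [Fin.val_castAdd]
    simp only at this
    omega
  · intro y hy z hz h
    simp only [Finset.coe_filter, Finset.mem_univ, true_and, Set.mem_ofPred_eq] at hy hz h
    have hy' : ∃ hy : y.val < n, (t.cell ⟨y, hy⟩).val.1 = 1 :=
      ⟨by omega, (t.path_eq_false_iff ⟨y, by omega⟩).1 hy.2⟩
    have hz' : ∃ hz : z.val < n, (t.cell ⟨z, hz⟩).val.1 = 1 :=
      ⟨by omega, (t.path_eq_false_iff ⟨z, by omega⟩).1 hz.2⟩
    rw [dif_pos hy', dif_pos hz'] at h
    have h1 := t.cell.symm.injective (Fin.castAdd_injective n d h)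
    have h2 := congrArg (fun x => x.val.2) h1
    simp only at h2
    have := t.cell_injective (hy'.choose_spec.trans hz'.choose_spec.symm) h2
    exact Fin.ext (Fin.mk.inj_iff.1 this)

theorem card_eq (t : StandardTableau (twoRowDiagram l d) n) : n = 2 * l + d := by
  have := Fintype.card_congr t.cell
  rwa [Fintype.card_fin, Fintype.card_coe, card_twoRowDiagram] at this

theorem card_row_le (t : StandardTableau (twoRowDiagram l d) n) (b : Bool) (B : ℕ)
    (hB : ∀ k, t.path (Fin.castAdd d k) = b → (t.cell k).val.2 < B) :
    (Finset.univ.filter fun y : Fin (n + d) => y.val < n ∧ t.path y = b).card ≤ B := by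
  have hrow : ∀ j k : Fin n, t.path (Fin.castAdd d j) = t.path (Fin.castAdd d k) →
      (t.cell j).val.1 = (t.cell k).val.1 := by
    intro j k h
    cases e : t.path (Fin.castAdd d k)
    · rw [e] at h
      rw [(t.path_eq_false_iff j).1 h, (t.path_eq_false_iff k).1 e]
    · rw [e] at h
      rw [(t.path_eq_true_iff j).1 h, (t.path_eq_true_iff k).1 e]
  refine le_of_le_of_eq (Finset.card_le_card_of_injOn (t := Finset.range B)
    (fun y => if h : y.val < n then (t.cell ⟨y, h⟩).val.2 else 0) ?_ ?_) (Finset.card_range B)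
  · intro y hy
    simp only [Finset.coe_filter, Finset.mem_univ, true_and, Set.mem_ofPred_eq] at hy
    simp only [dif_pos hy.1, Finset.coe_range, Set.mem_Iio]
    exact hB ⟨y, hy.1⟩ hy.2
  · intro y hy z hz h
    simp only [Finset.coe_filter, Finset.mem_univ, true_and, Set.mem_ofPred_eq] at hy hz
    simp only [dif_pos hy.1, dif_pos hz.1] at h
    have := t.cell_injective (hrow ⟨y, hy.1⟩ ⟨z, hz.1⟩ (hy.2.trans hz.2.symm)) h
    exact Fin.ext (Fin.mk.inj_iff.1 this)

theorem downCount_path_le_card (t : StandardTableau (twoRowDiagram l d) n) :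
    downCount t.path n ≤ l :=
  t.card_row_le _ _ fun k hk => by
    have := (t.path_eq_false_iff k).1 hk
    rcases t.row_cases k with h | h <;> omega

theorem upCount_path_le_card (t : StandardTableau (twoRowDiagram l d) n) :
    upCount t.path n ≤ l + d :=
  t.card_row_le _ _ fun k hk => by
    have := (t.path_eq_true_iff k).1 hk
    rcases t.row_cases k with h | h <;> omega

theorem height_path_top (t : StandardTableau (twoRowDiagram l d) n) : height t.path n = d + 1 := by
  have h1 := upCount_add_downCount t.path (k := n) (by omega)
  have h2 := t.downCount_path_le_card
  have h3 := t.upCount_path_le_card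
  have h4 := t.card_eq
  rw [height_eq_counts]
  omega

theorem height_path_end (t : StandardTableau (twoRowDiagram l d) n) : height t.path (n + d) = 1 := by
  rw [height_of_forall_down le_rfl (fun x hx _ => t.path_bottom hx), height_path_top]
  ring

theorem good_path (t : StandardTableau (twoRowDiagram l d) n) : Good t.path := by
  intro k
  rcases le_total k n with hk | hk
  · have := t.downCount_path_le hk
    rw [height_eq_counts]
    omega
  rcases le_total k (n + d) with hk' | hk'
  · obtain ⟨j, rfl⟩ := Nat.exists_eq_add_of_le hk
    rw [height_of_forall_down (by omega) (fun x hx _ => t.path_bottom hx), height_path_top]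
    omega
  · rw [height_of_ge _ hk', height_path_end]

/-- The tableau of a lattice path: the entries of the up steps form the first row. The columns increase
as the path never goes below height `1`. -/
theorem exists_path_eq (hn : n = 2 * l + d) {s : Fin (n + d) → Bool} (hs : Good s)
    (hbot : ∀ x, n ≤ x.val → s x = false) (hend : height s (n + d) = 1) :
    ∃ t : StandardTableau (twoRowDiagram l d) n, t.path = s := by
  have hhn : height s n = d + 1 := by
    have := height_of_forall_down (s := s) (a := n) (k := d) le_rfl (fun x hx _ => hbot x hx)
    linarith
  have hcount := upCount_add_downCount s (k := n) (by omega)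
  rw [height_eq_counts] at hhn
  have hu : upCount s n = l + d := by omega
  have hd : downCount s n = l := by omega
  have hmono : ∀ j k : Fin n, s (Fin.castAdd d j) = s (Fin.castAdd d k) → j < k →
      (if s (Fin.castAdd d j) then upCount s j else downCount s j) <
        if s (Fin.castAdd d k) then upCount s k else downCount s k := by
    intro j k h hjk
    rw [← h]
    split_ifs with hj
    · have h1 := upCount_succ s (Fin.castAdd d j)
      rw [if_pos hj] at h1
      have h2 := upCount_mono s (Nat.succ_le_of_lt (Fin.lt_def.1 hjk))
      simp only [Fin.val_castAdd] at h1
      simp only [Nat.succ_eq_add_one] at h2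
      omega
    · have h1 := downCount_succ s (Fin.castAdd d j)
      rw [if_neg hj] at h1
      have h2 := downCount_mono s (Nat.succ_le_of_lt (Fin.lt_def.1 hjk))
      simp only [Fin.val_castAdd] at h1
      simp only [Nat.succ_eq_add_one] at h2
      omega
  -- the row of `k` is given by its step, and the column by the number of equal steps before
  let f : Fin n → (twoRowDiagram l d).cells := fun k =>
    ⟨(if s (Fin.castAdd d k) then 0 else 1,
      if s (Fin.castAdd d k) then upCount s k else downCount s k), by
      rw [mem_twoRowDiagram]
      by_cases hk : s (Fin.castAdd d k) = true
      · refine Or.inl ⟨by simp [hk], ?_⟩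
        have h1 := upCount_succ s (Fin.castAdd d k)
        have h2 := upCount_mono s (Nat.succ_le_of_lt k.2)
        simp only [Fin.val_castAdd, hk, if_true] at h1 ⊢
        simp only [Nat.succ_eq_add_one] at h2
        omega
      · refine Or.inr ⟨by simp [hk], ?_⟩
        have h1 := downCount_succ s (Fin.castAdd d k)
        have h2 := downCount_mono s (Nat.succ_le_of_lt k.2)
        simp only [Fin.val_castAdd, hk] at h1 ⊢
        simp only [Nat.succ_eq_add_one] at h2
        simp at h1 ⊢
        omega⟩
  have hrow : ∀ j k, (f j).val.1 = (f k).val.1 → s (Fin.castAdd d j) = s (Fin.castAdd d k) := by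
    intro j k h
    simp only [f] at h
    cases h1 : s (Fin.castAdd d j) <;> cases h2 : s (Fin.castAdd d k) <;> simp [h1, h2] at h <;> rfl
  have hinj : Function.Injective f := by
    intro j k h
    have h1 := hrow j k (by rw [h])
    have h2 : (f j).val.2 = (f k).val.2 := by rw [h]
    rcases lt_trichotomy j k with h3 | h3 | h3
    · exact absurd h2 (hmono j k h1 h3).ne
    · exact h3
    · exact absurd h2.symm (hmono k j h1.symm h3).ne
  have hbij : Function.Bijective f := by
    rw [Fintype.bijective_iff_injective_and_card]
    refine ⟨hinj, ?_⟩
    rw [Fintype.card_fin, Fintype.card_coe, card_twoRowDiagram, hn]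
  refine ⟨⟨Equiv.ofBijective f hbij, fun x y hxy => ?_⟩, ?_⟩
  · obtain ⟨j, rfl⟩ := hbij.2 x
    obtain ⟨k, rfl⟩ := hbij.2 y
    rw [Equiv.ofBijective_symm_apply_apply, Equiv.ofBijective_symm_apply_apply]
    obtain ⟨h1, h2⟩ := Prod.le_def.1 hxy
    by_contra hcon
    have hkj := not_le.1 hcon
    by_cases hrowjk : s (Fin.castAdd d k) = s (Fin.castAdd d j)
    · exact absurd (hmono k j hrowjk hkj) h2.not_gt
    · have hj : s (Fin.castAdd d j) = true := by
        by_contra h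
        simp only [f, h] at h1
        cases hk : s (Fin.castAdd d k) <;> simp_all
      have hk : s (Fin.castAdd d k) = false := by
        rw [hj] at hrowjk; simpa using hrowjk
      simp only [f, hj, hk, if_true] at h2
      have h3 := hs (k + 1)
      have h4 := height_succ s (Fin.castAdd d k)
      simp only [Fin.val_castAdd, hk] at h4
      rw [h4, height_eq_counts, step] at h3
      have h5 := upCount_mono s (Fin.le_def.1 hkj.le)
      simp at h2 h3
      omega
  · funext x
    by_cases h : x.val < n
    · rw [path, dif_pos h]
      simp only [Equiv.ofBijective_apply, f]
      rw [show Fin.castAdd d ⟨x.val, h⟩ = x from rfl]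
      cases s x <;> simp
    · rw [path, dif_neg h]
      exact (hbot x (by omega)).symm

end StandardTableau

/-! ### Young's seminormal form -/

namespace StandardTableau

open StateSum

variable {l d n : ℕ}

/-- The entries `i` and `i + 1` can be exchanged unless they are neighbours in a row or in a
column. -/
theorem exchangeable_iff (t : StandardTableau (twoRowDiagram l d) n) (i : Fin (n - 1)) :
    t.Exchangeable i ↔ ¬ (t.cell (fst i)).val ≤ (t.cell (snd i)).val := by
  have hlt : fst i < snd i := by simp [fst, snd, Fin.lt_def]
  constructor
  · intro h hle
    have := h _ _ hle
    simp only [Equiv.symm_trans_apply, Equiv.symm_apply_apply, Equiv.symm_swap,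
      Equiv.swap_apply_left, Equiv.swap_apply_right] at this
    exact absurd this hlt.not_ge
  · intro h x y hxy
    have h1 := t.increasing x y hxy
    simp only [Equiv.symm_trans_apply, Equiv.symm_swap]
    have hx : t.cell (t.cell.symm x) = x := t.cell.apply_symm_apply x
    have hy : t.cell (t.cell.symm y) = y := t.cell.apply_symm_apply y
    generalize t.cell.symm x = a at *
    generalize t.cell.symm y = b at *
    subst hx hy
    rw [Equiv.swap_apply_def, Equiv.swap_apply_def]
    have ha : (fst i).val = i := rfl
    have hb : (snd i).val = i + 1 := rfl
    have hab : ¬ (a = fst i ∧ b = snd i) := by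
      rintro ⟨rfl, rfl⟩
      exact h hxy
    rw [Fin.le_def] at h1
    simp only [Fin.ext_iff] at hab ⊢
    rw [Fin.le_def]
    split_ifs <;> omega

variable (t : StandardTableau (twoRowDiagram l d) n) (i : Fin (n - 1))

theorem castAdd_fst : Fin.castAdd d (fst i) = LinkDiagram.left d i := rfl

theorem castAdd_snd : Fin.castAdd d (snd i) = LinkDiagram.right d i := rfl

theorem path_exchange (h : t.Exchangeable i) :
    (t.exchange i h).path = setPair t.path (LinkDiagram.left d i) (LinkDiagram.right d i)
      (t.path (LinkDiagram.right d i)) ∧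
    t.path (LinkDiagram.right d i) = !t.path (LinkDiagram.left d i) := by
  have hrow : t.path (LinkDiagram.right d i) = !t.path (LinkDiagram.left d i) := by
    by_contra hcon
    have e : t.path (LinkDiagram.right d i) = t.path (LinkDiagram.left d i) := by
      revert hcon
      cases t.path (LinkDiagram.right d i) <;> cases t.path (LinkDiagram.left d i) <;> simp
    rw [exchangeable_iff] at h
    refine h ?_
    have hlt : fst i < snd i := by simp [fst, snd, Fin.lt_def]
    have hr : (t.cell (fst i)).val.1 = (t.cell (snd i)).val.1 := by
      rw [← castAdd_fst, ← castAdd_snd] at e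
      rcases t.row_cases (fst i) with ⟨h1, -⟩ | ⟨h1, -⟩
      · rw [h1, (t.path_eq_true_iff _).1 (e.trans ((t.path_eq_true_iff _).2 h1))]
      · rw [h1, (t.path_eq_false_iff _).1 (e.trans ((t.path_eq_false_iff _).2 h1))]
    exact Prod.le_def.2 ⟨hr.le, ((t.lt_iff_col_lt hr).1 hlt).le⟩
  refine ⟨funext fun x => ?_, hrow⟩
  by_cases hx : x.val < n
  · have hcell : (t.exchange i h).path x = t.path (Fin.castAdd d
        (Equiv.swap (fst i) (snd i) ⟨x, hx⟩)) := by
      rw [path, path, dif_pos hx, dif_pos (by simp)]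
      rfl
    rw [hcell, Equiv.swap_apply_def]
    have h3 := LinkDiagram.left_ne_right (d := d) i
    split_ifs with h1 h2
    · have : x = LinkDiagram.left d i := Fin.ext (congrArg Fin.val h1 :)
      rw [this, setPair_left, castAdd_snd]
    · have : x = LinkDiagram.right d i := Fin.ext (congrArg Fin.val h2 :)
      rw [this, setPair_right _ h3, castAdd_fst, hrow, Bool.not_not]
    · rw [setPair_of_ne]
      · rfl
      · intro e; exact h1 (Fin.ext (show x.val = _ from congrArg Fin.val e))
      · intro e; exact h2 (Fin.ext (show x.val = _ from congrArg Fin.val e))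
  · have h1 := LinkDiagram.left_lt (d := d) i
    have h2 := LinkDiagram.right_lt (d := d) i
    rw [path_bottom _ (not_lt.1 hx), setPair_of_ne, path_bottom _ (not_lt.1 hx)]
    · rintro rfl; exact hx h1
    · rintro rfl; exact hx h2

theorem height_left_of_not_exchangeable (h : ¬ t.Exchangeable i)
    (hrow : t.path (LinkDiagram.right d i) = !t.path (LinkDiagram.left d i)) :
    t.path (LinkDiagram.left d i) = true ∧ height t.path i = 1 := by
  rw [exchangeable_iff, not_not, Prod.le_def] at h
  have h1 : t.path (LinkDiagram.left d i) = true := by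
    by_contra hcon
    rw [Bool.not_eq_true] at hcon
    rw [hcon, Bool.not_false, ← castAdd_snd, path_eq_true_iff] at hrow
    rw [← castAdd_fst, path_eq_false_iff] at hcon
    omega
  refine ⟨h1, ?_⟩
  have h2 := hrow
  rw [h1, Bool.not_true, ← castAdd_snd, path_eq_false_iff] at h2
  have h3 := h1
  rw [← castAdd_fst, path_eq_true_iff] at h3
  have h4 := t.col_of_row_zero h3
  have h5 := t.col_of_row_one h2
  have h6 := downCount_succ t.path (LinkDiagram.left d i)
  have h7 := t.good_path i
  rw [height_eq_counts] at h7 ⊢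
  rw [h1, if_pos rfl] at h6
  have h8 : (fst i).val = i := rfl
  have h9 : (snd i).val = i + 1 := rfl
  have h10 : (LinkDiagram.left d i).val = i := rfl
  rw [h8] at h4
  rw [h9] at h5
  rw [h10] at h6
  omega

theorem axialDistance_eq (hrow : t.path (LinkDiagram.right d i) = !t.path (LinkDiagram.left d i)) :
    t.axialDistance i = step (t.path (LinkDiagram.left d i)) * height t.path i := by
  have h5 : (LinkDiagram.left d i).val = i := rfl
  have h8 : (fst i).val = i := rfl
  have h9 : (snd i).val = i + 1 := rfl
  have hu := upCount_succ t.path (LinkDiagram.left d i)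
  have hd := downCount_succ t.path (LinkDiagram.left d i)
  rw [h5] at hu hd
  rw [axialDistance, content, content, height_eq_counts]
  cases h : t.path (LinkDiagram.left d i)
  · rw [h] at hrow hu hd
    rw [← castAdd_fst, path_eq_false_iff] at h
    rw [Bool.not_false, ← castAdd_snd, path_eq_true_iff] at hrow
    rw [t.col_of_row_one h, t.col_of_row_zero hrow, h, hrow, h8, h9, hu]
    simp [step]
    ring
  · rw [h] at hrow hu hd
    rw [← castAdd_fst, path_eq_true_iff] at h
    rw [Bool.not_true, ← castAdd_snd, path_eq_false_iff] at hrow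
    rw [t.col_of_row_zero h, t.col_of_row_one hrow, h, hrow, h8, h9, hd]
    simp [step]
    ring

theorem axialDistance_eq_neg_one
    (hrow : t.path (LinkDiagram.right d i) = t.path (LinkDiagram.left d i)) :
    t.axialDistance i = -1 := by
  have h5 : (LinkDiagram.left d i).val = i := rfl
  have h8 : (fst i).val = i := rfl
  have h9 : (snd i).val = i + 1 := rfl
  have hu := upCount_succ t.path (LinkDiagram.left d i)
  have hd := downCount_succ t.path (LinkDiagram.left d i)
  rw [h5] at hu hd
  rw [axialDistance, content, content]
  cases h : t.path (LinkDiagram.left d i)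
  · rw [h] at hrow hu hd
    rw [← castAdd_fst, path_eq_false_iff] at h
    rw [← castAdd_snd, path_eq_false_iff] at hrow
    rw [t.col_of_row_one h, t.col_of_row_one hrow, h, hrow, h8, h9, hd]
    simp
  · rw [h] at hrow hu hd
    rw [← castAdd_fst, path_eq_true_iff] at h
    rw [← castAdd_snd, path_eq_true_iff] at hrow
    rw [t.col_of_row_zero h, t.col_of_row_zero hrow, h, hrow, h8, h9, hu]
    simp

theorem not_exchangeable (hrow : t.path (LinkDiagram.right d i) = t.path (LinkDiagram.left d i)) :
    ¬ t.Exchangeable i := by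
  intro h
  have := (t.path_exchange i h).2
  rw [hrow] at this
  simp at this

theorem exchange_exchange (h : t.Exchangeable i) :
    ∃ h' : (t.exchange i h).Exchangeable i, (t.exchange i h).exchange i h' = t := by
  have e : (Equiv.swap (fst i) (snd i)).trans ((Equiv.swap (fst i) (snd i)).trans t.cell) =
      t.cell := by
    ext1 x; simp
  have h' : (t.exchange i h).Exchangeable i := by
    intro x y hxy
    have := t.increasing x y hxy
    rw [show (t.exchange i h).cell = (Equiv.swap (fst i) (snd i)).trans t.cell from rfl, e]
    exact this
  exact ⟨h', StandardTableau.ext e⟩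

open Classical in
/-- The matrix entries of Young's seminormal form, by rows. -/
theorem seminormalIdempotent_apply (q : ℂ) (f : StandardTableau (twoRowDiagram l d) n →₀ ℂ) :
    seminormalIdempotent q i f t = weight q (t.axialDistance i) * f t +
      if h : t.Exchangeable i then
        weight q ((t.exchange i h).axialDistance i) * f (t.exchange i h) else 0 := by
  induction f using Finsupp.induction_linear with
  | zero => simp
  | add f g hf hg =>
    rw [map_add, Finsupp.add_apply, hf, hg]
    split_ifs <;> simp only [Finsupp.add_apply] <;> ring
  | single t' a =>
    rw [seminormalIdempotent, Finsupp.linearCombination_single, Finsupp.smul_apply,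
      Finsupp.smul_apply, Finsupp.add_apply, smul_eq_mul, smul_eq_mul]
    have h1 : weight q (t'.axialDistance i) * Finsupp.single t' (1 : ℂ) t * a =
        weight q (t.axialDistance i) * Finsupp.single t' a t := by
      by_cases h : t' = t
      · subst h; simp
      · simp [h]
    have h2 : weight q (t'.axialDistance i) * (if h : t'.Exchangeable i then
        Finsupp.single (t'.exchange i h) (1 : ℂ) else 0) t * a =
        if h : t.Exchangeable i then
          weight q ((t.exchange i h).axialDistance i) * Finsupp.single t' a (t.exchange i h)
        else 0 := by
      by_cases hc : ∃ h : t.Exchangeable i, t.exchange i h = t'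
      · obtain ⟨h, rfl⟩ := hc
        obtain ⟨h', e⟩ := t.exchange_exchange i h
        rw [dif_pos h, dif_pos h', e]
        simp
      · have a1 : (if h : t'.Exchangeable i then
            Finsupp.single (t'.exchange i h) (1 : ℂ) else 0) t = 0 := by
          split_ifs with h
          · rw [Finsupp.single_apply, if_neg]
            intro e
            subst e
            exact hc (t'.exchange_exchange i h)
          · rfl
        rw [a1]
        split_ifs with h
        · rw [Finsupp.single_apply, if_neg (fun e => hc ⟨h, e.symm⟩)]
          simp
        · simp
    rw [mul_add, mul_comm a, ← h1, ← h2]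
    ring

end StandardTableau

/-! ### The Jones representation at a regular parameter -/

namespace LinkDiagram

open StateSum StandardTableau

/-- The quantum integer `[k]`, up to the sign `(-1)^k` and the factor `A² - A⁻²`. -/
noncomputable def signedQuantum (A : ℂˣ) (k : ℤ) : ℂ :=
  (-1) ^ k * ((A : ℂ) ^ (2 * k) - (A : ℂ) ^ (-(2 * k)))

theorem signedQuantum_zero (A : ℂˣ) : signedQuantum A 0 = 0 := by simp [signedQuantum]

theorem signedQuantum_neg (A : ℂˣ) (k : ℤ) : signedQuantum A (-k) = -signedQuantum A k := by
  have : ((-1 : ℂ) ^ (-k)) = (-1) ^ k := by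
    rw [zpow_neg, ← inv_zpow]; norm_num
  rw [signedQuantum, signedQuantum, this]
  ring_nf

theorem signedQuantum_ne_zero {A : ℂˣ} {k : ℤ} (h : ((A : ℂ) ^ 4) ^ k ≠ 1) :
    signedQuantum A k ≠ 0 := by
  have hA : (A : ℂ) ≠ 0 := A.ne_zero
  refine mul_ne_zero (zpow_ne_zero _ (by norm_num)) fun e => h ?_
  rw [sub_eq_zero] at e
  have : ((A : ℂ) ^ 4) ^ k = (A : ℂ) ^ (2 * k) * (A : ℂ) ^ (2 * k) := by
    rw [← zpow_add₀ hA, ← zpow_natCast, ← zpow_mul]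
    congr 1
    push_cast
    ring
  rw [this]
  nth_rewrite 2 [e]
  rw [← zpow_add₀ hA, add_neg_cancel, zpow_zero]

theorem loopValue_eq (A : ℂˣ) : loopValue A = -(A : ℂ) ^ 2 - (A : ℂ) ^ (-2 : ℤ) := by
  rw [loopValue, Units.val_inv_eq_inv_val, zpow_neg, inv_pow]
  norm_cast

theorem signedQuantum_add (A : ℂˣ) (k : ℤ) :
    signedQuantum A (k + 1) + signedQuantum A (k - 1) = loopValue A * signedQuantum A k := by
  have hA : (A : ℂ) ≠ 0 := A.ne_zero
  have h1 : (-1 : ℂ) ^ (k + 1) = -(-1) ^ k := by rw [zpow_add₀ (by norm_num)]; simp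
  have h2 : (-1 : ℂ) ^ (k - 1) = -(-1) ^ k := by rw [zpow_sub₀ (by norm_num)]; simp [div_neg]
  rw [signedQuantum, signedQuantum, signedQuantum, loopValue_eq, h1, h2,
    show 2 * (k + 1) = 2 * k + 2 by ring, show 2 * (k - 1) = 2 * k - 2 by ring,
    show -(2 * k + 2) = -(2 * k) - 2 by ring, show -(2 * k - 2) = -(2 * k) + 2 by ring,
    zpow_add₀ hA, zpow_sub₀ hA, zpow_add₀ hA, zpow_sub₀ hA, zpow_neg _ 2]
  norm_cast
  push_cast
  ring

/-- The coefficients of the seminormal form are ratios of consecutive quantum integers. -/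
theorem loopValue_mul_weight {A : ℂˣ} {k : ℤ} (h : ((A : ℂ) ^ 4) ^ k ≠ 1)
    (h1 : 1 + (A : ℂ) ^ 4 ≠ 0) :
    loopValue A * weight ((A : ℂ) ^ 4) k = signedQuantum A (k + 1) / signedQuantum A k := by
  have hA : (A : ℂ) ≠ 0 := A.ne_zero
  have hk := signedQuantum_ne_zero h
  rw [weight, eq_div_iff hk, ← mul_div_assoc, div_mul_eq_mul_div, div_eq_iff
    (mul_ne_zero h1 (sub_ne_zero.2 (Ne.symm h)))]
  have e1 : (-1 : ℂ) ^ (k + 1) = -(-1) ^ k := by rw [zpow_add₀ (by norm_num)]; simp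
  have e2 : ((A : ℂ) ^ 4) ^ k = (A : ℂ) ^ (2 * k) * (A : ℂ) ^ (2 * k) := by
    rw [← zpow_add₀ hA, ← zpow_natCast, ← zpow_mul]
    congr 1
    push_cast
    ring
  have e3 : ((A : ℂ) ^ 4) ^ (k + 1) = (A : ℂ) ^ (2 * k) * (A : ℂ) ^ (2 * k) * (A : ℂ) ^ 4 := by
    rw [zpow_add₀ (pow_ne_zero 4 hA), e2, zpow_one]
  have e4 : (A : ℂ) ^ (-(2 * k)) * (A : ℂ) ^ (2 * k) = 1 := by
    rw [← zpow_add₀ hA]; simp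
  rw [signedQuantum, signedQuantum, e1, e2, e3, loopValue_eq,
    show 2 * (k + 1) = 2 * k + 2 by ring, show -(2 * k + 2) = -(2 * k) - 2 by ring,
    zpow_add₀ hA, zpow_sub₀ hA, zpow_neg _ 2]
  generalize (A : ℂ) ^ (-(2 * k)) = y at *
  generalize (A : ℂ) ^ (2 * k) = x at *
  have hx : x ≠ 0 := by rintro rfl; simp at e4
  obtain rfl : y = x⁻¹ := eq_inv_of_mul_eq_one_left e4
  have : (A : ℂ) ^ (2 : ℤ) = (A : ℂ) ^ 2 := by norm_cast
  rw [this]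
  field_simp
  ring

/-- A parameter at which the seminormal form is defined, in terms of `A`. -/
structure RegularRoot (n : ℕ) (A : ℂˣ) : Prop where
  pow_ne : ∀ k : ℕ, 1 ≤ k → k ≤ n → ((A : ℂ) ^ 4) ^ k ≠ 1
  add_ne : 1 + (A : ℂ) ^ 4 ≠ 0

theorem regularRoot {n : ℕ} (hn : 2 ≤ n) {A : ℂˣ} (h : IsRegularParameter n ((A : ℂ) ^ 4)) :
    RegularRoot n A := by
  have h2 := h.2 2 le_rfl hn
  refine ⟨fun k hk hkn => ?_, fun e => h2 ?_⟩
  · rcases hk.eq_or_lt with rfl | hk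
    · intro e
      rw [pow_one] at e
      exact h2 (by rw [e, one_pow])
    · exact h.2 k hk hkn
  · rw [show (A : ℂ) ^ 4 = -1 by linear_combination e]; norm_num

variable {n l d : ℕ} {A : ℂˣ}

theorem RegularRoot.signedQuantum_ne (hA : RegularRoot n A) {k : ℤ} (h1 : 1 ≤ k) (h2 : k ≤ n) :
    signedQuantum A k ≠ 0 := by
  refine signedQuantum_ne_zero ?_
  obtain ⟨j, rfl⟩ := Int.eq_ofNat_of_zero_le (by omega : 0 ≤ k)
  rw [zpow_natCast]
  exact hA.pow_ne j (by omega) (by omega)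

/-- The state sum with the weights of the seminormal form. Paths that descend to the height `0` do
not contribute, as the corresponding coefficient of the cap is the quantum integer `[0] = 0`. -/
noncomputable def toTableaux (A : ℂˣ) (l : ℕ) :
    Span ℂ n d →ₗ[ℂ] (StandardTableau (twoRowDiagram l d) n →₀ ℂ) :=
  (Finsupp.linearEquivFunOnFinite ℂ ℂ _).symm.toLinearMap ∘ₗ
    LinearMap.funLeft ℂ ℂ StandardTableau.path ∘ₗ stateSum fun k _ => (signedQuantum A k)⁻¹

theorem toTableaux_apply (v : Span ℂ n d) (t : StandardTableau (twoRowDiagram l d) n) :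
    toTableaux A l v t = stateSum (fun k _ => (signedQuantum A k)⁻¹) v t.path := rfl

/-- Stacking becomes a seminormal idempotent. The local rule of the state sum and the seminormal form
are compared entry by entry; the entry at a path that descends to the height `0`, which has no tableau,
vanishes since `[0] = 0`. -/
theorem toTableaux_cupCapMap (hA : RegularRoot n A) (i : Fin (n - 1)) (v : Span ℂ n d) :
    toTableaux A l (cupCapMap (loopValue A) i v) =
      loopValue A • seminormalIdempotent ((A : ℂ) ^ 4) i (toTableaux A l v) := by
  ext t
  have hin := i.2
  have h1 : 1 ≤ height t.path i := t.good_path i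
  have h2 : height t.path i ≤ n := by have := height_le t.path i; omega
  have hy : signedQuantum A (height t.path i) ≠ 0 := hA.signedQuantum_ne h1 h2
  have hh : ∀ b, ((A : ℂ) ^ 4) ^ (step b * height t.path i) ≠ 1 := by
    obtain ⟨j, hj⟩ := Int.eq_ofNat_of_zero_le (by omega : 0 ≤ height t.path i)
    have := hA.pow_ne j (by omega) (by omega)
    intro b
    rw [hj]
    cases b
    · rw [step, if_neg Bool.false_ne_true, neg_one_mul, zpow_neg, zpow_natCast]
      exact fun e => this (inv_eq_one.1 e)
    · rw [step, if_pos rfl, one_mul, zpow_natCast]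
      exact this
  rw [toTableaux_apply, stateSum_cupCapMap (s := t.path) _ (fun k b => signedQuantum A (k + step b)) _ i
    (fun x hx => t.path_bottom hx), Finsupp.smul_apply, seminormalIdempotent_apply, smul_eq_mul]
  · by_cases hrow : t.path (right d i) = t.path (left d i)
    · rw [if_pos hrow, t.axialDistance_eq_neg_one i hrow, dif_neg (t.not_exchangeable i hrow), weight]
      simp
    have hrow' : t.path (right d i) = !t.path (left d i) := by
      revert hrow; cases t.path (right d i) <;> cases t.path (left d i) <;> simp
    rw [if_neg hrow, t.axialDistance_eq i hrow', mul_add, ← mul_assoc,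
      loopValue_mul_weight (hh _) hA.add_ne]
    have hratio : ∀ b, signedQuantum A (step b * height t.path i + 1) /
        signedQuantum A (step b * height t.path i) =
        (signedQuantum A (height t.path i))⁻¹ * signedQuantum A (height t.path i + step b) := by
      intro b
      cases b
      · rw [show step false = -1 from rfl, neg_one_mul, signedQuantum_neg,
          show -height t.path i + 1 = -(height t.path i + -1) by ring, signedQuantum_neg, neg_div_neg_eq,
          div_eq_inv_mul]
      · rw [show step true = 1 from rfl, one_mul, div_eq_inv_mul]
    have hsum : ∀ f : Bool → ℂ, ∀ b, ∑ c, f c = f b + f (!b) := by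
      intro f b; cases b <;> simp [add_comm]
    rw [hratio, hsum _ (t.path (left d i)), setPair_self t.path hrow', toTableaux_apply, mul_add,
      mul_assoc]
    congr 1
    split_ifs with hex
    · obtain ⟨e1, e2⟩ := t.path_exchange i hex
      have e3 : (t.exchange i hex).axialDistance i =
          step (!t.path (left d i)) * height t.path i := by
        rw [axialDistance_eq _ _ (by
          rw [e1, setPair_left, setPair_right _ (left_ne_right i)]), e1, setPair_left, hrow']
        congr 1
        exact height_setPair t.path _ rfl hrow' (by simp [right])
      rw [e3, ← mul_assoc (loopValue A), loopValue_mul_weight (hh _) hA.add_ne, hratio, toTableaux_apply, e1, hrow']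
      ring
    · obtain ⟨e1, e2⟩ := t.height_left_of_not_exchangeable i hex hrow'
      rw [e1, e2, Bool.not_true, show (1 : ℤ) + step false = 0 from rfl, signedQuantum_zero]
      ring
  · rw [Fintype.sum_bool, ← add_mul, show step true = 1 from rfl, show step false = -1 from rfl,
      ← sub_eq_add_neg, signedQuantum_add, mul_assoc, mul_inv_cancel₀ hy, mul_one]
  · intro k b hk
    refine mul_inv_cancel₀ ?_
    have := t.good_path k
    refine hA.signedQuantum_ne (by omega) ?_
    have := height_le t.path i
    have : step b ≤ 1 := by cases b <;> simp [step]
    omega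

end LinkDiagram

namespace LinkDiagram

open StateSum StandardTableau TemperleyLieb

variable {n l d : ℕ}

/-- The good paths are the paths of diagrams: a path in which two up steps are followed by a down
step comes from a lower one by stacking. -/
theorem exists_path_eq (hn : n = 2 * l + d) {s : Fin (n + d) → Bool} (hs : Good s)
    (hbot : ∀ x, n ≤ x.val → s x = false) (hend : height s (n + d) = 1) :
    ∃ D : LinkDiagram n d, D.path = s := by
  generalize hk : downSum s = k
  induction k using Nat.strong_induction_on generalizing s with
  | _ k ih =>
    rcases eq_zigzag_or_exists hn hs hbot hend with h | ⟨j, hj, h0, h1, h2⟩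
    · exact ⟨zigzagDiagram hn, by rw [path_zigzagDiagram, h]⟩
    set i : Fin (n - 1) := ⟨j, by omega⟩ with hi
    set i' : Fin (n - 1) := ⟨j + 1, by omega⟩ with hi'
    change s (left d i) = true at h0
    change s (left d i') = true at h1
    change s (right d i') = false at h2
    have hne : left d i' ≠ right d i' := left_ne_right i'
    have hne1 : left d i ≠ left d i' := by simp [left, hi, hi']
    have hne2 : left d i ≠ right d i' := by simp [left, right, hi, hi', add_assoc]
    have hrow : s (right d i') = !s (left d i') := by rw [h1, h2]; rfl
    have hlr : (left d i').val + 1 = (right d i').val := rfl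
    have hds := downSum_setPair s hlr h1 h2
    -- Replace the peak by a valley. In the diagram of the resulting path, the valley creates an arc
    -- between `left i` and the next point, and stacking turns it into an arc at the peak.
    set s' := setPair s (left d i') (right d i') false with hs'
    have hheight : ∀ k, k ≠ (right d i').val → height s' k = height s k :=
      fun k hk => height_setPair s false hlr hrow hk
    have hgood : Good s' := by
      intro k
      by_cases hk : k = (right d i').val
      · have e1 := height_succ s' (left d i')
        have e2 := height_succ s (left d i)
        have e3 : (left d i).val + 1 = (left d i').val := rfl
        have e4 := hs (left d i)
        rw [hlr, hheight (left d i').val (by omega), hs', setPair_left, ← hs'] at e1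
        rw [e3, h0] at e2
        rw [hk, e1, e2]
        simpa [step] using e4
      · rw [hheight k hk]
        exact hs k
    have hr := right_lt (d := d) i'
    obtain ⟨E, hE⟩ := ih (downSum s') (by omega) hgood (fun x hx => by
      rw [hs', setPair_of_ne _ _ (fun h => by rw [h] at hx; omega)
        (fun h => by rw [h] at hx; omega), hbot x hx])
      (by rw [hheight _ (by omega), hend]) rfl
    have hp : E.partner (left d i) = left d i' := by
      refine E.partner_of_peak rfl ?_ ?_
      · rw [hE, hs', setPair_of_ne _ _ hne1 hne2, h0]
      · rw [hE, hs', setPair_left]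
    have hm := E.isMatching
    have hp' : E.partner (left d i') = left d i := by rw [← hp, hm.invol]
    have hl := left_lt (d := d) i
    refine ⟨E.cupCap i' (by rw [hp']; exact hne2) (fun h => by rw [hp'] at h; omega), ?_⟩
    have hlt : left d i < left d i' := by simp [left, Fin.lt_def, hi, hi']
    have hlt' : left d i' < right d i' := by simp [left, right, Fin.lt_def]
    have hz : right d i' < E.partner (right d i') := by
      have : E.path (right d i') = true := by rw [hE, hs', setPair_right _ hne]; rfl
      simpa [path] using this
    have hpath : ∀ x, x ≠ left d i' → x ≠ right d i' → E.path x = s x := fun x hx hx' => by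
      rw [hE, hs', setPair_of_ne _ _ hx hx']
    funext x
    show decide (x < E.reconnect i' x) = _
    rcases E.reconnect_cases i' x with ⟨c1, c2⟩ | ⟨c1, c2⟩ | ⟨c1, c2⟩ | ⟨c1, c2⟩ | ⟨c1, c2, c3, c4, c5⟩
    · rw [c2, c1, h1]
      simpa using hlt'
    · rw [c2, c1, h2]
      simpa using hlt'.le
    · rw [c2, c1, hp', h0]
      simpa using (hlt.trans (hlt'.trans hz))
    · rw [c2, c1, hp', ← hpath _ (hlt'.trans hz).ne' hz.ne', E.compatible_path, hE, hs',
        setPair_right _ hne]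
      simpa using (hlt.trans (hlt'.trans hz)).le
    · rw [c5, ← hpath x c1 c2, path]

instance : Finite (LinkDiagram n d) := Finite.of_injective _ path_injective

theorem card_eq_card_tableaux (hn : n = 2 * l + d) :
    Nat.card (LinkDiagram n d) = Nat.card (StandardTableau (twoRowDiagram l d) n) := by
  choose f hf using fun D : LinkDiagram n d => StandardTableau.exists_path_eq hn D.good_path
    (fun x hx => D.path_bottom hx) D.height_path_end
  refine Nat.card_congr (Equiv.ofBijective f ⟨fun D E h => path_injective ?_, fun t => ?_⟩)
  · rw [← hf, ← hf, h]
  · obtain ⟨D, hD⟩ := exists_path_eq hn t.good_path (fun x hx => t.path_bottom hx)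
      t.height_path_end
    exact ⟨D, StandardTableau.path_injective ((hf D).trans hD)⟩

/-- No coefficient at the path of a diagram is lost, as that path comes from a tableau. -/
theorem toTableaux_injective {A : ℂˣ} (hA : RegularRoot n A) (hn : n = 2 * l + d) :
    Function.Injective (toTableaux A l : Span ℂ n d → _) := by
  refine (injective_iff_map_eq_zero _).2 fun v hv => by_contra fun hne => ?_
  have hw : ∀ (D : LinkDiagram n d) (x : Fin (n + d)), x < D.partner x →
      (signedQuantum A (height D.path x))⁻¹ ≠ 0 := by
    intro D x hx
    have h1 := height_le D.path x
    have h2 := D.good_path x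
    have h3 : x.val < n := by
      by_contra h
      have := D.through x (not_lt.1 h)
      rw [Fin.lt_def] at hx
      omega
    exact inv_ne_zero (hA.signedQuantum_ne h2 (by omega))
  obtain ⟨D, hD⟩ := exists_stateSum_ne_zero (fun k _ => (signedQuantum A k)⁻¹) hw hne
  obtain ⟨t, ht⟩ := StandardTableau.exists_path_eq hn D.good_path
    (fun x hx => D.path_bottom hx) D.height_path_end
  rw [← ht, ← toTableaux_apply, hv] at hD
  exact hD rfl

theorem toTableaux_jonesGen {A : ℂˣ} (hA : RegularRoot n A) (i : Fin (n - 1)) (v : Span ℂ n d) :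
    toTableaux A l (jonesGen A i v) = heckeGen ((A : ℂ) ^ 4) i (toTableaux A l v) := by
  have h0 : (A : ℂ) ≠ 0 := A.ne_zero
  rw [jonesGen_eq, LinearMap.add_apply, LinearMap.smul_apply, Module.End.one_apply, map_add,
    map_smul, toTableaux_cupCapMap hA, smul_smul, heckeGen, LinearMap.sub_apply,
    LinearMap.smul_apply, LinearMap.id_apply, sub_eq_add_neg, ← neg_smul]
  congr 2
  rw [loopValue, Units.val_inv_eq_inv_val]
  field_simp
  ring

/-- Operators on a space to which the Jones representations can be identified generator by generator
define a representation of the braid group, namely the transported one. -/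
theorem exists_representation {W : Type} [AddCommGroup W] [Module ℂ W]
    (g : Fin (n - 1) → W →ₗ[ℂ] W) {P : ℂˣ → Prop} (hP : ∃ A, P A)
    (h : ∀ A, P A → ∃ e : Span ℂ n d ≃ₗ[ℂ] W, ∀ i v, e (jonesGen A i v) = g i (e v)) :
    ∃ π : Representation ℂ (BraidGroup n) W, (∀ i, π (BraidGroup.gen i) = g i) ∧
      ∀ A, P A → Nonempty ((jonesRep n d A).Equiv π) := by
  obtain ⟨A₀, hA₀⟩ := hP
  obtain ⟨e₀, he₀⟩ := h A₀ hA₀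
  let π : Representation ℂ (BraidGroup n) W :=
    (e₀.conjRingEquiv : Module.End ℂ (Span ℂ n d) →* Module.End ℂ W).comp (jonesRep n d A₀)
  have hgen : ∀ i, π (BraidGroup.gen i) = g i := by
    intro i
    ext v
    have : e₀ (jonesRep n d A₀ (BraidGroup.gen i) (e₀.symm v)) = g i v := by
      rw [jonesRep_gen, he₀, e₀.apply_symm_apply]
    exact this
  refine ⟨π, hgen, fun A hA => ?_⟩
  obtain ⟨e, he⟩ := h A hA
  refine ⟨Representation.Equiv.mk e fun b => LinearMap.ext fun v => ?_⟩
  refine intertwine_of_gen (jonesRep n d A) π e (fun i v => ?_) b v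
  rw [hgen, jonesRep_gen, he]

theorem exists_heckeRepresentation (hn : n = 2 * l + d) (hn2 : 2 ≤ n) {q : ℂ}
    (hq : IsRegularParameter n q) :
    ∃ π : Representation ℂ (BraidGroup n) (StandardTableau (twoRowDiagram l d) n →₀ ℂ),
      (∀ i, π (BraidGroup.gen i) = heckeGen q i) ∧
        ∀ A : ℂˣ, (A : ℂ) ^ 4 = q → Nonempty ((jonesRep n d A).Equiv π) := by
  refine exists_representation _ ?_ fun A hA => ?_
  · obtain ⟨a, ha⟩ := IsAlgClosed.exists_pow_nat_eq q (n := 4) (by norm_num)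
    have ha0 : a ≠ 0 := by rintro rfl; exact hq.1 (by rw [← ha]; norm_num)
    exact ⟨Units.mk0 a ha0, ha⟩
  · subst hA
    have hA := regularRoot hn2 hq
    have := Fintype.ofFinite (LinkDiagram n d)
    have := Fintype.ofFinite (StandardTableau (twoRowDiagram l d) n)
    have hdim : Module.finrank ℂ (Span ℂ n d) =
        Module.finrank ℂ (StandardTableau (twoRowDiagram l d) n →₀ ℂ) := by
      rw [Module.finrank_finsupp_self, Module.finrank_finsupp_self, ← Nat.card_eq_fintype_card,
        ← Nat.card_eq_fintype_card, card_eq_card_tableaux hn]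
    refine ⟨(toTableaux A l).linearEquivOfInjective (toTableaux_injective hA hn) hdim,
      fun i v => ?_⟩
    exact toTableaux_jonesGen hA i v

end LinkDiagram

/-! ### Contractions of exterior algebras -/

namespace ExteriorAlgebra

variable {R M N : Type*} [CommRing R] [AddCommGroup M] [Module R M] [AddCommGroup N] [Module R N]

/-- The contraction with a linear form, an antiderivation of the exterior algebra. -/
noncomputable def contract (f : Module.Dual R M) :
    ExteriorAlgebra R M →ₗ[R] ExteriorAlgebra R M :=
  CliffordAlgebra.contractLeft f

theorem contract_one (f : Module.Dual R M) : contract f 1 = 0 :=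
  CliffordAlgebra.contractLeft_one (Q := 0) f

theorem contract_ι_mul (f : Module.Dual R M) (v : M) (z : ExteriorAlgebra R M) :
    contract f (ι R v * z) = f v • z - ι R v * contract f z :=
  CliffordAlgebra.contractLeft_ι_mul f v z

theorem contract_contract (f : Module.Dual R M) (z : ExteriorAlgebra R M) :
    contract f (contract f z) = 0 :=
  CliffordAlgebra.contractLeft_contractLeft f z

theorem contract_comm (f g : Module.Dual R M) (z : ExteriorAlgebra R M) :
    contract f (contract g z) = -contract g (contract f z) :=
  CliffordAlgebra.contractLeft_comm f g z

theorem contract_add (f g : Module.Dual R M) (z : ExteriorAlgebra R M) :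
    contract (f + g) z = contract f z + contract g z := by
  rw [contract, map_add]; rfl

theorem contract_sub (f g : Module.Dual R M) (z : ExteriorAlgebra R M) :
    contract (f - g) z = contract f z - contract g z := by
  rw [contract, map_sub]; rfl

theorem contract_smul (a : R) (f : Module.Dual R M) (z : ExteriorAlgebra R M) :
    contract (a • f) z = a • contract f z := by
  rw [contract, map_smul]; rfl

theorem contract_sum {J : Type*} (s : Finset J) (f : J → Module.Dual R M)
    (z : ExteriorAlgebra R M) : contract (∑ i ∈ s, f i) z = ∑ i ∈ s, contract (f i) z := by
  rw [contract, map_sum, LinearMap.sum_apply]; rfl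

theorem ι_mul_ι_mul_self (v : M) (z : ExteriorAlgebra R M) : ι R v * (ι R v * z) = 0 := by
  rw [← mul_assoc, ι_sq_zero, zero_mul]

theorem ι_mul_ι_mul_comm (v w : M) (z : ExteriorAlgebra R M) :
    ι R v * (ι R w * z) = -(ι R w * (ι R v * z)) := by
  rw [← mul_assoc, ← mul_assoc, eq_neg_iff_add_eq_zero, ← add_mul, ι_add_mul_swap, zero_mul]

/-- Induction over products of vectors. -/
theorem ι_mul_induction {P : ExteriorAlgebra R M → Prop} (z : ExteriorAlgebra R M)
    (algebraMap : ∀ r : R, P (algebraMap R _ r)) (add : ∀ x y, P x → P y → P (x + y))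
    (ι_mul : ∀ x v, P x → P (ι R v * x)) : P z :=
  CliffordAlgebra.left_induction (Q := 0) (P := P) algebraMap add ι_mul z

theorem contract_map (t : M →ₗ[R] N) (f : Module.Dual R N) (z : ExteriorAlgebra R M) :
    contract f (map t z) = map t (contract (f ∘ₗ t) z) := by
  induction z using ι_mul_induction with
  | algebraMap r => simp [Algebra.algebraMap_eq_smul_one, contract_one]
  | add x y hx hy => simp [hx, hy]
  | ι_mul x v hx =>
    rw [map_mul, map_apply_ι, contract_ι_mul, hx, contract_ι_mul, map_sub, map_smul, map_mul,
      map_apply_ι]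
    rfl

/-- The operator `z ↦ v ∧ (f ⌟ z)`. -/
noncomputable def wedgeContract (v : M) (f : Module.Dual R M) :
    ExteriorAlgebra R M →ₗ[R] ExteriorAlgebra R M :=
  LinearMap.mulLeft R (ι R v) ∘ₗ contract f

theorem wedgeContract_apply (v : M) (f : Module.Dual R M) (z : ExteriorAlgebra R M) :
    wedgeContract v f z = ι R v * contract f z := rfl

theorem wedgeContract_one (v : M) (f : Module.Dual R M) : wedgeContract v f 1 = 0 := by
  rw [wedgeContract_apply, contract_one, mul_zero]

/-- `z ↦ v ∧ (f ⌟ z)` is the derivation that extends the endomorphism `x ↦ f x • v`. -/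
theorem wedgeContract_ι_mul (v : M) (f : Module.Dual R M) (x : M) (z : ExteriorAlgebra R M) :
    wedgeContract v f (ι R x * z) = f x • (ι R v * z) + ι R x * wedgeContract v f z := by
  rw [wedgeContract_apply, contract_ι_mul, mul_sub, ι_mul_ι_mul_comm, wedgeContract_apply,
    mul_smul_comm, sub_neg_eq_add]

theorem map_wedgeContract (t : M →ₗ[R] N) (v : M) (f : Module.Dual R N) (z : ExteriorAlgebra R M) :
    map t (wedgeContract v (f ∘ₗ t) z) = wedgeContract (t v) f (map t z) := by
  rw [wedgeContract_apply, wedgeContract_apply, map_mul, map_apply_ι, contract_map]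

/-- A transvection acts on the exterior algebra as `1` plus the corresponding derivation. -/
theorem map_transvection {t : M →ₗ[R] M} {v : M} {f : Module.Dual R M} (ht : ∀ x, t x = x + f x • v)
    (z : ExteriorAlgebra R M) :
    map t z = z + wedgeContract v f z := by
  induction z using ι_mul_induction with
  | algebraMap r => simp [Algebra.algebraMap_eq_smul_one, wedgeContract_one]
  | add x y hx hy => rw [map_add, hx, hy, map_add]; abel
  | ι_mul z x hz =>
    rw [map_mul, map_apply_ι, hz, ht, wedgeContract_ι_mul, map_add, map_smul, add_mul, mul_add,
      smul_mul_assoc, mul_add, wedgeContract_apply, ι_mul_ι_mul_self, add_zero]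
    abel

theorem exteriorPower_induction {k : ℕ} {P : ℕ → ExteriorAlgebra R M → Prop}
    (algebraMap : ∀ r : R, P 0 (algebraMap R _ r)) (add : ∀ k x y, P k x → P k y → P k (x + y))
    (ι_mul : ∀ k x v, P k x → P (k + 1) (ι R v * x)) {z : ExteriorAlgebra R M}
    (hz : z ∈ ⋀[R]^k M) : P k z := by
  refine Submodule.pow_induction_on_left' _ (C := fun k z _ => P k z) algebraMap
    (fun x y i _ _ hx hy => add i x y hx hy) ?_ hz
  rintro m ⟨v, rfl⟩ i x _ hx
  exact ι_mul i x v hx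

theorem ι_mul_mem {k : ℕ} (v : M) {z : ExteriorAlgebra R M} (hz : z ∈ ⋀[R]^k M) :
    ι R v * z ∈ ⋀[R]^(k + 1) M := by
  rw [exteriorPower, pow_succ']
  exact Submodule.mul_mem_mul (LinearMap.mem_range_self _ v) hz

theorem one_mem : (1 : ExteriorAlgebra R M) ∈ ⋀[R]^0 M := by
  rw [exteriorPower, pow_zero]; exact Submodule.one_le.1 le_rfl

theorem contract_mem (f : Module.Dual R M) {k : ℕ} {z : ExteriorAlgebra R M}
    (hz : z ∈ ⋀[R]^k M) : contract f z ∈ ⋀[R]^(k - 1) M ∧ (k = 0 → contract f z = 0) := by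
  refine exteriorPower_induction (P := fun k z =>
    z ∈ ⋀[R]^k M ∧ contract f z ∈ ⋀[R]^(k - 1) M ∧ (k = 0 → contract f z = 0)) ?_ ?_ ?_ hz |>.2
  · intro r
    rw [Algebra.algebraMap_eq_smul_one, map_smul, contract_one, smul_zero]
    exact ⟨Submodule.smul_mem _ _ one_mem, Submodule.zero_mem _, fun _ => rfl⟩
  · rintro k x y ⟨hx, hx', hx''⟩ ⟨hy, hy', hy''⟩
    rw [map_add]
    exact ⟨add_mem hx hy, add_mem hx' hy', fun h => by rw [hx'' h, hy'' h, add_zero]⟩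
  · rintro k x v ⟨hx, hx', hx''⟩
    refine ⟨ι_mul_mem v hx, ?_, fun h => by omega⟩
    rw [contract_ι_mul, Nat.add_sub_cancel]
    refine sub_mem (Submodule.smul_mem _ _ hx) ?_
    rcases k with - | k
    · rw [hx'' rfl, mul_zero]; exact Submodule.zero_mem _
    · exact ι_mul_mem v hx'

end ExteriorAlgebra

/-! ### The Lefschetz operators of a symplectic basis -/

open ExteriorAlgebra in
/-- A symplectic basis `a_k`, `b_k` together with its dual basis. -/
structure SymplecticFrame (M : Type*) [AddCommGroup M] [Module ℂ M] (n : ℕ) where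
  a : Fin n → M
  b : Fin n → M
  α : Fin n → Module.Dual ℂ M
  β : Fin n → Module.Dual ℂ M
  α_a : ∀ j k, α j (a k) = if j = k then 1 else 0
  α_b : ∀ j k, α j (b k) = 0
  β_a : ∀ j k, β j (a k) = 0
  β_b : ∀ j k, β j (b k) = if j = k then 1 else 0
  sum_eq : ∀ x, ∑ k, (α k x • a k + β k x • b k) = x

namespace SymplecticFrame

open ExteriorAlgebra

variable {M : Type*} [AddCommGroup M] [Module ℂ M] {n : ℕ} (F : SymplecticFrame M n)

/-- The bivector `∑ a_k ∧ b_k`. -/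
noncomputable def bivector : ExteriorAlgebra ℂ M := ∑ k, ι ℂ (F.a k) * ι ℂ (F.b k)

/-- The contraction with the symplectic form, the adjoint of the multiplication with the
bivector. -/
noncomputable def lower : ExteriorAlgebra ℂ M →ₗ[ℂ] ExteriorAlgebra ℂ M :=
  ∑ k, contract (F.β k) ∘ₗ contract (F.α k)

theorem lower_apply (z : ExteriorAlgebra ℂ M) :
    F.lower z = ∑ k, contract (F.β k) (contract (F.α k) z) := by
  simp [lower]

/-- The linear form `x ↦ ⟨c, x⟩` for the symplectic form with `⟨a_k, b_k⟩ = 1`. -/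
noncomputable def pairing (c : M) : Module.Dual ℂ M := ∑ k, (F.α k c • F.β k - F.β k c • F.α k)

theorem pairing_apply (c x : M) :
    F.pairing c x = ∑ k, (F.α k c * F.β k x - F.β k c * F.α k x) := by
  simp [pairing]

theorem contract_pairing (c : M) (z : ExteriorAlgebra ℂ M) : contract (F.pairing c) z =
    ∑ k, (F.α k c • contract (F.β k) z - F.β k c • contract (F.α k) z) := by
  rw [pairing, contract_sum]
  exact Finset.sum_congr rfl fun k _ => by rw [contract_sub, contract_smul, contract_smul]

theorem bivector_mul (z : ExteriorAlgebra ℂ M) :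
    F.bivector * z = ∑ k, ι ℂ (F.a k) * (ι ℂ (F.b k) * z) := by
  rw [bivector, Finset.sum_mul]
  exact Finset.sum_congr rfl fun k _ => mul_assoc _ _ _

theorem lower_ι_mul (c : M) (z : ExteriorAlgebra ℂ M) :
    F.lower (ι ℂ c * z) = contract (F.pairing c) z + ι ℂ c * F.lower z := by
  rw [lower_apply, lower_apply, contract_pairing, Finset.mul_sum, ← Finset.sum_add_distrib]
  refine Finset.sum_congr rfl fun k _ => ?_
  rw [contract_ι_mul, map_sub, map_smul, contract_ι_mul]
  abel

theorem lower_contract (f : Module.Dual ℂ M) (z : ExteriorAlgebra ℂ M) :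
    F.lower (contract f z) = contract f (F.lower z) := by
  rw [lower_apply, lower_apply, map_sum]
  refine Finset.sum_congr rfl fun k _ => ?_
  rw [contract_comm _ f, map_neg, contract_comm _ f, neg_neg]

theorem lower_wedgeContract (c : M) (z : ExteriorAlgebra ℂ M) :
    F.lower (wedgeContract c (F.pairing c) z) = wedgeContract c (F.pairing c) (F.lower z) := by
  rw [wedgeContract_apply, lower_ι_mul, contract_contract, zero_add, lower_contract,
    wedgeContract_apply]

theorem lower_mem {k : ℕ} {z : ExteriorAlgebra ℂ M} (hz : z ∈ ⋀[ℂ]^k M) :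
    F.lower z ∈ ⋀[ℂ]^(k - 2) M ∧ (k < 2 → F.lower z = 0) := by
  rw [lower_apply]
  refine ⟨Submodule.sum_mem _ fun j _ => ?_, fun hk => Finset.sum_eq_zero fun j _ => ?_⟩
  · exact (contract_mem _ (contract_mem _ hz).1).1
  · refine (contract_mem _ (contract_mem _ hz).1).2 (by omega)

theorem bivector_mul_mem {k : ℕ} {z : ExteriorAlgebra ℂ M} (hz : z ∈ ⋀[ℂ]^k M) :
    F.bivector * z ∈ ⋀[ℂ]^(k + 2) M := by
  rw [bivector_mul]
  exact Submodule.sum_mem _ fun j _ => ι_mul_mem _ (ι_mul_mem _ hz)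

/-- The derivation that extends the identity multiplies by the degree. -/
theorem sum_wedgeContract {k : ℕ} {z : ExteriorAlgebra ℂ M} (hz : z ∈ ⋀[ℂ]^k M) :
    ∑ j, (wedgeContract (F.a j) (F.α j) z + wedgeContract (F.b j) (F.β j) z) = (k : ℂ) • z := by
  refine exteriorPower_induction (P := fun k z => ∑ j, (wedgeContract (F.a j) (F.α j) z +
    wedgeContract (F.b j) (F.β j) z) = (k : ℂ) • z) ?_ ?_ ?_ hz
  · intro r
    simp [Algebra.algebraMap_eq_smul_one, wedgeContract_one]
  · intro k x y hx hy
    rw [smul_add, ← hx, ← hy, ← Finset.sum_add_distrib]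
    refine Finset.sum_congr rfl fun j _ => ?_
    rw [map_add, map_add]; abel
  · intro k x v hx
    have : ∀ j, wedgeContract (F.a j) (F.α j) (ι ℂ v * x) + wedgeContract (F.b j) (F.β j)
        (ι ℂ v * x) = ι ℂ (F.α j v • F.a j + F.β j v • F.b j) * x +
        ι ℂ v * (wedgeContract (F.a j) (F.α j) x + wedgeContract (F.b j) (F.β j) x) := by
      intro j
      rw [wedgeContract_ι_mul, wedgeContract_ι_mul, map_add, map_smul, map_smul, add_mul, mul_add,
        smul_mul_assoc, smul_mul_assoc]
      abel
    rw [Finset.sum_congr rfl fun j _ => this j, Finset.sum_add_distrib, ← Finset.mul_sum, hx,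
      ← Finset.sum_mul, ← map_sum, F.sum_eq, mul_smul_comm]
    push_cast
    rw [add_smul, one_smul, add_comm]

/-- The commutator of the Lefschetz operators is the degree, up to a shift and the sign. -/
theorem lower_bivector_mul {k : ℕ} {z : ExteriorAlgebra ℂ M} (hz : z ∈ ⋀[ℂ]^k M) :
    F.lower (F.bivector * z) = F.bivector * F.lower z + ((n : ℂ) - k) • z := by
  have h1 : ∀ j, contract (F.pairing (F.a j)) = contract (F.β j) := by
    intro j
    refine LinearMap.ext fun z => ?_
    rw [contract_pairing, Finset.sum_eq_single j]
    · simp [F.α_a, F.β_a]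
    · intro i _ h; simp [F.α_a, F.β_a, h]
    · simp
  have h2 : ∀ j, contract (F.pairing (F.b j)) = -contract (F.α j) := by
    intro j
    refine LinearMap.ext fun z => ?_
    rw [contract_pairing, Finset.sum_eq_single j]
    · simp [F.α_b, F.β_b]
    · intro i _ h; simp [F.α_b, F.β_b, h]
    · simp
  rw [sub_smul, ← F.sum_wedgeContract hz, bivector_mul, map_sum, bivector_mul]
  have h3 : ∀ j, F.lower (ι ℂ (F.a j) * (ι ℂ (F.b j) * z)) =
      ι ℂ (F.a j) * (ι ℂ (F.b j) * F.lower z) + z -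
        (wedgeContract (F.a j) (F.α j) z + wedgeContract (F.b j) (F.β j) z) := by
    intro j
    rw [lower_ι_mul, lower_ι_mul, h1, h2, contract_ι_mul, F.β_b, if_pos rfl, one_smul, mul_add,
      LinearMap.neg_apply, mul_neg, wedgeContract_apply, wedgeContract_apply]
    abel
  rw [Finset.sum_congr rfl fun j _ => h3 j, Finset.sum_sub_distrib, Finset.sum_add_distrib,
    Finset.sum_const, Finset.card_univ, Fintype.card_fin, ← Nat.cast_smul_eq_nsmul ℂ]
  abel

/-- In low degrees the operator `z ↦ ω ∧ (ω ⌟ z)` has no negative integer eigenvalue: by the commutator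
of the Lefschetz operators, the contraction of an eigenvector is an eigenvector for a negative integer
in a lower degree. -/
theorem eq_zero_of_bivector_mul_lower {k : ℕ} {z : ExteriorAlgebra ℂ M} (hz : z ∈ ⋀[ℂ]^k M)
    {μ : ℕ} (hμ : 0 < μ) (hk : k ≤ n + 1) (h : F.bivector * F.lower z = -(μ : ℂ) • z) : z = 0 := by
  induction k using Nat.strong_induction_on generalizing z μ with
  | _ k ih =>
    have hμ0 : (-(μ : ℂ)) ≠ 0 := neg_ne_zero.2 (Nat.cast_ne_zero.2 hμ.ne')
    have key : F.lower z = 0 := by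
      by_cases hk2 : k < 2
      · exact (F.lower_mem hz).2 hk2
      have hmem := (F.lower_mem hz).1
      refine ih (k - 2) (by omega) hmem (μ := μ + (n - (k - 2))) (by omega) (by omega) ?_
      have h1 := F.lower_bivector_mul hmem
      rw [h, map_smul] at h1
      rw [eq_sub_of_add_eq h1.symm, ← sub_smul]
      congr 1
      push_cast [show k - 2 ≤ n by omega]
      ring
    rw [key, mul_zero] at h
    exact (smul_eq_zero.1 h.symm).resolve_left hμ0

/-- In degrees below the middle, the multiplication with the bivector is injective, and its image
meets the kernel of its adjoint trivially. -/
theorem eq_zero_of_lower_bivector_mul {k : ℕ} {z : ExteriorAlgebra ℂ M} (hz : z ∈ ⋀[ℂ]^k M)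
    (hk : k < n) (h : F.lower (F.bivector * z) = 0) : z = 0 := by
  refine F.eq_zero_of_bivector_mul_lower hz (μ := n - k) (by omega) (by omega) ?_
  rw [F.lower_bivector_mul hz] at h
  rw [eq_neg_of_add_eq_zero_left h, neg_smul]
  push_cast [hk.le]
  rfl

/-- Transvections preserve the bivector. -/
theorem map_bivector {t : M →ₗ[ℂ] M} {c : M} (ht : ∀ x, t x = x + F.pairing c x • c) :
    map t F.bivector = F.bivector := by
  rw [map_transvection ht, wedgeContract_apply]
  have h1 : ∀ j, F.pairing c (F.a j) = -F.β j c := by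
    intro j
    rw [pairing_apply, Finset.sum_eq_single j]
    · simp [F.α_a, F.β_a]
    · intro i _ h; simp [F.α_a, F.β_a, h]
    · simp
  have h2 : ∀ j, F.pairing c (F.b j) = F.α j c := by
    intro j
    rw [pairing_apply, Finset.sum_eq_single j]
    · simp [F.α_b, F.β_b]
    · intro i _ h; simp [F.α_b, F.β_b, h]
    · simp
  have h3 : contract (F.pairing c) F.bivector = -ι ℂ c := by
    conv_rhs => rw [← F.sum_eq c]
    rw [bivector, map_sum, map_sum, ← Finset.sum_neg_distrib]
    refine Finset.sum_congr rfl fun j _ => ?_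
    rw [contract_ι_mul, ← mul_one (ι ℂ (F.b j)), contract_ι_mul, contract_one, h1, h2]
    simp
    abel
  rw [h3, mul_neg, ι_sq_zero, neg_zero, add_zero]

end SymplecticFrame

/-! ### The state sum at a fourth root of `-1` -/

namespace StateSum

open ExteriorAlgebra

variable {M N : Type*} [AddCommGroup M] [Module ℂ M] [AddCommGroup N] [Module ℂ N]
  (κ : ℂ) (α : ℕ → M)

/-- The factor of the site `k`: a scaled vector for a down step and `1` for an up step. -/
noncomputable def site (b : Bool) (k : ℕ) : ExteriorAlgebra ℂ M :=
  if b then 1 else κ ^ k • ι ℂ (α k)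

/-- The product of the factors of the sites `a, …, a + k - 1` in increasing order. -/
noncomputable def fock (s : ℕ → Bool) : ℕ → ℕ → ExteriorAlgebra ℂ M
  | _, 0 => 1
  | a, k + 1 => site κ α (s a) a * fock s (a + 1) k

variable {κ α}

theorem fock_zero (s : ℕ → Bool) (a : ℕ) : fock κ α s a 0 = 1 := rfl

theorem fock_succ (s : ℕ → Bool) (a k : ℕ) :
    fock κ α s a (k + 1) = site κ α (s a) a * fock κ α s (a + 1) k := rfl

theorem fock_add (s : ℕ → Bool) (a j k : ℕ) :
    fock κ α s a (j + k) = fock κ α s a j * fock κ α s (a + j) k := by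
  induction j generalizing a with
  | zero => simp [fock_zero]
  | succ j ih => rw [Nat.succ_add, fock_succ, ih, fock_succ, mul_assoc, Nat.succ_add_eq_add_succ]

theorem fock_congr {s t : ℕ → Bool} {a k : ℕ} (h : ∀ x, a ≤ x → x < a + k → s x = t x) :
    fock κ α s a k = fock κ α t a k := by
  induction k generalizing a with
  | zero => rfl
  | succ k ih =>
    rw [fock_succ, fock_succ, h a le_rfl (by omega), ih fun x h1 h2 => h x (by omega) (by omega)]

theorem fock_of_forall_up {s : ℕ → Bool} {a k : ℕ} (h : ∀ x, a ≤ x → x < a + k → s x = true) :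
    fock κ α s a k = 1 := by
  induction k generalizing a with
  | zero => rfl
  | succ k ih =>
    rw [fock_succ, h a le_rfl (by omega), ih fun x h1 h2 => h x (by omega) (by omega)]
    simp [site]

theorem map_fock (p : M →ₗ[ℂ] N) (s : ℕ → Bool) (a k : ℕ) :
    map p (fock κ α s a k) = fock κ (fun x => p (α x)) s a k := by
  induction k generalizing a with
  | zero => rw [fock_zero, fock_zero, map_one]
  | succ k ih =>
    rw [fock_succ, fock_succ, map_mul, ih, site, site]
    split_ifs
    · rw [map_one]
    · rw [map_smul, map_apply_ι]

theorem wedgeContract_fock_mul (c : M) {f : Module.Dual ℂ M} {a k : ℕ} (s : ℕ → Bool)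
    (h : ∀ x, a ≤ x → x < a + k → f (α x) = 0) (z : ExteriorAlgebra ℂ M) :
    wedgeContract c f (fock κ α s a k * z) = fock κ α s a k * wedgeContract c f z := by
  induction k generalizing a with
  | zero => simp [fock_zero]
  | succ k ih =>
    rw [fock_succ, site]
    split_ifs
    · rw [one_mul, ih fun x h1 h2 => h x (by omega) (by omega)]
    · rw [mul_assoc, smul_mul_assoc, map_smul, wedgeContract_ι_mul, h a le_rfl (by omega), zero_smul,
        zero_add, ih fun x h1 h2 => h x (by omega) (by omega), smul_mul_assoc, smul_mul_assoc,
        mul_assoc]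

theorem contract_fock {f : Module.Dual ℂ M} {a k : ℕ} (s : ℕ → Bool)
    (h : ∀ x, a ≤ x → x < a + k → f (α x) = 0) : contract f (fock κ α s a k) = 0 := by
  induction k generalizing a with
  | zero => rw [fock_zero, contract_one]
  | succ k ih =>
    have := ih (a := a + 1) fun x h1 h2 => h x (by omega) (by omega)
    rw [fock_succ, site]
    split_ifs
    · rw [one_mul, this]
    · rw [smul_mul_assoc, map_smul, contract_ι_mul, this, h a le_rfl (by omega), zero_smul, mul_zero,
        sub_zero, smul_zero]

theorem site_true_mul (k : ℕ) (z : ExteriorAlgebra ℂ M) : site κ α true k * z = z := by simp [site]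

theorem site_false_mul (k : ℕ) (z : ExteriorAlgebra ℂ M) :
    site κ α false k * z = κ ^ k • (ι ℂ (α k) * z) := by simp [site]

theorem wedgeContract_site_mul {i : ℕ} {f : Module.Dual ℂ M} (h0 : f (α i) = -1)
    (h1 : f (α (i + 1)) = 1) (hκ : κ ^ 2 = -1) {z : ExteriorAlgebra ℂ M}
    (hz : wedgeContract (α i + α (i + 1)) f z = 0) {b c : Bool} :
    wedgeContract (α i + α (i + 1)) f (site κ α b i * (site κ α c (i + 1) * z)) =
      if c = b then 0 else (step b : ℂ) • (site κ α b i * (site κ α c (i + 1) * z)) +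
        κ • (site κ α c i * (site κ α b (i + 1) * z)) := by
  have e0 : wedgeContract (α i + α (i + 1)) f (ι ℂ (α i) * z) =
      -(ι ℂ (α i) * z + ι ℂ (α (i + 1)) * z) := by
    rw [wedgeContract_ι_mul, hz, h0, mul_zero, add_zero, map_add, add_mul, neg_smul, one_smul]
  have e1 : wedgeContract (α i + α (i + 1)) f (ι ℂ (α (i + 1)) * z) =
      ι ℂ (α i) * z + ι ℂ (α (i + 1)) * z := by
    rw [wedgeContract_ι_mul, hz, h1, mul_zero, add_zero, map_add, add_mul, one_smul]
  have e2 : κ * κ ^ (i + 1) = -κ ^ i := by rw [pow_succ]; linear_combination κ ^ i * hκ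
  cases b <;> cases c
  · rw [if_pos rfl, site_false_mul, site_false_mul, map_smul, mul_smul_comm, map_smul,
      wedgeContract_ι_mul, e1, h0, map_add, add_mul, ι_mul_ι_mul_self, add_zero, mul_add,
      ι_mul_ι_mul_self, zero_add, neg_one_smul, neg_add_cancel, smul_zero, smul_zero]
  · rw [if_neg (by simp), site_true_mul, site_true_mul, site_false_mul, site_false_mul, map_smul, e0,
      smul_smul κ, e2, show step false = -1 from rfl]
    generalize ι ℂ (α i) * z = x
    generalize ι ℂ (α (i + 1)) * z = y
    push_cast
    module
  · rw [if_neg (by simp), site_true_mul, site_true_mul, site_false_mul, site_false_mul, map_smul, e1,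
      smul_smul κ, ← pow_succ', show step true = 1 from rfl]
    generalize ι ℂ (α i) * z = x
    generalize ι ℂ (α (i + 1)) * z = y
    push_cast
    module
  · rw [if_pos rfl, site_true_mul, site_true_mul, hz]

/-- A transvection that involves only the neighbouring sites `i` and `i + 1` acts on the states by
the matrix of the cap and the cup. -/
theorem wedgeContract_fock {i m : ℕ} (hi : i + 2 ≤ m) {f : Module.Dual ℂ M} (h0 : f (α i) = -1)
    (h1 : f (α (i + 1)) = 1) (h : ∀ x < m, x ≠ i → x ≠ i + 1 → f (α x) = 0) (hκ : κ ^ 2 = -1)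
    {s t : ℕ → Bool} (ht0 : t i = s (i + 1)) (ht1 : t (i + 1) = s i)
    (ht : ∀ x, x ≠ i → x ≠ i + 1 → t x = s x) :
    wedgeContract (α i + α (i + 1)) f (fock κ α s 0 m) = if s (i + 1) = s i then 0 else
      (step (s i) : ℂ) • fock κ α s 0 m + κ • fock κ α t 0 m := by
  obtain ⟨k, rfl⟩ : ∃ k, m = i + (k + 1 + 1) := ⟨m - i - 2, by omega⟩
  have e1 : fock κ α t 0 i = fock κ α s 0 i := fock_congr fun x _ hx => ht x (by omega) (by omega)
  have e2 : fock κ α t (i + 1 + 1) k = fock κ α s (i + 1 + 1) k :=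
    fock_congr fun x hx _ => ht x (by omega) (by omega)
  have e3 := contract_fock (κ := κ) (α := α) (f := f) (a := i + 1 + 1) (k := k) s
    fun x hx _ => h x (by omega) (by omega) (by omega)
  rw [fock_add s 0 i, fock_add t 0 i, e1, zero_add, wedgeContract_fock_mul _ s
    fun x _ hx => h x (by omega) (by omega) (by omega), fock_succ, fock_succ, fock_succ, fock_succ, e2, ht0, ht1]
  generalize fock κ α s 0 i = A at *
  generalize fock κ α s (i + 1 + 1) k = B at *
  have e4 : wedgeContract (α i + α (i + 1)) f B = 0 := by rw [wedgeContract_apply, e3, mul_zero]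
  rw [wedgeContract_site_mul h0 h1 hκ e4]
  split_ifs
  · exact mul_zero A
  · rw [mul_add, mul_smul_comm, mul_smul_comm]

/-- The products of distinct vectors of a linearly independent family are detected by linear forms:
contract with the dual vector at each down step, and set the vector to zero at each up step. -/
theorem exists_detect (hκ : κ ≠ 0) (φ : ℕ → Module.Dual ℂ M) {a k : ℕ}
    (h : ∀ x y, a ≤ x → x < a + k → a ≤ y → y < a + k → φ x (α y) = if x = y then 1 else 0)
    (s : ℕ → Bool) : ∃ F : ExteriorAlgebra ℂ M →ₗ[ℂ] ℂ, F (fock κ α s a k) ≠ 0 ∧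
      ∀ t, (∃ x, a ≤ x ∧ x < a + k ∧ t x ≠ s x) → F (fock κ α t a k) = 0 := by
  induction k generalizing a with
  | zero =>
    refine ⟨(algebraMapInv (M := M)).toLinearMap, by simp [fock_zero], ?_⟩
    rintro t ⟨x, h1, h2, -⟩
    omega
  | succ k ih =>
    obtain ⟨F, hF, hF'⟩ := ih (a := a + 1)
      fun x y h1 h2 h3 h4 => h x y (by omega) (by omega) (by omega) (by omega)
    have hφ : ∀ x, a + 1 ≤ x → x < a + 1 + k → φ a (α x) = 0 := fun x h1 h2 => by
      rw [h a x le_rfl (by omega) (by omega) (by omega), if_neg (by omega)]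
    have hφa : φ a (α a) = 1 := by rw [h a a le_rfl (by omega) le_rfl (by omega), if_pos rfl]
    have hcontr : ∀ t : ℕ → Bool, contract (φ a) (fock κ α t a (k + 1)) =
        if t a then 0 else κ ^ a • fock κ α t (a + 1) k := by
      intro t
      have := contract_fock (κ := κ) t hφ
      rw [fock_succ, site]
      split_ifs
      · rw [one_mul, this]
      · rw [smul_mul_assoc, map_smul, contract_ι_mul, this, hφa, one_smul, mul_zero, sub_zero]
    set p : M →ₗ[ℂ] M := LinearMap.id - (φ a).smulRight (α a) with hp
    have hpr : ∀ t : ℕ → Bool, map p (fock κ α t a (k + 1)) =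
        if t a then fock κ α t (a + 1) k else 0 := by
      intro t
      have hpx : ∀ k a', a < a' → (∀ x, a' ≤ x → x < a' + k → φ a (α x) = 0) →
          map p (fock κ α t a' k) = fock κ α t a' k := by
        intro k
        induction k with
        | zero => intro _ _ _; rw [fock_zero, map_one]
        | succ k ih =>
          intro a' h1 h2
          rw [fock_succ, map_mul, ih _ (by omega) fun x h3 h4 => h2 x (by omega) (by omega), site]
          split_ifs
          · rw [map_one]
          · rw [map_smul, map_apply_ι, hp]
            simp [h2 a' le_rfl (by omega)]
      rw [fock_succ, map_mul, hpx _ _ (by omega) hφ, site]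
      split_ifs
      · rw [map_one, one_mul]
      · rw [map_smul, map_apply_ι, hp]
        simp [hφa]
    have hdiff : ∀ t : ℕ → Bool, (∃ x, a ≤ x ∧ x < a + (k + 1) ∧ t x ≠ s x) → t a = s a →
        F (fock κ α t (a + 1) k) = 0 := by
      rintro t ⟨x, h1, h2, h3⟩ h4
      refine hF' t ⟨x, ?_, by omega, h3⟩
      rcases h1.eq_or_lt with rfl | h1
      · exact absurd h4 h3
      · exact h1
    cases hs : s a
    · refine ⟨F ∘ₗ contract (φ a), ?_, fun t ht => ?_⟩
      · rw [LinearMap.comp_apply, hcontr, hs]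
        simpa [hκ] using hF
      · rw [LinearMap.comp_apply, hcontr]
        split_ifs with h5
        · exact map_zero F
        · rw [map_smul, hdiff t ht (by rw [hs]; simpa using h5), smul_zero]
    · refine ⟨F ∘ₗ (map p).toLinearMap, ?_, fun t ht => ?_⟩
      · rw [LinearMap.comp_apply, AlgHom.toLinearMap_apply, hpr, hs]
        simpa using hF
      · rw [LinearMap.comp_apply, AlgHom.toLinearMap_apply, hpr]
        split_ifs with h5
        · exact hdiff t ht (by rw [hs]; exact h5)
        · exact map_zero F

/-! ### The image of the zigzag diagram -/

/-- The state in which the arc that joins `2k` and `2k + 1` is oriented by `b k`, and all later steps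
are up. -/
def zigzagState {j : ℕ} (b : Fin j → Bool) (x : ℕ) : Bool :=
  if h : x / 2 < j then (if x % 2 = 0 then b ⟨x / 2, h⟩ else !b ⟨x / 2, h⟩) else true

/-- The product of the vectors `α_{2k} + α_{2k+1}` for `k < j`. -/
noncomputable def arcProduct (α : ℕ → M) : ℕ → ExteriorAlgebra ℂ M
  | 0 => 1
  | j + 1 => arcProduct α j * ι ℂ (α (2 * j) + α (2 * j + 1))

theorem sum_fock_zigzagState (j : ℕ) :
    ∑ b : Fin j → Bool, (∏ k, if b k then 1 else κ) • fock κ α (zigzagState b) 0 (2 * j) =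
      (∏ k ∈ Finset.range j, κ ^ (2 * k + 1)) • arcProduct α j := by
  induction j with
  | zero => simp [fock_zero, arcProduct]
  | succ j ih =>
    rw [Finset.prod_range_succ, arcProduct, mul_comm (∏ k ∈ _, _), mul_smul, ← smul_mul_assoc, ← ih,
      ← (Fin.snocEquiv fun _ => Bool).sum_comp, Fintype.sum_prod_type, Fintype.sum_bool,
      Finset.sum_mul, Finset.smul_sum, ← Finset.sum_add_distrib]
    refine Finset.sum_congr rfl fun b _ => ?_
    have key : ∀ c : Bool, (∏ k, if (Fin.snocEquiv fun _ => Bool) (c, b) k then 1 else κ) •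
        fock κ α (zigzagState ((Fin.snocEquiv fun _ => Bool) (c, b))) 0 (2 * (j + 1)) =
        ((∏ k, if b k then 1 else κ) • fock κ α (zigzagState b) 0 (2 * j)) *
          ((if c then 1 else κ) • (site κ α c (2 * j) * site κ α (!c) (2 * j + 1))) := by
      intro c
      have e0 : fock κ α (zigzagState ((Fin.snocEquiv fun _ => Bool) (c, b))) 0 (2 * j) =
          fock κ α (zigzagState b) 0 (2 * j) := by
        refine fock_congr fun x _ hx => ?_
        have h1 : x / 2 < j := by omega
        rw [zigzagState, zigzagState, dif_pos (by omega), dif_pos h1]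
        have : (Fin.snocEquiv fun _ => Bool) (c, b) ⟨x / 2, by omega⟩ = b ⟨x / 2, h1⟩ :=
          Fin.snoc_castSucc (α := fun _ => Bool) c b ⟨x / 2, h1⟩
        rw [this]
      have hlast : (Fin.snocEquiv fun _ => Bool) (c, b) (Fin.last j) = c :=
        Fin.snoc_last (α := fun _ => Bool) c b
      have e1 : zigzagState ((Fin.snocEquiv fun _ => Bool) (c, b)) (2 * j) = c := by
        rw [zigzagState, dif_pos (by omega), if_pos (by omega)]
        convert hlast using 2
        exact Fin.ext (by simp)
      have e2 : zigzagState ((Fin.snocEquiv fun _ => Bool) (c, b)) (2 * j + 1) = !c := by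
        rw [zigzagState, dif_pos (by omega), if_neg (by omega)]
        congr 1
        convert hlast using 2
        exact Fin.ext (by simp; omega)
      rw [show 2 * (j + 1) = 2 * j + (0 + 1 + 1) by ring, fock_add, e0, zero_add, fock_succ, fock_succ,
        fock_zero, e1, e2, mul_one, Fin.prod_univ_castSucc, hlast]
      have : ∀ k : Fin j, (Fin.snocEquiv fun _ => Bool) (c, b) k.castSucc = b k :=
        fun k => Fin.snoc_castSucc (α := fun _ => Bool) c b k
      simp only [this, mul_smul, smul_mul_assoc, mul_smul_comm]
      rw [smul_comm]
    have e1 : site κ α true (2 * j) * site κ α (!true) (2 * j + 1) =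
        κ ^ (2 * j + 1) • ι ℂ (α (2 * j + 1)) := by simp [site]
    have e2 : site κ α false (2 * j) * site κ α (!false) (2 * j + 1) =
        κ ^ (2 * j) • ι ℂ (α (2 * j)) := by simp [site]
    rw [key, key, ← mul_add, ← mul_smul_comm (κ ^ (2 * j + 1)), e1, e2, if_pos rfl, if_neg (by simp), one_smul,
      smul_smul, ← pow_succ', ← smul_add, map_add, add_comm (ι ℂ (α (2 * j)))]

theorem contract_arcProduct_mul {f : Module.Dual ℂ M} {j : ℕ}
    (h : ∀ k < j, f (α (2 * k) + α (2 * k + 1)) = 0) {z : ExteriorAlgebra ℂ M}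
    (hz : contract f z = 0) : contract f (arcProduct α j * z) = 0 := by
  induction j generalizing z with
  | zero => rwa [arcProduct, one_mul]
  | succ j ih =>
    rw [arcProduct, mul_assoc]
    refine ih (fun k hk => h k (by omega)) ?_
    rw [contract_ι_mul, hz, h j (by omega), zero_smul, mul_zero, sub_zero]

theorem contract_arcProduct {f : Module.Dual ℂ M} {j : ℕ}
    (h : ∀ k < j, f (α (2 * k) + α (2 * k + 1)) = 0) : contract f (arcProduct α j) = 0 := by
  have := contract_arcProduct_mul h (contract_one f)
  rwa [mul_one] at this

theorem arcProduct_mem (j : ℕ) : arcProduct α j ∈ ⋀[ℂ]^j M := by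
  induction j with
  | zero => exact one_mem
  | succ j ih =>
    rw [arcProduct, exteriorPower, pow_succ]
    exact Submodule.mul_mem_mul ih (LinearMap.mem_range_self _ _)

/-- A product of pairwise orthogonal vectors is primitive. -/
theorem lower_arcProduct {n : ℕ} (F : SymplecticFrame M n) {j : ℕ}
    (h : ∀ i < j, ∀ k < j, F.pairing (α (2 * i) + α (2 * i + 1)) (α (2 * k) + α (2 * k + 1)) = 0) :
    F.lower (arcProduct α j) = 0 := by
  have key : ∀ i ≤ j, ∀ z, F.lower z = 0 →
      (∀ k < j, contract (F.pairing (α (2 * k) + α (2 * k + 1))) z = 0) →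
      F.lower (arcProduct α i * z) = 0 := by
    intro i
    induction i with
    | zero => intro _ z hz _; rwa [arcProduct, one_mul]
    | succ i ih =>
      intro hi z hz hz'
      rw [arcProduct, mul_assoc]
      refine ih (by omega) _ ?_ fun k hk => ?_
      · rw [F.lower_ι_mul, hz, hz' i (by omega), mul_zero, add_zero]
      · rw [contract_ι_mul, hz' k hk, h k hk i (by omega), zero_smul, mul_zero, sub_zero]
  have := key j le_rfl 1 ((F.lower_mem one_mem).2 (by norm_num)) fun k _ => contract_one _
  rwa [mul_one] at this

end StateSum

/-! ### The number of diagrams -/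

namespace StateSum

theorem height_eq_of_agree {M M' : ℕ} {s : Fin M → Bool} {t : Fin M' → Bool} {k : ℕ} (hM : k ≤ M)
    (hM' : k ≤ M') (h : ∀ (x : ℕ) (h1 : x < M) (h2 : x < M'), x < k → s ⟨x, h1⟩ = t ⟨x, h2⟩) :
    height s k = height t k := by
  induction k with
  | zero => rw [height_zero, height_zero]
  | succ k ih =>
    have e1 := height_succ s ⟨k, by omega⟩
    have e2 := height_succ t ⟨k, by omega⟩
    simp only at e1 e2
    rw [e1, e2, ih (by omega) (by omega) fun x h1 h2 h3 => h x h1 h2 (by omega),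
      h k (by omega) (by omega) (by omega)]

open Classical in
/-- The good paths with `m` steps that end at the height `h`. -/
noncomputable def goodPaths (m : ℕ) (h : ℤ) : Finset (Fin m → Bool) :=
  Finset.univ.filter fun s => Good s ∧ height s m = h

theorem mem_goodPaths {m : ℕ} {h : ℤ} {s : Fin m → Bool} :
    s ∈ goodPaths m h ↔ Good s ∧ height s m = h := by simp [goodPaths]

theorem snoc_mem_goodPaths {m : ℕ} {h : ℤ} {s : Fin m → Bool} (b : Bool) (h1 : 1 ≤ h)
    (hs : s ∈ goodPaths m (h - step b)) : (Fin.snoc s b : Fin (m + 1) → Bool) ∈ goodPaths (m + 1) h := by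
  rw [mem_goodPaths] at hs ⊢
  have hlow : ∀ k ≤ m, height (Fin.snoc s b : Fin (m + 1) → Bool) k = height s k := by
    intro k hk
    refine height_eq_of_agree (by omega) hk fun x h1 h2 h3 => ?_
    exact Fin.snoc_castSucc (α := fun _ => Bool) b s ⟨x, h2⟩
  have htop : height (Fin.snoc s b : Fin (m + 1) → Bool) (m + 1) = h := by
    have := height_succ (Fin.snoc s b : Fin (m + 1) → Bool) (Fin.last m)
    rw [Fin.val_last] at this
    rw [this, hlow m le_rfl, hs.2, Fin.snoc_last]
    ring
  refine ⟨fun k => ?_, htop⟩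
  rcases Nat.lt_or_ge k (m + 1) with hk | hk
  · rw [hlow k (by omega)]; exact hs.1 k
  · rw [height_of_ge _ hk, htop]; exact h1

theorem card_goodPaths_succ (m : ℕ) {h : ℤ} (h1 : 1 ≤ h) :
    (goodPaths m (h - 1)).card + (goodPaths m (h + 1)).card ≤ (goodPaths (m + 1) h).card := by
  classical
  have hinj : ∀ b : Bool, Function.Injective fun s : Fin m → Bool =>
      (Fin.snoc s b : Fin (m + 1) → Bool) := fun b s t e => by
    have := congrArg Fin.init e
    simpa only [Fin.init_snoc] using this
  have hcard : ∀ b : Bool, ((goodPaths m (h - step b)).image fun s =>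
      (Fin.snoc s b : Fin (m + 1) → Bool)).card = (goodPaths m (h - step b)).card :=
    fun b => Finset.card_image_of_injective _ (hinj b)
  have hd : Disjoint ((goodPaths m (h - step true)).image fun s =>
      (Fin.snoc s true : Fin (m + 1) → Bool)) ((goodPaths m (h - step false)).image fun s =>
      (Fin.snoc s false : Fin (m + 1) → Bool)) := by
    rw [Finset.disjoint_left]
    intro s hs hs'
    obtain ⟨t, -, rfl⟩ := Finset.mem_image.1 hs
    obtain ⟨t', -, e⟩ := Finset.mem_image.1 hs'
    have := congrFun e (Fin.last m)
    rw [Fin.snoc_last, Fin.snoc_last] at this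
    exact absurd this (by simp)
  have e1 : h - step true = h - 1 := rfl
  have e2 : h - step false = h + 1 := by rw [show step false = -1 from rfl]; ring
  have h3 := hcard true
  have h4 := hcard false
  rw [← e1, ← e2, ← h3, ← h4, ← Finset.card_union_of_disjoint hd]
  refine Finset.card_le_card fun s hs => ?_
  rcases Finset.mem_union.1 hs with hs | hs <;> obtain ⟨t, ht, rfl⟩ := Finset.mem_image.1 hs
  · exact snoc_mem_goodPaths _ h1 ht
  · exact snoc_mem_goodPaths _ h1 ht

/-- The lower bound in the ballot theorem. -/
theorem choose_le_card_goodPaths (m k h : ℕ) (hm : m + 1 = h + 2 * k) :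
    m.choose k ≤ (if k = 0 then 0 else m.choose (k - 1)) + (goodPaths m h).card := by
  induction m generalizing k h with
  | zero =>
    obtain rfl : k = 0 := by omega
    obtain rfl : h = 1 := by omega
    have : (goodPaths 0 ((1 : ℕ) : ℤ)).Nonempty :=
      ⟨fun _ => true, mem_goodPaths.2 ⟨fun k => by rw [height_of_ge _ (Nat.zero_le k), height_zero],
        height_zero _⟩⟩
    have := this.card_pos
    simp
    omega
  | succ m ih =>
    rcases Nat.eq_zero_or_pos h with rfl | hh
    · rw [if_neg (by omega)]
      have : (m + 1).choose k = (m + 1).choose (k - 1) := by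
        rw [← Nat.choose_symm (by omega : k ≤ m + 1)]
        congr 1
        omega
      omega
    have h1 := card_goodPaths_succ m (h := (h : ℤ)) (by omega)
    have h2 := ih k (h - 1) (by omega)
    rw [Nat.cast_sub hh, Nat.cast_one] at h2
    rcases k with - | k
    · rw [if_pos rfl, zero_add, Nat.choose_zero_right] at h2 ⊢
      omega
    · have h3 := ih k (h + 1) (by omega)
      rw [if_neg (by omega), Nat.add_sub_cancel] at h2 ⊢
      push_cast at h3
      rw [Nat.choose_succ_succ]
      rcases k with - | k
      · rw [if_pos rfl] at h3
        simp only [Nat.choose_zero_right, Nat.succ_eq_add_one, zero_add] at *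
        omega
      · rw [if_neg (by omega), Nat.add_sub_cancel] at h3
        simp only [Nat.succ_eq_add_one] at *
        rw [Nat.choose_succ_succ m k] at *
        simp only [Nat.succ_eq_add_one] at *
        omega

end StateSum

namespace LinkDiagram

open StateSum ExteriorAlgebra

variable {n l d : ℕ}

/-- The number of diagrams is at least a ballot number. The inequality suffices, as an injective map
from their span bounds it from above. -/
theorem choose_le_card (hn : n = 2 * l + d) :
    n.choose l ≤ (if l = 0 then 0 else n.choose (l - 1)) + Nat.card (LinkDiagram n d) := by
  have h1 := choose_le_card_goodPaths n l (d + 1) (by omega)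
  refine h1.trans (Nat.add_le_add_left ?_ _)
  have hex : ∀ s : goodPaths n ((d + 1 : ℕ) : ℤ), ∃ D : LinkDiagram n d,
      D.path = Fin.append s.1 fun _ => false := by
    rintro ⟨s, hs⟩
    obtain ⟨hs1, hs2⟩ := mem_goodPaths.1 hs
    have hlow : ∀ k ≤ n, height (Fin.append s fun _ : Fin d => false) k = height s k := by
      intro k hk
      refine height_eq_of_agree (by omega) hk fun x h1 h2 h3 => ?_
      exact Fin.append_left s _ ⟨x, h2⟩
    have hbot : ∀ x : Fin (n + d), n ≤ x.val → Fin.append s (fun _ : Fin d => false) x = false := by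
      intro x hx
      have := Fin.append_right s (fun _ : Fin d => false) ⟨x - n, by omega⟩
      rwa [show Fin.natAdd n ⟨x.val - n, by omega⟩ = x from Fin.ext (by simp; omega)] at this
    have hdown : ∀ k ≤ d, height (Fin.append s fun _ : Fin d => false) (n + k) = d + 1 - k := by
      intro k hk
      rw [height_of_forall_down (by omega) fun x hx _ => hbot x hx, hlow n le_rfl, hs2]
      push_cast
      ring
    refine exists_path_eq hn (fun k => ?_) hbot ?_
    · rcases Nat.le_total k n with hk | hk
      · rw [hlow k hk]; exact hs1 k
      rcases Nat.le_total k (n + d) with hk' | hk'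
      · obtain ⟨j, rfl⟩ := Nat.exists_eq_add_of_le hk
        rw [hdown j (by omega)]
        omega
      · rw [height_of_ge _ hk', hdown d le_rfl]
        omega
    · rw [hdown d le_rfl]
      ring
  choose f hf using hex
  have hfi : Function.Injective f := by
    intro s t h
    have e : Fin.append s.1 (fun _ : Fin d => false) = Fin.append t.1 fun _ => false := by
      rw [← hf, ← hf, h]
    refine Subtype.ext (funext fun x => ?_)
    have := congrFun e (Fin.castAdd d x)
    rwa [Fin.append_left, Fin.append_left] at this
  have := Nat.card_le_card_of_injective f hfi
  rwa [Nat.card_eq_fintype_card, Fintype.card_coe] at this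

/-! ### The exterior algebra as a spin model -/

variable {M : Type*} [AddCommGroup M] [Module ℂ M]

/-- The weights of the state sum at a fourth root of `-1`; they do not depend on the height. -/
def spinWeight (κ : ℂ) (_ : ℤ) (b : Bool) : ℂ := if b then 1 else κ

/-- A state as a sequence. -/
def extend (s : Fin (n + d) → Bool) (x : ℕ) : Bool := if h : x < n + d then s ⟨x, h⟩ else false

open Classical in
/-- The map from diagrams to the exterior algebra by which a state becomes the product of the vectors
of its down steps at the top points. -/
noncomputable def fockMap (κ : ℂ) (α : ℕ → M) : Span ℂ n d →ₗ[ℂ] ExteriorAlgebra ℂ M :=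
  ∑ s ∈ Finset.univ.filter (fun s : Fin (n + d) → Bool => ∀ x, n ≤ x.val → s x = false),
    (LinearMap.proj s ∘ₗ stateSum (spinWeight κ)).smulRight (fock κ α (extend s) 0 n)

open Classical in
theorem fockMap_apply (κ : ℂ) (α : ℕ → M) (v : Span ℂ n d) : fockMap κ α v =
    ∑ s ∈ Finset.univ.filter (fun s : Fin (n + d) → Bool => ∀ x, n ≤ x.val → s x = false),
      stateSum (spinWeight κ) v s • fock κ α (extend s) 0 n := by
  simp [fockMap]

theorem map_fockMap {N : Type*} [AddCommGroup N] [Module ℂ N] (κ : ℂ) (α : ℕ → M) (p : M →ₗ[ℂ] N)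
    (v : Span ℂ n d) : map p (fockMap κ α v) = fockMap κ (fun x => p (α x)) v := by
  simp only [fockMap_apply, map_sum, map_smul, map_fock]

/-- The local rule of the state sum when the weights do not depend on the height: the cap and the cup
keep the two steps, up to a factor, or exchange them. -/
theorem stateSum_spinWeight {κ : ℂ} (hκ : κ ^ 2 = -1) (i : Fin (n - 1)) {s : Fin (n + d) → Bool}
    (hs : ∀ x, n ≤ x.val → s x = false) (v : Span ℂ n d) :
    κ * stateSum (spinWeight κ) (cupCapMap 0 i v) s = if s (right d i) = s (left d i) then 0 else
      step (s (left d i)) * stateSum (spinWeight κ) v s +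
        κ * stateSum (spinWeight κ) v (s ∘ Equiv.swap (left d i) (right d i)) := by
  have hκ0 : κ ≠ 0 := by rintro rfl; norm_num at hκ
  rw [stateSum_cupCapMap (spinWeight κ) (fun _ b => if b then κ⁻¹ else 1) 0 i hs]
  · split_ifs with h
    · exact mul_zero κ
    have hrow : s (right d i) = !s (left d i) := by
      revert h; cases s (right d i) <;> cases s (left d i) <;> simp
    have e1 : setPair s (left d i) (right d i) (s (left d i)) = s := setPair_self s hrow
    have e2 : setPair s (left d i) (right d i) (!s (left d i)) =
        s ∘ Equiv.swap (left d i) (right d i) := by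
      funext x
      have hne := left_ne_right (d := d) i
      by_cases hl : x = left d i
      · subst hl; rw [setPair_left, Function.comp, Equiv.swap_apply_left, hrow]
      by_cases hr : x = right d i
      · subst hr
        rw [setPair_right _ hne, Function.comp, Equiv.swap_apply_right, Bool.not_not]
      · rw [setPair_of_ne _ _ hl hr, Function.comp, Equiv.swap_apply_of_ne_of_ne hl hr]
    have hsum : ∀ f : Bool → ℂ, ∀ b, ∑ c, f c = f b + f (!b) := by
      intro f b; cases b <;> simp [add_comm]
    rw [hsum _ (s (left d i)), e1, e2]
    generalize stateSum (spinWeight κ) v s = x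
    generalize stateSum (spinWeight κ) v _ = y
    have e3 : κ⁻¹ = -κ := by
      refine inv_eq_of_mul_eq_one_right ?_
      linear_combination -hκ
    cases s (left d i)
    · simp only [spinWeight, step, Bool.not_false, Bool.false_eq_true, if_false, if_true, e3]
      push_cast
      linear_combination (x - κ * y) * hκ
    · simp only [spinWeight, step, Bool.not_true, Bool.false_eq_true, if_false, if_true, e3]
      push_cast
      linear_combination -x * hκ
  · rw [Fintype.sum_bool]
    simp only [spinWeight, Bool.false_eq_true, if_false, if_true]
    field_simp
    linear_combination hκ
  · intro _ b _
    cases b <;> simp [spinWeight, hκ0]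

/-- Stacking becomes the composition of a contraction and an exterior multiplication, for a linear form
that sees only the vectors of the two points. -/
theorem fockMap_cupCapMap {κ : ℂ} (hκ : κ ^ 2 = -1) {α : ℕ → M} (i : Fin (n - 1))
    {f : Module.Dual ℂ M} (h0 : f (α i) = -1) (h1 : f (α (i + 1)) = 1)
    (h : ∀ x < n, x ≠ i → x ≠ i + 1 → f (α x) = 0) (v : Span ℂ n d) :
    fockMap κ α (κ • cupCapMap 0 i v) = wedgeContract (α i + α (i + 1)) f (fockMap κ α v) := by
  classical
  have hl := left_lt (d := d) i
  have hr := right_lt (d := d) i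
  have hne := left_ne_right (d := d) i
  have hi := i.2
  rw [map_smul, fockMap_apply, fockMap_apply, map_sum, Finset.smul_sum]
  set B := Finset.univ.filter (fun s : Fin (n + d) → Bool => ∀ x, n ≤ x.val → s x = false) with hB
  have key : ∀ s : Fin (n + d) → Bool, wedgeContract (α i + α (i + 1)) f
      (fock κ α (extend s) 0 n) = if s (right d i) = s (left d i) then 0 else
        (step (s (left d i)) : ℂ) • fock κ α (extend s) 0 n +
          κ • fock κ α (extend (s ∘ Equiv.swap (left d i) (right d i))) 0 n := by
    intro s
    have e1 : ∀ s : Fin (n + d) → Bool, extend s i = s (left d i) := fun s => dif_pos _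
    have e2 : ∀ s : Fin (n + d) → Bool, extend s (i + 1) = s (right d i) := fun s => dif_pos _
    rw [wedgeContract_fock (t := extend (s ∘ Equiv.swap (left d i) (right d i))) (by omega) h0 h1 h
      hκ, e1, e2]
    · rw [e1, e2, Function.comp, Equiv.swap_apply_left]
    · rw [e1, e2, Function.comp, Equiv.swap_apply_right]
    · intro x hx hx'
      rw [extend, extend]
      split_ifs with hx''
      · rw [Function.comp, Equiv.swap_apply_of_ne_of_ne (fun e => hx (congrArg Fin.val e))
          (fun e => hx' (congrArg Fin.val e))]
      · rfl
  have hl' : ∀ s ∈ B, κ • stateSum (spinWeight κ) (cupCapMap 0 i v) s • fock κ α (extend s) 0 n =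
      (if s (right d i) = s (left d i) then 0 else (step (s (left d i)) *
        stateSum (spinWeight κ) v s) • fock κ α (extend s) 0 n) +
      if s (right d i) = s (left d i) then 0 else (κ * stateSum (spinWeight κ) v
        (s ∘ Equiv.swap (left d i) (right d i))) • fock κ α (extend s) 0 n := by
    intro s hs
    rw [smul_smul, stateSum_spinWeight hκ i (by simpa [hB] using hs)]
    split_ifs
    · rw [zero_smul, add_zero]
    · rw [add_smul]
  have hr' : ∀ s ∈ B, wedgeContract (α i + α (i + 1)) f
      (stateSum (spinWeight κ) v s • fock κ α (extend s) 0 n) =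
      (if s (right d i) = s (left d i) then 0 else (step (s (left d i)) *
        stateSum (spinWeight κ) v s) • fock κ α (extend s) 0 n) +
      if s (right d i) = s (left d i) then 0 else (κ * stateSum (spinWeight κ) v s) •
        fock κ α (extend (s ∘ Equiv.swap (left d i) (right d i))) 0 n := by
    intro s _
    rw [map_smul, key]
    split_ifs
    · rw [smul_zero, add_zero]
    · rw [smul_add, smul_smul, smul_smul, mul_comm, mul_comm κ]
  rw [Finset.sum_congr rfl hl', Finset.sum_congr rfl hr', Finset.sum_add_distrib,
    Finset.sum_add_distrib]
  congr 1
  -- exchange the two steps in each state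
  have hinv : ∀ s : Fin (n + d) → Bool, (s ∘ Equiv.swap (left d i) (right d i)) ∘
      Equiv.swap (left d i) (right d i) = s := by
    intro s; funext x; simp
  have hmem : ∀ s ∈ B, s ∘ Equiv.swap (left d i) (right d i) ∈ B := by
    intro s hs
    rw [hB, Finset.mem_filter] at hs ⊢
    refine ⟨Finset.mem_univ _, fun x hx => ?_⟩
    rw [Function.comp, Equiv.swap_apply_of_ne_of_ne, hs.2 x hx]
    · rintro rfl; omega
    · rintro rfl; omega
  refine Finset.sum_nbij' (fun s => s ∘ Equiv.swap (left d i) (right d i))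
    (fun s => s ∘ Equiv.swap (left d i) (right d i)) hmem hmem (fun s _ => hinv s)
    (fun s _ => hinv s) fun s _ => ?_
  rw [hinv]
  simp only [Function.comp, Equiv.swap_apply_left, Equiv.swap_apply_right, eq_comm]

theorem fockMap_zigzagDiagram (hn : n = 2 * l + d) (κ : ℂ) (α : ℕ → M) :
    fockMap κ α (Finsupp.single (zigzagDiagram hn) 1) =
      (∏ k ∈ Finset.range l, κ ^ (2 * k + 1)) • arcProduct α l := by
  classical
  rw [fockMap_apply, ← sum_fock_zigzagState, stateSum_single]
  have hval : ∀ x : Fin (n + d), ((zigzagDiagram hn).partner x).val = if x.val < 2 * l then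
      (if x.val % 2 = 0 then x.val + 1 else x.val - 1) else 2 * l + (n + d) - 1 - x.val := fun _ => rfl
  set S : (Fin l → Bool) → Fin (n + d) → Bool := fun b x => if x.val < n then zigzagState b x else false
    with hS
  have hlow : ∀ b : Fin l → Bool, ∀ x : Fin (n + d), ∀ h : x.val < 2 * l,
      S b x = if x.val % 2 = 0 then b ⟨x / 2, by omega⟩ else !b ⟨x / 2, by omega⟩ := by
    intro b x h
    simp only [hS]
    rw [if_pos (by omega), zigzagState, dif_pos (by omega)]
  have hmid : ∀ b : Fin l → Bool, ∀ x : Fin (n + d), 2 * l ≤ x.val → S b x = decide (x.val < n) := by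
    intro b x h
    simp only [hS]
    split_ifs with h'
    · rw [zigzagState, dif_neg (by omega), decide_eq_true h']
    · rw [decide_eq_false h']
  have hcomp : ∀ b, Compatible (zigzagDiagram hn).partner (S b) := by
    intro b x
    have hx := hval x
    by_cases h : x.val < 2 * l
    · rw [if_pos h] at hx
      have h2 : ((zigzagDiagram hn).partner x).val < 2 * l := by
        rw [hx]; split_ifs <;> omega
      rw [hlow b _ h2, hlow b x h]
      by_cases h3 : x.val % 2 = 0
      · rw [if_pos h3] at hx
        rw [if_neg (by omega), if_pos h3]
        congr 2
        exact Fin.ext (by simp only [hx]; omega)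
      · rw [if_neg h3] at hx
        rw [if_pos (by omega), if_neg h3, Bool.not_not]
        congr 1
        exact Fin.ext (by simp only [hx]; omega)
    · rw [if_neg h] at hx
      have := x.2
      rw [hmid b _ (by omega), hmid b _ (by omega), hx]
      by_cases h3 : x.val < n
      · rw [decide_eq_true h3, decide_eq_false (by omega)]; rfl
      · rw [decide_eq_false h3, decide_eq_true (by omega)]; rfl
  symm
  refine Finset.sum_of_injOn S ?_ ?_ ?_ ?_
  · intro b _ b' _ e
    funext k
    have := congrFun e ⟨2 * k, by omega⟩
    rw [hlow _ _ (by simp only; omega), hlow _ _ (by simp only; omega)] at this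
    simpa using this
  · intro b _
    simp only [Finset.coe_filter, Finset.mem_univ, true_and, Set.mem_ofPred_eq]
    intro x hx
    simp only [hS]
    rw [if_neg (by omega)]
  · intro s hs hs'
    rw [coeff_of_not_compatible, zero_smul]
    intro hc
    refine hs' ⟨fun k => s ⟨2 * k, by omega⟩, Finset.mem_coe.2 (Finset.mem_univ _), ?_⟩
    have hbot : ∀ x, n ≤ x.val → s x = false := by simpa using hs
    funext x
    have hx := hval x
    have hx2 := x.2
    by_cases h : x.val < 2 * l
    · rw [hlow _ _ h]
      have hp : x.val % 2 ≠ 0 → (zigzagDiagram hn).partner x = ⟨2 * (x.val / 2), by omega⟩ := by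
        intro h3
        rw [if_pos h, if_neg h3] at hx
        exact Fin.ext (by rw [hx]; simp only; omega)
      split_ifs with h3
      · congr 1; exact Fin.ext (by simp only; omega)
      · have := hc x
        rw [hp h3] at this
        simp only
        rw [this, Bool.not_not]
    · rw [hmid _ _ (by omega)]
      rw [if_neg h] at hx
      by_cases h3 : x.val < n
      · have h4 := hc x
        rw [hbot _ (by omega)] at h4
        rw [decide_eq_true h3]
        cases h5 : s x
        · rw [h5] at h4; exact absurd h4 (by simp)
        · rfl
      · rw [decide_eq_false h3, hbot x (by omega)]
  · intro b _
    rw [coeff_of_compatible (hcomp b)]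
    have e1 : fock κ α (extend (S b)) 0 n = fock κ α (zigzagState b) 0 (2 * l) := by
      have e0 : fock κ α (extend (S b)) 0 n = fock κ α (extend (S b)) 0 (2 * l + d) :=
        congrArg _ hn
      rw [e0, fock_add, fock_of_forall_up (a := 0 + 2 * l), mul_one]
      · refine fock_congr fun x _ hx => ?_
        rw [extend, dif_pos (by omega)]
        simp only [hS]
        rw [if_pos (by omega)]
      · intro x h1 h2
        rw [extend, dif_pos (by omega), hmid _ _ (by simp only; omega)]
        simp only [decide_eq_true_eq]
        omega
    rw [e1]
    congr 1
    refine Finset.prod_of_injOn (fun k : Fin l => (⟨2 * k, by omega⟩ : Fin (n + d))) ?_ ?_ ?_ ?_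
    · intro j _ k _ e
      have := congrArg Fin.val e
      simp only at this
      exact Fin.ext (by omega)
    · intro _ _
      exact Finset.mem_coe.2 (Finset.mem_univ _)
    · intro x _ hx
      rw [arcWeight]
      split_ifs with h
      · have hxv := hval x
        have h2l : 2 * l ≤ x.val := by
          by_contra hlt
          rw [if_pos (by omega)] at hxv
          rw [Fin.lt_def] at h
          refine hx ⟨⟨x.val / 2, by omega⟩, Finset.mem_coe.2 (Finset.mem_univ _), Fin.ext ?_⟩
          simp only
          split_ifs at hxv <;> omega
        rw [if_neg (by omega)] at hxv
        rw [Fin.lt_def] at h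
        rw [hmid _ _ h2l, decide_eq_true (by omega), spinWeight, if_pos rfl]
      · rfl
    · intro k _
      have hk := hval ⟨2 * k, by omega⟩
      rw [if_pos (by simp only; omega), if_pos (by simp only; omega)] at hk
      have hk2 : 2 * k.val < n := by omega
      rw [arcWeight, if_pos (Fin.lt_def.2 (by rw [hk]; omega)), spinWeight,
        hlow _ ⟨2 * k, by omega⟩ (show 2 * k.val < 2 * l by omega),
        if_pos (show 2 * k.val % 2 = 0 by omega)]
      congr 3
      exact Fin.ext (show k.val = 2 * k.val / 2 by omega)

end LinkDiagram

/-! ### Chains of vectors with consecutive symplectic pairings -/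

namespace ChainBasis

open ExteriorAlgebra StateSum LinkDiagram

variable {H : Type*} [AddCommGroup H] [Module ℂ H] {n : ℕ} (c : Module.Basis (Fin (2 * n)) ℂ H)

/-- The basis vectors as a sequence, continued by zero. -/
noncomputable def vec (k : ℕ) : H := if h : k < 2 * n then c ⟨k, h⟩ else 0

/-- The dual basis as a sequence, continued by zero. -/
noncomputable def dualVec (k : ℕ) : Module.Dual ℂ H := if h : k < 2 * n then c.coord ⟨k, h⟩ else 0

theorem vec_of_lt {k : ℕ} (h : k < 2 * n) : vec c k = c ⟨k, h⟩ := dif_pos h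

theorem vec_fin (i : Fin (2 * n)) : vec c i = c i := dif_pos i.2

theorem dualVec_vec {j k : ℕ} (hk : k < 2 * n) : dualVec c j (vec c k) = if j = k then 1 else 0 := by
  rw [dualVec, vec_of_lt c hk]
  split_ifs with h1 h2 h2
  · subst h2; simp
  · rw [Module.Basis.coord_apply, Module.Basis.repr_self, Finsupp.single_apply, if_neg]
    intro e; exact h2 (congrArg Fin.val e).symm
  · omega
  · rfl

theorem sum_ite_val_eq {E : Type*} [AddCommGroup E] [Module ℂ E] (j : ℕ) (f : ℕ → E)
    (hf : n ≤ j → f j = 0) : ∑ k : Fin n, (if k.val = j then (1 : ℂ) else 0) • f k = f j := by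
  by_cases h : j < n
  · rw [Finset.sum_eq_single ⟨j, h⟩]
    · simp
    · intro k _ hk
      rw [if_neg (fun e => hk (Fin.ext e)), zero_smul]
    · simp
  · rw [hf (by omega)]
    refine Finset.sum_eq_zero fun k _ => ?_
    rw [if_neg (by omega), zero_smul]

/-- The symplectic basis `a_k = c_0 + c_2 + ⋯ + c_{2k}`, `b_k = c_{2k+1}`. -/
noncomputable def frame : SymplecticFrame H n where
  a k := ∑ j ∈ Finset.range (k + 1), vec c (2 * j)
  b k := vec c (2 * k + 1)
  α k := dualVec c (2 * k) - dualVec c (2 * k + 2)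
  β k := dualVec c (2 * k + 1)
  α_a j k := by
    have h : ∀ i ∈ Finset.range (k.val + 1), (dualVec c (2 * j) - dualVec c (2 * j + 2)) (vec c (2 * i))
        = (if j.val = i then 1 else 0) - if j.val + 1 = i then 1 else 0 := by
      intro i hi
      rw [Finset.mem_range] at hi
      rw [LinearMap.sub_apply, dualVec_vec c (by omega), dualVec_vec c (by omega)]
      congr 1 <;> refine if_congr ?_ rfl rfl <;> omega
    rw [map_sum, Finset.sum_congr rfl h, Finset.sum_sub_distrib, Finset.sum_ite_eq, Finset.sum_ite_eq]
    simp only [Finset.mem_range, Fin.ext_iff]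
    split_ifs <;> first | omega | norm_num
  α_b j k := by
    rw [LinearMap.sub_apply, dualVec_vec c (by omega), dualVec_vec c (by omega), if_neg (by omega),
      if_neg (by omega), sub_zero]
  β_a j k := by
    rw [map_sum]
    refine Finset.sum_eq_zero fun i hi => ?_
    rw [Finset.mem_range] at hi
    rw [dualVec_vec c (by omega), if_neg (by omega)]
  β_b j k := by
    rw [dualVec_vec c (by omega)]
    refine if_congr ?_ rfl rfl
    rw [Fin.ext_iff]
    omega
  sum_eq x := by
    set T : H →ₗ[ℂ] H := ∑ k : Fin n, ((dualVec c (2 * k) - dualVec c (2 * k + 2)).smulRight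
      (∑ j ∈ Finset.range (k + 1), vec c (2 * j)) +
        (dualVec c (2 * k + 1)).smulRight (vec c (2 * k + 1))) with hT
    suffices T = LinearMap.id by
      have := LinearMap.congr_fun this x
      simpa [hT] using this
    refine c.ext fun i => ?_
    rw [← vec_fin]
    have hi := i.2
    set F : ℕ → H := fun k => ∑ j ∈ Finset.range (k + 1), vec c (2 * j) with hF
    have h1 : T (vec c i) = ∑ k : Fin n, (((if 2 * k.val = i then (1 : ℂ) else 0) -
        if 2 * k.val + 2 = i then 1 else 0) • F k + (if 2 * k.val + 1 = i then (1 : ℂ) else 0) •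
          vec c (2 * k + 1)) := by
      rw [hT, LinearMap.sum_apply]
      refine Finset.sum_congr rfl fun k _ => ?_
      simp only [LinearMap.add_apply, LinearMap.smulRight_apply, LinearMap.sub_apply,
        dualVec_vec c hi, hF]
    rw [h1]
    simp only [sub_smul, Finset.sum_add_distrib, Finset.sum_sub_distrib, LinearMap.id_apply]
    rcases Nat.even_or_odd' i.val with ⟨p, hp | hp⟩
    · have e1 : ∀ k : Fin n, (if 2 * k.val = i then (1 : ℂ) else 0) = if k.val = p then 1 else 0 :=
        fun k => if_congr (by omega) rfl rfl
      have e3 : ∀ k : Fin n, (if 2 * k.val + 1 = i then (1 : ℂ) else 0) = 0 :=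
        fun k => if_neg (by omega)
      simp only [e1, e3, zero_smul, Finset.sum_const_zero, add_zero]
      rw [sum_ite_val_eq p F (fun h => by omega), hp]
      rcases p with - | p
      · simp [hF]
      · have e2 : ∀ k : Fin n, (if 2 * k.val + 2 = 2 * (p + 1) then (1 : ℂ) else 0) =
            if k.val = p then 1 else 0 := fun k => if_congr (by omega) rfl rfl
        simp only [e2]
        rw [sum_ite_val_eq p F (fun h => by omega), hF]
        simp only
        rw [Finset.sum_range_succ _ (p + 1), add_sub_cancel_left]
    · have e1 : ∀ k : Fin n, (if 2 * k.val = i then (1 : ℂ) else 0) = 0 :=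
        fun k => if_neg (by omega)
      have e2 : ∀ k : Fin n, (if 2 * k.val + 2 = i then (1 : ℂ) else 0) = 0 :=
        fun k => if_neg (by omega)
      have e3 : ∀ k : Fin n, (if 2 * k.val + 1 = i then (1 : ℂ) else 0) =
          if k.val = p then 1 else 0 := fun k => if_congr (by omega) rfl rfl
      simp only [e1, e2, e3, zero_smul, Finset.sum_const_zero, sub_zero, zero_add]
      rw [sum_ite_val_eq p (fun k => vec c (2 * k + 1)) (fun h => by omega), hp]

theorem frame_α_vec (k : Fin n) {j : ℕ} (hj : j < 2 * n) : (frame c).α k (vec c j) =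
    (if 2 * k.val = j then 1 else 0) - if 2 * k.val + 2 = j then 1 else 0 := by
  rw [← dualVec_vec c hj, ← dualVec_vec c hj]; rfl

theorem frame_β_vec (k : Fin n) {j : ℕ} (hj : j < 2 * n) : (frame c).β k (vec c j) =
    if 2 * k.val + 1 = j then 1 else 0 := by
  rw [← dualVec_vec c hj]; rfl

theorem pairing_vec {i j : ℕ} (hi : i < 2 * n) (hj : j < 2 * n) :
    (frame c).pairing (vec c i) (vec c j) =
      (if j = i + 1 then 1 else 0) - if i = j + 1 then 1 else 0 := by
  rw [SymplecticFrame.pairing_apply]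
  simp only [frame_α_vec c _ hi, frame_α_vec c _ hj, frame_β_vec c _ hi, frame_β_vec c _ hj]
  rcases Nat.even_or_odd' i with ⟨p, hp | hp⟩ <;> rcases Nat.even_or_odd' j with ⟨q, hq | hq⟩
  · rw [Finset.sum_eq_zero, if_neg (by omega), if_neg (by omega), sub_zero]
    intro k _
    rw [if_neg (by omega : ¬ 2 * k.val + 1 = j), if_neg (by omega : ¬ 2 * k.val + 1 = i)]
    ring
  · rw [Finset.sum_eq_single ⟨q, by omega⟩]
    · simp only
      split_ifs <;> first | omega | norm_num
    · intro k _ hk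
      have : k.val ≠ q := fun e => hk (Fin.ext e)
      rw [if_neg (by omega : ¬ 2 * k.val + 1 = j), if_neg (by omega : ¬ 2 * k.val + 1 = i)]
      ring
    · simp
  · rw [Finset.sum_eq_single ⟨p, by omega⟩]
    · simp only
      split_ifs <;> first | omega | norm_num
    · intro k _ hk
      have : k.val ≠ p := fun e => hk (Fin.ext e)
      rw [if_neg (by omega : ¬ 2 * k.val + 1 = j), if_neg (by omega : ¬ 2 * k.val + 1 = i)]
      ring
    · simp
  · rw [Finset.sum_eq_zero, if_neg (by omega), if_neg (by omega), sub_zero]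
    intro k _
    rw [if_neg (by omega : ¬ 2 * k.val = i), if_neg (by omega : ¬ 2 * k.val + 2 = i),
      if_neg (by omega : ¬ 2 * k.val = j), if_neg (by omega : ¬ 2 * k.val + 2 = j)]
    ring

/-- The vectors `0, c_0, c_1 - c_0, …`, any two consecutive ones of which add up to a vector of the
chain. -/
noncomputable def spinVec : ℕ → H
  | 0 => 0
  | k + 1 => vec c k - spinVec k

theorem spinVec_add (k : ℕ) : spinVec c k + spinVec c (k + 1) = vec c k := by
  rw [spinVec, add_sub_cancel]

theorem pairing_spinVec {i x : ℕ} (hi : i < 2 * n) (hx : x ≤ 2 * n) :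
    (frame c).pairing (vec c i) (spinVec c x) = (if x = i + 1 then 1 else 0) -
      (if x = i then 1 else 0) + if i = 0 then (-1) ^ x else 0 := by
  induction x with
  | zero =>
    rw [spinVec, map_zero, if_neg (by omega)]
    by_cases h : i = 0
    · simp [h]
    · simp [h, Ne.symm h]
  | succ x ih =>
    rw [spinVec, map_sub, pairing_vec c hi (by omega), ih (by omega), pow_succ]
    split_ifs <;> first | omega | ring

theorem dual_spinVec {x y : ℕ} (hy : 1 ≤ y) (hx : x ≤ 2 * n) :
    (dualVec c y + dualVec c (y - 1)) (spinVec c x) = if y = x then 1 else 0 := by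
  induction x with
  | zero => rw [spinVec, map_zero, if_neg (by omega)]
  | succ x ih =>
    rw [spinVec, map_sub, ih (by omega), LinearMap.add_apply, dualVec_vec c (by omega),
      dualVec_vec c (by omega)]
    split_ifs <;> first | omega | norm_num

/-! ### The Jones representation at a fourth root of `-1` -/

variable {d l : ℕ} {κ : ℂ}

/-- The standard vectors, from which the sequence `spinVec` is obtained by a linear map. -/
noncomputable abbrev unitVec (x : ℕ) : ℕ →₀ ℂ := Finsupp.single x 1

/-- The alternating sum of the coordinates. -/
noncomputable def alternating : Module.Dual ℂ (ℕ →₀ ℂ) :=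
  Finsupp.linearCombination ℂ fun x => (-1 : ℂ) ^ x

/-- The pairing with `c_i`, pulled back along `spinVec`, up to a multiple of the alternating sum: the
difference of two neighbouring coordinates. -/
noncomputable def localForm (i : ℕ) : Module.Dual ℂ (ℕ →₀ ℂ) :=
  (frame c).pairing (vec c i) ∘ₗ Finsupp.linearCombination ℂ (spinVec c) -
    (if i = 0 then (1 : ℂ) else 0) • alternating

theorem localForm_unitVec {i x : ℕ} (hi : i < 2 * n) (hx : x ≤ 2 * n) :
    localForm c i (unitVec x) = (if x = i + 1 then 1 else 0) - if x = i then 1 else 0 := by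
  have : localForm c i (unitVec x) = (frame c).pairing (vec c i) (spinVec c x) -
      (if i = 0 then (1 : ℂ) else 0) * (-1) ^ x := by
    rw [localForm, LinearMap.sub_apply, LinearMap.smul_apply, LinearMap.comp_apply]
    simp [alternating]
  rw [this, pairing_spinVec c hi hx]
  split_ifs <;> ring

theorem fockMap_unitVec_cupCapMap (hκ : κ ^ 2 = -1) (i : Fin (2 * n))
    (v : Span ℂ (2 * n + 1) d) : fockMap κ unitVec (κ • cupCapMap 0 i v) =
      wedgeContract (unitVec i + unitVec (i + 1)) (localForm c i) (fockMap κ unitVec v) := by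
  have hi := i.2
  refine fockMap_cupCapMap (n := 2 * n + 1) hκ i ?_ ?_ (fun x hx h1 h2 => ?_) v
  · rw [localForm_unitVec c hi (by omega), if_neg (by omega), if_pos rfl, zero_sub]
  · rw [localForm_unitVec c hi (by omega), if_pos rfl, if_neg (by omega), sub_zero]
  · rw [localForm_unitVec c hi (by omega), if_neg h2, if_neg h1, sub_zero]

/-- A subspace that contains the image of the zigzag diagram and is stable under stacking. -/
theorem mem_of_stable (hn : 2 * n + 1 = 2 * l + d) (hκ : κ ^ 2 = -1)
    (W : Submodule ℂ (Span ℂ (2 * n + 1) d)) (h0 : Finsupp.single (zigzagDiagram hn) 1 ∈ W)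
    (hW : ∀ i, ∀ x ∈ W, κ • cupCapMap 0 i x ∈ W) (x : Span ℂ (2 * n + 1) d) : x ∈ W := by
  have hκ0 : κ ≠ 0 := by rintro rfl; norm_num at hκ
  refine mem_of_zigzagDiagram_mem hn 0 W h0 (fun i x hx => ?_) x
  have := W.smul_mem κ⁻¹ (hW i x hx)
  rwa [smul_smul, inv_mul_cancel₀ hκ0, one_smul] at this

/-- The alternating sum of the coordinates vanishes on `unitVec i + unitVec (i + 1)`, so the contraction
with it kills the image of all diagrams, and on this image `localForm` may be replaced by the symplectic
pairing. -/
theorem contract_alternating_fockMap (c : Module.Basis (Fin (2 * n)) ℂ H)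
    (hn : 2 * n + 1 = 2 * l + d) (hκ : κ ^ 2 = -1) (v : Span ℂ (2 * n + 1) d) :
    contract alternating (fockMap κ unitVec v) = 0 := by
  refine mem_of_stable hn hκ (LinearMap.ker (contract alternating ∘ₗ fockMap κ unitVec)) ?_
    (fun i x hx => ?_) v
  · rw [LinearMap.mem_ker, LinearMap.comp_apply, fockMap_zigzagDiagram, map_smul,
      contract_arcProduct, smul_zero]
    intro k _
    simp [alternating, pow_succ]
  · rw [LinearMap.mem_ker, LinearMap.comp_apply] at hx ⊢
    rw [fockMap_unitVec_cupCapMap c hκ, wedgeContract_apply, contract_ι_mul, contract_comm, hx,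
      map_zero, neg_zero, mul_zero, sub_zero]
    have : alternating (unitVec i + unitVec (i + 1)) = 0 := by simp [alternating, pow_succ]
    rw [this, zero_smul]

/-- Stacking becomes the derivation of the exterior algebra that belongs to the transvection along `c_i`. -/
theorem fockMap_spinVec_cupCapMap (hn : 2 * n + 1 = 2 * l + d) (hκ : κ ^ 2 = -1) (i : Fin (2 * n))
    (v : Span ℂ (2 * n + 1) d) : fockMap κ (spinVec c) (κ • cupCapMap 0 i v) =
      wedgeContract (vec c i) ((frame c).pairing (vec c i)) (fockMap κ (spinVec c) v) := by
  set p : (ℕ →₀ ℂ) →ₗ[ℂ] H := Finsupp.linearCombination ℂ (spinVec c) with hp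
  have h1 : ∀ w : Span ℂ (2 * n + 1) d, fockMap κ (spinVec c) w = map p (fockMap κ unitVec w) := by
    intro w
    rw [map_fockMap]
    congr 2
    funext x
    simp [hp]
  have h2 : p (unitVec i + unitVec (i + 1)) = vec c i := by
    rw [← spinVec_add]; simp [hp]
  have h3 : (frame c).pairing (vec c i) ∘ₗ p =
      localForm c i + (if i.val = 0 then (1 : ℂ) else 0) • alternating := by
    rw [localForm, sub_add_cancel]
  rw [h1, h1, fockMap_unitVec_cupCapMap c hκ, ← h2, ← map_wedgeContract, h2, h3,
    wedgeContract_apply, wedgeContract_apply, contract_add, contract_smul,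
    contract_alternating_fockMap c hn hκ, smul_zero, add_zero]

theorem fockMap_spinVec_zigzagDiagram (hn : 2 * n + 1 = 2 * l + d) :
    fockMap κ (spinVec c) (Finsupp.single (zigzagDiagram hn) 1) =
      (∏ k ∈ Finset.range l, κ ^ (2 * k + 1)) • arcProduct (spinVec c) l :=
  fockMap_zigzagDiagram hn κ _

theorem fockMap_spinVec_mem (hn : 2 * n + 1 = 2 * l + d) (hκ : κ ^ 2 = -1)
    (v : Span ℂ (2 * n + 1) d) : fockMap κ (spinVec c) v ∈ ⋀[ℂ]^l H := by
  refine mem_of_stable hn hκ ((⋀[ℂ]^l H).comap (fockMap κ (spinVec c))) ?_ (fun i x hx => ?_) v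
  · rw [Submodule.mem_comap, fockMap_spinVec_zigzagDiagram]
    exact Submodule.smul_mem _ _ (arcProduct_mem l)
  · rw [Submodule.mem_comap] at hx ⊢
    rw [fockMap_spinVec_cupCapMap c hn hκ, wedgeContract_apply]
    obtain ⟨h1, h2⟩ := contract_mem ((frame c).pairing (vec c i)) hx
    rcases Nat.eq_zero_or_pos l with h | h
    · rw [h2 h, mul_zero]; exact Submodule.zero_mem _
    · have := ι_mul_mem (vec c i) h1
      rwa [Nat.sub_add_cancel h] at this

/-- The image of the diagrams consists of primitive elements. -/
theorem lower_fockMap_spinVec (hn : 2 * n + 1 = 2 * l + d) (hκ : κ ^ 2 = -1)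
    (v : Span ℂ (2 * n + 1) d) : (frame c).lower (fockMap κ (spinVec c) v) = 0 := by
  refine mem_of_stable hn hκ (LinearMap.ker ((frame c).lower ∘ₗ fockMap κ (spinVec c))) ?_
    (fun i x hx => ?_) v
  · rw [LinearMap.mem_ker, LinearMap.comp_apply, fockMap_spinVec_zigzagDiagram, map_smul,
      lower_arcProduct, smul_zero]
    intro j hj k hk
    rw [spinVec_add, spinVec_add, pairing_vec c (by omega) (by omega), if_neg (by omega),
      if_neg (by omega), sub_zero]
  · rw [LinearMap.mem_ker, LinearMap.comp_apply] at hx ⊢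
    rw [fockMap_spinVec_cupCapMap c hn hκ, SymplecticFrame.lower_wedgeContract, hx, map_zero]

theorem fockMap_spinVec_injective (hκ : κ ^ 2 = -1) :
    Function.Injective (fockMap κ (spinVec c) : Span ℂ (2 * n + 1) d → _) := by
  classical
  have hκ0 : κ ≠ 0 := by rintro rfl; norm_num at hκ
  refine (injective_iff_map_eq_zero _).2 fun v hv => by_contra fun hne => ?_
  obtain ⟨D, hD⟩ := exists_stateSum_ne_zero (spinWeight κ)
    (fun D x _ => by rw [spinWeight, if_pos rfl]; exact one_ne_zero) hne
  obtain ⟨F, hF, hF'⟩ := exists_detect (α := spinVec c) hκ0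
    (fun y => dualVec c y + dualVec c (y - 1)) (a := 1) (k := 2 * n)
    (fun x y h1 _ _ h4 => dual_spinVec c h1 (by omega)) (extend D.path)
  have hfock : ∀ s : Fin (2 * n + 1 + d) → Bool, fock κ (spinVec c) (extend s) 0 (2 * n + 1) =
      if s 0 then fock κ (spinVec c) (extend s) 1 (2 * n) else 0 := by
    intro s
    rw [fock_succ, show extend s 0 = s 0 from dif_pos (by omega), site]
    split_ifs
    · rw [one_mul]
    · rw [spinVec, map_zero, smul_zero, zero_mul]
  have h0 : D.path 0 = true := by
    have := D.partner_ne 0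
    simp only [path, decide_eq_true_eq]
    rw [Fin.lt_def]
    exact Nat.pos_of_ne_zero fun e => this (Fin.ext e)
  have := congrArg F hv
  rw [fockMap_apply, map_sum, map_zero, Finset.sum_eq_single D.path] at this
  · rw [map_smul, hfock, if_pos h0, smul_eq_mul, mul_eq_zero] at this
    exact this.elim hD hF
  · intro s hs hne
    rw [map_smul, hfock]
    split_ifs with hs0
    · rw [hF', smul_zero]
      by_contra hcon
      push Not at hcon
      refine hne (funext fun x => ?_)
      rw [Finset.mem_filter] at hs
      by_cases hx : x.val < 2 * n + 1
      · rcases Nat.eq_zero_or_pos x.val with hx0 | hx0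
        · rw [show x = 0 from Fin.ext hx0, hs0, h0]
        · have := hcon x hx0 (by omega)
          rwa [extend, extend, dif_pos x.2, dif_pos x.2] at this
      · rw [hs.2 x (by omega), D.path_bottom (by omega)]
    · rw [map_zero, smul_zero]
  · intro h
    exact absurd (Finset.mem_filter.2 ⟨Finset.mem_univ _, fun x hx => D.path_bottom hx⟩) h

end ChainBasis

/-! ### Primitive elements and the quotient by the Lefschetz image -/

namespace ExteriorAlgebra

theorem coe_exteriorPower_map {R M N : Type*} [CommRing R] [AddCommGroup M] [Module R M]
    [AddCommGroup N] [Module R N] (k : ℕ) (t : M →ₗ[R] N) (x : ⋀[R]^k M) :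
    (exteriorPower.map k t x : ExteriorAlgebra R N) = map t x := by
  have : (⋀[R]^k N).subtype ∘ₗ exteriorPower.map k t =
      (map t).toLinearMap ∘ₗ (⋀[R]^k M).subtype := by
    refine exteriorPower.linearMap_ext (AlternatingMap.ext fun v => ?_)
    simp only [LinearMap.compAlternatingMap_apply, LinearMap.comp_apply,
      exteriorPower.map_apply_ιMulti, Submodule.subtype_apply, exteriorPower.ιMulti_apply_coe,
      AlgHom.toLinearMap_apply, map_apply_ιMulti]
  exact LinearMap.congr_fun this x

end ExteriorAlgebra

namespace SymplecticFrame

open ExteriorAlgebra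

variable {H : Type*} [AddCommGroup H] [Module ℂ H] {n : ℕ} (F : SymplecticFrame H n)

/-- The subspace `ω ∧ Λ^{l-2}` of `Λ^l`. -/
noncomputable def wedgeImage (l : ℕ) : Submodule ℂ (⋀[ℂ]^l H) :=
  Submodule.span ℂ {y | ∃ k, k + 2 = l ∧ ∃ x ∈ ⋀[ℂ]^k H,
    (y : ExteriorAlgebra ℂ H) = F.bivector * x}

theorem exists_of_mem_wedgeImage {l : ℕ} {y : ⋀[ℂ]^l H} (hy : y ∈ F.wedgeImage l) :
    ∃ x ∈ ⋀[ℂ]^(l - 2) H, (l < 2 → x = 0) ∧ (y : ExteriorAlgebra ℂ H) = F.bivector * x := by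
  induction hy using Submodule.span_induction with
  | mem y hy =>
    obtain ⟨k, hk, x, hx, e⟩ := hy
    refine ⟨x, ?_, by omega, e⟩
    rwa [← hk, Nat.add_sub_cancel]
  | zero => exact ⟨0, Submodule.zero_mem _, fun _ => rfl, by simp⟩
  | add y z _ _ hy hz =>
    obtain ⟨x, hx, hx', e⟩ := hy
    obtain ⟨x', hx2, hx2', e'⟩ := hz
    exact ⟨x + x', add_mem hx hx2, fun h => by rw [hx' h, hx2' h, add_zero],
      by rw [Submodule.coe_add, e, e', mul_add]⟩
  | smul r y _ hy =>
    obtain ⟨x, hx, hx', e⟩ := hy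
    exact ⟨r • x, Submodule.smul_mem _ _ hx, fun h => by rw [hx' h, smul_zero],
      by rw [Submodule.coe_smul, e, mul_smul_comm]⟩

/-- Primitive elements meet the multiples of the bivector trivially up to the middle degree. -/
theorem eq_zero_of_mem_wedgeImage {l : ℕ} (hl : l ≤ n) {y : ⋀[ℂ]^l H} (hy : y ∈ F.wedgeImage l)
    (h : F.lower (y : ExteriorAlgebra ℂ H) = 0) : y = 0 := by
  obtain ⟨x, hx, hx', e⟩ := F.exists_of_mem_wedgeImage hy
  have hx0 : x = 0 := by
    rcases Nat.lt_or_ge l 2 with h2 | h2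
    · exact hx' h2
    · exact F.eq_zero_of_lower_bivector_mul hx (by omega) (e ▸ h)
  exact Subtype.ext (by rw [e, hx0, mul_zero]; rfl)

theorem choose_le_finrank_wedgeImage [Module.Finite ℂ H] {l : ℕ} (hl : l ≤ n) (h2 : 2 ≤ l) :
    (Module.finrank ℂ H).choose (l - 2) ≤ Module.finrank ℂ (F.wedgeImage l) := by
  obtain ⟨k, rfl⟩ : ∃ k, l = k + 2 := ⟨l - 2, by omega⟩
  rw [Nat.add_sub_cancel, ← exteriorPower.finrank_eq (R := ℂ) (n := k) (M := H)]
  let L : ⋀[ℂ]^k H →ₗ[ℂ] F.wedgeImage (k + 2) :=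
    LinearMap.codRestrict _ (LinearMap.codRestrict _
      (LinearMap.mulLeft ℂ F.bivector ∘ₗ (⋀[ℂ]^k H).subtype) fun x => F.bivector_mul_mem x.2)
      fun x => Submodule.subset_span ⟨k, rfl, x, x.2, rfl⟩
  refine LinearMap.finrank_le_finrank_of_injective (f := L) ?_
  refine (injective_iff_map_eq_zero L).2 fun x hx => Subtype.ext ?_
  have h0 : F.bivector * (x : ExteriorAlgebra ℂ H) = 0 :=
    congrArg (fun y : F.wedgeImage (k + 2) => ((y : ⋀[ℂ]^(k + 2) H) : ExteriorAlgebra ℂ H)) hx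
  exact F.eq_zero_of_lower_bivector_mul x.2 (by omega) (by rw [h0, map_zero])

theorem wedgeImage_le_comap {t : H →ₗ[ℂ] H} {c : H} (ht : ∀ x, t x = x + F.pairing c x • c) (l : ℕ) :
    F.wedgeImage l ≤ (F.wedgeImage l).comap (exteriorPower.map l t) := by
  refine Submodule.span_le.2 ?_
  rintro y ⟨k, hk, x, hx, e⟩
  refine Submodule.subset_span ⟨k, hk, exteriorPower.map k t ⟨x, hx⟩, Subtype.coe_prop _, ?_⟩
  rw [coe_exteriorPower_map, e, map_mul, F.map_bivector ht, coe_exteriorPower_map]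

end SymplecticFrame

namespace ChainBasis

open ExteriorAlgebra StateSum LinkDiagram

variable {H : Type*} [AddCommGroup H] [Module ℂ H] {n d l : ℕ}
  (c : Module.Basis (Fin (2 * n)) ℂ H)

theorem loopValue_eq_zero {A : ℂˣ} (hA : (A : ℂ) ^ 4 = -1) : loopValue A = 0 := by
  have h0 : (A : ℂ) ≠ 0 := A.ne_zero
  rw [loopValue, Units.val_inv_eq_inv_val]
  field_simp
  linear_combination -hA

theorem inv_sq_sq {A : ℂˣ} (hA : (A : ℂ) ^ 4 = -1) : ((((A⁻¹ : ℂˣ) : ℂ)) ^ 2) ^ 2 = -1 := by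
  have h0 : (A : ℂ) ≠ 0 := A.ne_zero
  rw [Units.val_inv_eq_inv_val, ← pow_mul, inv_pow, hA]
  norm_num

theorem fockMap_spinVec_jonesGen (hn : 2 * n + 1 = 2 * l + d) {A : ℂˣ} (hA : (A : ℂ) ^ 4 = -1)
    (i : Fin (2 * n)) {t : H →ₗ[ℂ] H}
    (ht : ∀ x, t x = x + (frame c).pairing (c i) x • c i) (v : Span ℂ (2 * n + 1) d) :
    fockMap (((A⁻¹ : ℂˣ) : ℂ) ^ 2) (spinVec c) (jonesGen A i v) =
      map t (fockMap (((A⁻¹ : ℂˣ) : ℂ) ^ 2) (spinVec c) v) := by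
  rw [jonesGen_eq, loopValue_eq_zero hA, map_transvection ht, ← vec_fin,
    ← fockMap_spinVec_cupCapMap c hn (inv_sq_sq hA), ← map_add]
  rfl

/-- The diagrams map isomorphically to the exterior power modulo the multiples of the bivector: the
image consists of primitive elements, and the dimensions agree. -/
theorem exists_linearEquiv (hn : 2 * n + 1 = 2 * l + d) {A : ℂˣ} (hA : (A : ℂ) ^ 4 = -1)
    (t : Fin (2 * n) → H →ₗ[ℂ] H)
    (ht : ∀ i x, t i x = x + (frame c).pairing (c i) x • c i) :
    ∃ e : Span ℂ (2 * n + 1) d ≃ₗ[ℂ] (⋀[ℂ]^l H ⧸ (frame c).wedgeImage l), ∀ (i : Fin (2 * n)) v,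
      e (jonesGen A i v) = ((frame c).wedgeImage l).mapQ ((frame c).wedgeImage l)
        (exteriorPower.map l (t i)) ((frame c).wedgeImage_le_comap (ht i) l) (e v) := by
  have hκ := inv_sq_sq hA
  have := Module.Finite.of_basis c
  have := Fintype.ofFinite (LinkDiagram (2 * n + 1) d)
  have hH : Module.finrank ℂ H = 2 * n := by
    rw [Module.finrank_eq_card_basis c, Fintype.card_fin]
  let Ψ : Span ℂ (2 * n + 1) d →ₗ[ℂ] ⋀[ℂ]^l H :=
    LinearMap.codRestrict _ (fockMap (((A⁻¹ : ℂˣ) : ℂ) ^ 2) (spinVec c))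
      (fockMap_spinVec_mem c hn hκ)
  have hinj : Function.Injective (((frame c).wedgeImage l).mkQ ∘ₗ Ψ) := by
    refine (injective_iff_map_eq_zero _).2 fun v hv => ?_
    rw [LinearMap.comp_apply, Submodule.mkQ_apply, Submodule.Quotient.mk_eq_zero] at hv
    have h0 := (frame c).eq_zero_of_mem_wedgeImage (by omega) hv (lower_fockMap_spinVec c hn hκ v)
    refine fockMap_spinVec_injective c hκ ?_
    rw [map_zero]
    exact congrArg Subtype.val h0
  -- `≤` holds by injectivity. For `≥`, the quotient has dimension at most
  -- `C(2n, l) - C(2n, l - 2) = C(2n + 1, l) - C(2n + 1, l - 1)`, which is the ballot number.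
  have hdim : Module.finrank ℂ (Span ℂ (2 * n + 1) d) =
      Module.finrank ℂ (⋀[ℂ]^l H ⧸ (frame c).wedgeImage l) := by
    refine le_antisymm (LinearMap.finrank_le_finrank_of_injective hinj) ?_
    have h1 := ((frame c).wedgeImage l).finrank_quotient_add_finrank
    have h2 := choose_le_card (l := l) (d := d) hn
    rw [exteriorPower.finrank_eq, hH] at h1
    rw [Module.finrank_finsupp_self, ← Nat.card_eq_fintype_card]
    rcases l with - | l
    · rw [if_pos rfl, Nat.choose_zero_right] at h2
      rw [Nat.choose_zero_right] at h1
      omega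
    · rw [if_neg (by omega), Nat.add_sub_cancel, Nat.choose_succ_succ] at h2
      rcases l with - | l
      · simp only [Nat.choose_zero_right, Nat.succ_eq_add_one, zero_add] at *
        omega
      · have h3 := (frame c).choose_le_finrank_wedgeImage (l := l + 1 + 1) (by omega) (by omega)
        rw [hH, show l + 1 + 1 - 2 = l by omega] at h3
        simp only [Nat.succ_eq_add_one] at *
        rw [Nat.choose_succ_succ (2 * n) l, Nat.succ_eq_add_one] at h2
        omega
  refine ⟨LinearMap.linearEquivOfInjective _ hinj hdim, fun i v => ?_⟩
  rw [LinearMap.linearEquivOfInjective_apply, LinearMap.linearEquivOfInjective_apply,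
    LinearMap.comp_apply, LinearMap.comp_apply, Submodule.mkQ_apply, Submodule.mkQ_apply,
    Submodule.mapQ_apply]
  congr 1
  refine Subtype.ext ?_
  rw [coe_exteriorPower_map]
  exact fockMap_spinVec_jonesGen c hn hA i (ht i) v

end ChainBasis

/-! ### Path cocycles -/

/-- A `1`-cocycle on a space `X` with complex coefficients, as a function of paths. A singular
`2`-simplex is presented as the restriction of a map of the square to the triangle with the vertices
`(0, 0)`, `(1, 0)`, `(1, 1)`. -/
structure PathCocycle (X : Type) [TopologicalSpace X] where
  /-- the value on a path -/
  toFun : C(I, X) → ℂ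
  triangle : ∀ F : C(I × I, X), toFun ⟨fun t => F (t, 0), by fun_prop⟩ +
    toFun ⟨fun t => F (1, t), by fun_prop⟩ = toFun ⟨fun t => F (t, t), by fun_prop⟩

namespace PathCocycle

variable {X Y : Type} [TopologicalSpace X] [TopologicalSpace Y]

instance : CoeFun (PathCocycle X) fun _ => C(I, X) → ℂ := ⟨toFun⟩

/-- The function `f` on points is a primitive of the cocycle `φ`. -/
def IsPrimitive (φ : PathCocycle X) (f : X → ℂ) : Prop := ∀ γ : C(I, X), φ γ = f (γ 1) - f (γ 0)

/-- The pullback of a cocycle along a continuous map. -/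
def comap (f : C(X, Y)) (φ : PathCocycle Y) : PathCocycle X where
  toFun γ := φ (f.comp γ)
  triangle F := φ.triangle (f.comp F)

theorem comap_apply (f : C(X, Y)) (φ : PathCocycle Y) (γ : C(I, X)) :
    φ.comap f γ = φ (f.comp γ) := rfl

variable (φ : PathCocycle X)

theorem square (F : C(I × I, X)) : φ ⟨fun t => F (t, 0), by fun_prop⟩ +
    φ ⟨fun t => F (1, t), by fun_prop⟩ =
      φ ⟨fun t => F (0, t), by fun_prop⟩ + φ ⟨fun t => F (t, 1), by fun_prop⟩ :=
  (φ.triangle F).trans (φ.triangle ⟨fun p => F (p.2, p.1), by fun_prop⟩).symm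

theorem const (x : X) : φ (.const I x) = 0 := by
  have h := φ.triangle (.const _ x)
  exact add_eq_left.1 h

/-- Cocycles on a real topological vector space have primitives: integrate along the segments from
the origin. -/
theorem exists_isPrimitive {E : Type} [AddCommGroup E] [Module ℝ E] [TopologicalSpace E]
    [ContinuousSMul ℝ E] (φ : PathCocycle E) : ∃ P, φ.IsPrimitive P := by
  refine ⟨fun x => φ ⟨fun t => (t : ℝ) • x, by fun_prop⟩, fun γ => ?_⟩
  have h := φ.square ⟨fun p => (p.1 : ℝ) • γ p.2, by fun_prop⟩
  have h0 := φ.const 0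
  have e1 : (⟨fun t => (((0 : I)) : ℝ) • γ t, by fun_prop⟩ : C(I, E)) = .const I 0 := by ext; simp
  have e2 : (⟨fun t => (((1 : I)) : ℝ) • γ t, by fun_prop⟩ : C(I, E)) = γ := by ext; simp
  simp only [ContinuousMap.coe_mk] at h
  rw [e1, e2, h0] at h
  linear_combination h

/-- The restriction of a path to the interval between two parameters. -/
noncomputable def subpath (γ : C(I, X)) (a b : I) : C(I, X) :=
  ⟨fun t => γ (Set.projIcc 0 1 zero_le_one ((1 - t) * a + t * b)), by
    have := continuous_projIcc (a := (0 : ℝ)) (b := 1) (h := zero_le_one)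
    fun_prop⟩

theorem exists_subpath_eq (γ : C(I, X)) :
    ∃ P : I → ℂ, ∀ a b, φ (subpath γ a b) = P b - P a := by
  have hc := continuous_projIcc (a := (0 : ℝ)) (b := 1) (h := zero_le_one)
  obtain ⟨P, hP⟩ := exists_isPrimitive (φ.comap (γ.comp ⟨Set.projIcc (0 : ℝ) 1 zero_le_one, hc⟩))
  refine ⟨fun t => P t, fun a b => ?_⟩
  have h := hP ⟨fun t => (1 - t) * a + t * b, by fun_prop⟩
  rw [comap_apply] at h
  refine h.trans ?_
  simp

theorem subpath_zero_one (γ : C(I, X)) : subpath γ 0 1 = γ := by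
  ext t
  simp [subpath]

/-- A function which is a primitive locally is a primitive. -/
theorem isPrimitive_of_local (Q : X → ℂ) (h : ∀ x, ∃ U : Set X, IsOpen U ∧ x ∈ U ∧
    ∀ γ : C(I, X), (∀ t, γ t ∈ U) → φ γ = Q (γ 1) - Q (γ 0)) : φ.IsPrimitive Q := by
  intro γ
  obtain ⟨P, hP⟩ := φ.exists_subpath_eq γ
  -- the difference between `Q` and the integral along `γ` is locally constant
  have hloc : IsLocallyConstant fun t => P t - Q (γ t) := by
    rw [IsLocallyConstant.iff_exists_open]
    intro t
    obtain ⟨U, hU, ht, hφ⟩ := h (γ t)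
    obtain ⟨ε, hε, hb⟩ := Metric.isOpen_iff.1 (hU.preimage γ.continuous) t ht
    refine ⟨Metric.ball t ε, Metric.isOpen_ball, Metric.mem_ball_self hε, fun s hs => ?_⟩
    have h1 := hφ (subpath γ t s) fun r => hb (by
      have hs' : |(s : ℝ) - t| < ε := hs
      have hm : (1 - (r : ℝ)) * t + r * s ∈ Set.Icc (0 : ℝ) 1 := by
        have h1 := convex_Icc (0 : ℝ) 1 t.2 s.2 (sub_nonneg.2 r.2.2) r.2.1 (by ring)
        simpa using h1
      rw [Set.projIcc_of_mem _ hm, Metric.mem_ball, Subtype.dist_eq, Real.dist_eq]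
      have h2 : (1 - (r : ℝ)) * t + r * s - t = r * (s - t) := by ring
      rw [h2, abs_mul, abs_of_nonneg r.2.1]
      exact (mul_le_of_le_one_left (abs_nonneg _) r.2.2).trans_lt hs')
    have e0 : subpath γ t s 0 = γ t := by simp [subpath]
    have e1 : subpath γ t s 1 = γ s := by simp [subpath]
    rw [hP, e0, e1] at h1
    linear_combination h1
  have h2 := hP 0 1
  have h3 := hloc.apply_eq_of_isPreconnected isPreconnected_univ (Set.mem_univ 0) (Set.mem_univ 1)
  rw [subpath_zero_one] at h2
  rw [h2]
  linear_combination -h3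

end PathCocycle

/-! ### The dual of the first homology -/

namespace PathCocycle

open CategoryTheory Limits Simplicial

section

variable {X Y : Type} [TopologicalSpace X] [TopologicalSpace Y]

/-- The singular simplicial set of a space. -/
noncomputable abbrev sing (X : Type) [TopologicalSpace X] : SSet.{0} :=
  TopCat.toSSet.obj (TopCat.of X)

/-- The singular chain complex with complex coefficients. -/
noncomputable abbrev singChain (X : Type) [TopologicalSpace X] : ChainComplex (ModuleCat.{0} ℂ) ℕ :=
  (sing X).chainComplex (ModuleCat.of ℂ ℂ)

/-- Singular `1`-simplices are paths. -/
noncomputable def simplexEquiv (X : Type) [TopologicalSpace X] : (sing X) _⦋1⦌ ≃ C(I, X) :=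
  ((TopCat.of X).toSSetObjEquiv _).trans
    (stdSimplexHomeomorphUnitInterval.continuousMapCongr (.refl _))

theorem simplexEquiv_apply (x : (sing X) _⦋1⦌) (t : I) : simplexEquiv X x t =
    (TopCat.of X).toSSetObjEquiv _ x (stdSimplexHomeomorphUnitInterval.symm t) := rfl

/-- The map of the square onto the standard `2`-simplex which collapses one half of the square onto
the diagonal. -/
noncomputable def squareToSimplex (p : I × I) : stdSimplex ℝ (Fin 3) :=
  ⟨![1 - p.1, p.1 - min (p.1 : ℝ) p.2, min (p.1 : ℝ) p.2], by
    refine ⟨fun i => ?_, ?_⟩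
    · have h1 := p.1.2.1
      have h2 := p.1.2.2
      have h3 := p.2.2.1
      fin_cases i
      · simp [h2]
      · simp
      · simp [h1, h3]
    · simp [Fin.sum_univ_three]⟩

theorem continuous_squareToSimplex : Continuous squareToSimplex := by
  refine Continuous.subtype_mk (continuous_pi fun i => ?_) _
  fin_cases i <;> simp <;> fun_prop

/-- The inclusion of the standard `2`-simplex in the square as the lower half. -/
noncomputable def simplexToSquare (p : stdSimplex ℝ (Fin 3)) : I × I :=
  (⟨1 - p 0, by linarith [stdSimplex.le_one p 0], by linarith [stdSimplex.zero_le p 0]⟩,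
    ⟨p 2, stdSimplex.zero_le p 2, stdSimplex.le_one p 2⟩)

theorem continuous_simplexToSquare : Continuous simplexToSquare := by
  have h : ∀ i, Continuous fun p : stdSimplex ℝ (Fin 3) => p i := fun i =>
    (continuous_apply i).comp continuous_subtype_val
  exact ((continuous_const.sub (h 0)).subtype_mk _).prodMk ((h 2).subtype_mk _)

theorem simplexToSquare_squareToSimplex {u v : I} (h : v ≤ u) :
    simplexToSquare (squareToSimplex (u, v)) = (u, v) := by
  have h0 : (squareToSimplex (u, v)) 0 = 1 - u := rfl
  have h2 : (squareToSimplex (u, v)) 2 = min (u : ℝ) v := rfl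
  refine Prod.ext (Subtype.ext ?_) (Subtype.ext ?_)
  · change 1 - (squareToSimplex (u, v)) 0 = u
    rw [h0]
    ring
  · change (squareToSimplex (u, v)) 2 = v
    rw [h2, min_eq_right (by exact_mod_cast h)]

/-- The square of a singular `2`-simplex. -/
noncomputable def squareOf (x : (sing X) _⦋2⦌) : C(I × I, X) :=
  ((TopCat.of X).toSSetObjEquiv _ x).comp ⟨squareToSimplex, continuous_squareToSimplex⟩

theorem simplexEquiv_δ (x : (sing X) _⦋2⦌) (i : Fin 3) (t : I) (p : I × I)
    (h : (squareToSimplex p : Fin 3 → ℝ) =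
      stdSimplex.map (SimplexCategory.δ i) (stdSimplexHomeomorphUnitInterval.symm t)) :
    simplexEquiv X ((sing X).δ i x) t = squareOf x p := by
  have h2 : stdSimplex.map (SimplexCategory.δ i) (stdSimplexHomeomorphUnitInterval.symm t) =
    squareToSimplex p := stdSimplex.ext h.symm
  change (TopCat.of X).toSSetObjEquiv _ x _ = (TopCat.of X).toSSetObjEquiv _ x _
  exact congrArg _ h2

theorem map_δ (i : Fin 3) (t : I) (k : Fin 3) :
    stdSimplex.map (SimplexCategory.δ i) (stdSimplexHomeomorphUnitInterval.symm t) k =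
      (if i.succAbove 0 = k then 1 - (t : ℝ) else 0) + if i.succAbove 1 = k then (t : ℝ) else 0 := by
  have h : (stdSimplex.map (SimplexCategory.δ i) (stdSimplexHomeomorphUnitInterval.symm t) :
      Fin 3 → ℝ) k = ∑ j : Fin 2 with i.succAbove j = k, ![1 - (t : ℝ), t] j :=
    FunOnFinite.linearMap_apply_apply ..
  rw [h, Finset.sum_filter, Fin.sum_univ_two]
  rfl

/-- The functional on chains that belongs to a cochain. -/
noncomputable def chainHom (φ : C(I, X) → ℂ) : (singChain X).X 1 ⟶ ModuleCat.of ℂ ℂ :=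
  Cofan.IsColimit.desc ((sing X).isColimitChainComplexXCofan (ModuleCat.of ℂ ℂ) 1)
    fun x => ModuleCat.ofHom (φ (simplexEquiv X x) • LinearMap.id)

theorem ι_chainHom (φ : C(I, X) → ℂ) (x : (sing X) _⦋1⦌) :
    (sing X).ιChainComplex x ≫ chainHom φ =
      ModuleCat.ofHom (φ (simplexEquiv X x) • (LinearMap.id : ℂ →ₗ[ℂ] ℂ)) :=
  Cofan.IsColimit.fac ((sing X).isColimitChainComplexXCofan (ModuleCat.of ℂ ℂ) 1) _ x

theorem simplexEquiv_δ_zero (x : (sing X) _⦋2⦌) : simplexEquiv X ((sing X).δ 0 x) =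
    ⟨fun t => squareOf x (1, t), by fun_prop⟩ := by
  refine ContinuousMap.ext fun t => simplexEquiv_δ x 0 t _ (funext fun k => ?_)
  rw [map_δ]
  have := t.2.2
  fin_cases k <;> simp [squareToSimplex, Fin.succAbove, this] <;> rfl

theorem simplexEquiv_δ_one (x : (sing X) _⦋2⦌) : simplexEquiv X ((sing X).δ 1 x) =
    ⟨fun t => squareOf x (t, t), by fun_prop⟩ := by
  refine ContinuousMap.ext fun t => simplexEquiv_δ x 1 t _ (funext fun k => ?_)
  rw [map_δ]
  fin_cases k <;> simp [squareToSimplex, Fin.succAbove] <;> rfl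

theorem simplexEquiv_δ_two (x : (sing X) _⦋2⦌) : simplexEquiv X ((sing X).δ 2 x) =
    ⟨fun t => squareOf x (t, 0), by fun_prop⟩ := by
  refine ContinuousMap.ext fun t => simplexEquiv_δ x 2 t _ (funext fun k => ?_)
  rw [map_δ]
  have := t.2.1
  fin_cases k <;> simp [squareToSimplex, Fin.succAbove, this] <;> rfl

theorem d_chainHom (φ : PathCocycle X) : (singChain X).d 2 1 ≫ chainHom φ = 0 := by
  refine SSet.chainComplex_hom_ext fun x => ?_
  rw [SSet.ιChainComplex_d_assoc, Preadditive.sum_comp, Limits.comp_zero, Fin.sum_univ_three]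
  simp only [Preadditive.zsmul_comp, ι_chainHom, simplexEquiv_δ_zero, simplexEquiv_δ_one,
    simplexEquiv_δ_two]
  have h := φ.triangle (squareOf x)
  refine ModuleCat.hom_ext (LinearMap.ext fun z => ?_)
  simp [← h]
  ring

/-- The morphism from homology that a cocycle induces. -/
noncomputable def evalHom (φ : PathCocycle X) : (singChain X).homology 1 ⟶ ModuleCat.of ℂ ℂ :=
  (singChain X).homologyι 1 ≫ (singChain X).descOpcycles (chainHom φ) 2 (by simp) (d_chainHom φ)

/-- The evaluation of a cocycle on homology classes. -/
noncomputable def eval (φ : PathCocycle X) : H1 X →ₗ[ℂ] ℂ := (evalHom φ).hom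

theorem eval_map (φ : PathCocycle Y) (f : C(X, Y)) (u : H1 X) :
    eval φ (H1.map f u) = eval (φ.comap f) u := by
  have h : HomologicalComplex.homologyMap
      (SSet.chainComplexMap (TopCat.toSSet.map (TopCat.ofHom f)) (ModuleCat.of ℂ ℂ)) 1 ≫ evalHom φ =
      evalHom (φ.comap f) := by
    rw [evalHom, HomologicalComplex.homologyι_naturality_assoc, evalHom]
    congr 1
    rw [← cancel_epi ((singChain X).pOpcycles 1), HomologicalComplex.p_descOpcycles,
      HomologicalComplex.p_opcyclesMap_assoc, HomologicalComplex.p_descOpcycles]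
    refine SSet.chainComplex_hom_ext fun x => ?_
    rw [SSet.ι_chainComplexMap_f_assoc, ι_chainHom, ι_chainHom]
    rfl
  exact congrArg (fun k => k.hom u) h

/-- The functional on `0`-chains that belongs to a function on points. -/
noncomputable def pointHom (f : X → ℂ) : (singChain X).X 0 ⟶ ModuleCat.of ℂ ℂ :=
  Cofan.IsColimit.desc ((sing X).isColimitChainComplexXCofan (ModuleCat.of ℂ ℂ) 0)
    fun x => ModuleCat.ofHom (f ((TopCat.of X).toSSetObjEquiv _ x default) • LinearMap.id)

theorem ι_pointHom (f : X → ℂ) (x : (sing X) _⦋0⦌) :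
    (sing X).ιChainComplex x ≫ pointHom f =
      ModuleCat.ofHom (f ((TopCat.of X).toSSetObjEquiv _ x default) • (LinearMap.id : ℂ →ₗ[ℂ] ℂ)) :=
  Cofan.IsColimit.fac ((sing X).isColimitChainComplexXCofan (ModuleCat.of ℂ ℂ) 0) _ x

theorem toSSetObjEquiv_δ (x : (sing X) _⦋1⦌) (i : Fin 2) (t : I)
    (h : ∀ k, (if i.succAbove 0 = k then (1 : ℝ) else 0) = ![1 - (t : ℝ), t] k) :
    (TopCat.of X).toSSetObjEquiv _ ((sing X).δ i x) default = simplexEquiv X x t := by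
  change (TopCat.of X).toSSetObjEquiv _ x (stdSimplex.map (SimplexCategory.δ i) default) = _
  rw [simplexEquiv_apply]
  refine congrArg _ (stdSimplex.ext (funext fun k => ?_))
  have h1 : (stdSimplex.map (SimplexCategory.δ i) (default : stdSimplex ℝ (Fin 1)) : Fin 2 → ℝ) k =
      ∑ j : Fin 1 with i.succAbove j = k, (default : stdSimplex ℝ (Fin 1)) j :=
    FunOnFinite.linearMap_apply_apply ..
  have h2 : (default : stdSimplex ℝ (Fin 1)) 0 = 1 := by simp
  refine h1.trans ?_
  rw [Finset.sum_filter, Fin.sum_univ_one, h2]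
  exact h k

theorem eval_eq_zero {φ : PathCocycle X} {f : X → ℂ} (h : φ.IsPrimitive f) : eval φ = 0 := by
  have h1 : chainHom φ = (singChain X).d 1 0 ≫ pointHom f := by
    refine SSet.chainComplex_hom_ext fun x => ?_
    rw [ι_chainHom, SSet.ιChainComplex_d_assoc, Preadditive.sum_comp, Fin.sum_univ_two]
    simp only [Preadditive.zsmul_comp, ι_pointHom]
    rw [toSSetObjEquiv_δ x 0 1 (by intro k; fin_cases k <;> simp [Fin.succAbove]),
      toSSetObjEquiv_δ x 1 0 (by intro k; fin_cases k <;> simp [Fin.succAbove]), h]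
    refine ModuleCat.hom_ext (LinearMap.ext fun z => ?_)
    simp
    ring
  have h2 : evalHom φ = 0 := by
    have h3 : (singChain X).descOpcycles (chainHom φ) 2 (by simp) (d_chainHom φ) =
        (singChain X).fromOpcycles 1 0 ≫ pointHom f := by
      rw [← cancel_epi ((singChain X).pOpcycles 1), HomologicalComplex.p_descOpcycles,
        HomologicalComplex.p_fromOpcycles_assoc, h1]
    rw [evalHom, h3, HomologicalComplex.homologyι_comp_fromOpcycles_assoc, Limits.zero_comp]
  rw [eval, h2]
  rfl

/-- A closed path has a homology class. -/
theorem exists_class (γ : C(I, X)) (h : γ 0 = γ 1) : ∃ u : H1 X, ∀ φ : PathCocycle X,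
    eval φ u = φ γ := by
  set x := (simplexEquiv X).symm γ with hx
  have hd : (sing X).ιChainComplex x ≫ (singChain X).d 1 0 = 0 := by
    have e : (sing X).δ 0 x = (sing X).δ 1 x := by
      refine ((TopCat.of X).toSSetObjEquiv _).injective (ContinuousMap.ext fun p => ?_)
      obtain rfl : p = default := Subsingleton.elim _ _
      rw [toSSetObjEquiv_δ x 0 1 (by intro k; fin_cases k <;> simp [Fin.succAbove]),
        toSSetObjEquiv_δ x 1 0 (by intro k; fin_cases k <;> simp [Fin.succAbove]), hx,
        Equiv.apply_symm_apply, h]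
    rw [SSet.ιChainComplex_d, Fin.sum_univ_two, e]
    simp
  refine ⟨((singChain X).liftCycles ((sing X).ιChainComplex x) 0 (by simp) hd ≫
    (singChain X).homologyπ 1).hom (1 : ℂ), fun φ => ?_⟩
  have h1 : ((singChain X).liftCycles ((sing X).ιChainComplex x) 0 (by simp) hd ≫
      (singChain X).homologyπ 1) ≫ evalHom φ =
        ModuleCat.ofHom (φ γ • (LinearMap.id : ℂ →ₗ[ℂ] ℂ)) := by
    rw [evalHom, Category.assoc, HomologicalComplex.homology_π_ι_assoc,
      HomologicalComplex.p_descOpcycles, HomologicalComplex.liftCycles_i_assoc, ι_chainHom, hx,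
      Equiv.apply_symm_apply]
  have h2 := congrArg (fun k => k.hom (1 : ℂ)) h1
  exact h2.trans (mul_one _)

/-- Every functional on the homology is the evaluation of a cocycle. -/
theorem exists_eval_eq (L : H1 X →ₗ[ℂ] ℂ) : ∃ φ : PathCocycle X, eval φ = L := by
  have hker : LinearMap.ker ((singChain X).homologyι 1).hom = ⊥ :=
    LinearMap.ker_eq_bot.2 ((ModuleCat.mono_iff_injective _).1 inferInstance)
  obtain ⟨r, hr⟩ := LinearMap.exists_leftInverse_of_injective _ hker
  set E : (singChain X).opcycles 1 ⟶ ModuleCat.of ℂ ℂ := ModuleCat.ofHom (L ∘ₗ r) with hE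
  have key : ∀ x : (sing X) _⦋1⦌, (sing X).ιChainComplex x ≫ (singChain X).pOpcycles 1 ≫ E =
      ModuleCat.ofHom ((((sing X).ιChainComplex x ≫ (singChain X).pOpcycles 1 ≫ E).hom (1 : ℂ) : ℂ) •
        (LinearMap.id : ℂ →ₗ[ℂ] ℂ)) := by
    intro x
    refine ModuleCat.hom_ext (LinearMap.ext_ring ?_)
    simp
  set ψ : C(I, X) → ℂ := fun γ =>
    ((sing X).ιChainComplex ((simplexEquiv X).symm γ) ≫ (singChain X).pOpcycles 1 ≫ E).hom (1 : ℂ)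
    with hψ
  have hψ' : ∀ x, ψ (simplexEquiv X x) =
      ((sing X).ιChainComplex x ≫ (singChain X).pOpcycles 1 ≫ E).hom (1 : ℂ) := fun x => by
    rw [hψ]
    simp only [Equiv.symm_apply_apply]
  let φ : PathCocycle X :=
    { toFun := ψ
      triangle := fun F => by
        set x := ((TopCat.of X).toSSetObjEquiv (.op ⦋2⦌)).symm
          (F.comp ⟨simplexToSquare, continuous_simplexToSquare⟩) with hx
        have hs : ∀ u v : I, v ≤ u → F (u, v) = squareOf x (u, v) := fun u v huv => by
          rw [hx, squareOf, Equiv.apply_symm_apply]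
          exact congrArg F (simplexToSquare_squareToSimplex huv).symm
        have e0 := simplexEquiv_δ_zero x
        have e1 := simplexEquiv_δ_one x
        have e2 := simplexEquiv_δ_two x
        simp only [hs _ _ (unitInterval.nonneg'), hs _ _ (unitInterval.le_one'), hs _ _ le_rfl]
        rw [← e0, ← e1, ← e2, hψ', hψ', hψ']
        have h := SSet.ιChainComplex_d_assoc (sing X) (ModuleCat.of ℂ ℂ) x ((singChain X).pOpcycles 1 ≫ E)
        rw [HomologicalComplex.d_pOpcycles_assoc, Limits.zero_comp, Limits.comp_zero,
          Preadditive.sum_comp, Fin.sum_univ_three] at h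
        have h2 := congrArg (fun k => k.hom (1 : ℂ)) h
        simp at h2
        simp
        linear_combination -h2 }
  refine ⟨φ, ?_⟩
  have h1 : (singChain X).descOpcycles (chainHom φ) 2 (by simp) (d_chainHom φ) = E := by
    rw [← cancel_epi ((singChain X).pOpcycles 1), HomologicalComplex.p_descOpcycles]
    refine SSet.chainComplex_hom_ext fun x => ?_
    rw [ι_chainHom, key x]
    exact congrArg (fun z => ModuleCat.ofHom (z • (LinearMap.id : ℂ →ₗ[ℂ] ℂ))) (hψ' x)
  rw [eval, evalHom, h1, hE]
  refine LinearMap.ext fun u => ?_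
  exact congrArg L (LinearMap.congr_fun hr u)

end

end PathCocycle

/-! ### The homology of the circle and of the annulus -/

namespace PathCocycle

/-- The projection of the line onto the circle. -/
noncomputable def circleMk : C(ℝ, UnitAddCircle) := ⟨fun x => x, AddCircle.continuous_mk' 1⟩

theorem circleMk_apply (x : ℝ) : circleMk x = (x : UnitAddCircle) := rfl

theorem isCoveringMap_circleMk : IsCoveringMap circleMk := AddCircle.isCoveringMap_coe 1

theorem circleMk_surjective : Function.Surjective circleMk := QuotientAddGroup.mk_surjective

/-- The path which runs once around the circle. -/
noncomputable def circleLoop : C(I, UnitAddCircle) := ⟨fun t => ((t : ℝ) : UnitAddCircle), by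
  exact circleMk.continuous.comp continuous_subtype_val⟩

theorem exists_pathLift (γ : C(I, UnitAddCircle)) : ∃ g : C(I, ℝ), ∀ t, γ t = (g t : UnitAddCircle) := by
  obtain ⟨e, he⟩ := circleMk_surjective (γ 0)
  obtain ⟨g, hg, -⟩ := isCoveringMap_circleMk.exists_path_lifts γ e he.symm
  exact ⟨g, fun t => (congrFun hg t).symm⟩

/-- A cocycle on the annulus which vanishes on the core has a primitive. -/
theorem exists_isPrimitive_annulus (φ : PathCocycle Annulus) (y₀ : I)
    (h : φ (circleLoop.prodMk (.const I y₀)) = 0) : ∃ Q, φ.IsPrimitive Q := by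
  have hc := continuous_projIcc (a := (0 : ℝ)) (b := 1) (h := zero_le_one)
  set F : C(ℝ × ℝ, Annulus) := ⟨fun p => (circleMk p.1, Set.projIcc 0 1 zero_le_one p.2), by fun_prop⟩
    with hF
  obtain ⟨P, hP⟩ := exists_isPrimitive (φ.comap F)
  have hper : ∀ x y : ℝ, P (x + 1, y) = P (x, y) := by
    intro x y
    have h1 := hP ⟨fun t => (t * x, y₀ + t * (y - y₀)), by fun_prop⟩
    have h2 := hP ⟨fun t => (t * x + 1, y₀ + t * (y - y₀)), by fun_prop⟩
    have h3 := hP ⟨fun t => (t, y₀), by fun_prop⟩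
    rw [comap_apply] at h1 h2 h3
    have e1 : F.comp (⟨fun t => (t * x + 1, y₀ + t * (y - y₀)), by fun_prop⟩ : C(I, ℝ × ℝ)) =
        F.comp (⟨fun t => (t * x, y₀ + t * (y - y₀)), by fun_prop⟩ : C(I, ℝ × ℝ)) := by
      ext t
      · exact AddCircle.coe_add_period 1 _
      · rfl
    have e2 : F.comp (⟨fun t => (t, y₀), by fun_prop⟩ : C(I, ℝ × ℝ)) =
        circleLoop.prodMk (.const I y₀) := by
      ext t
      · rfl
      · simp [hF]
    rw [e1] at h2
    rw [e2, h] at h3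
    have h4 := h1.symm.trans h2
    simp only [ContinuousMap.coe_mk, Set.Icc.coe_one, Set.Icc.coe_zero, zero_mul, one_mul,
      zero_add, add_zero, add_sub_cancel] at h3 h4
    linear_combination -h3 - h4
  have hper' : Function.Periodic (fun (x : ℝ) (y : ℝ) => P (x, y)) 1 := fun x => funext (hper x)
  refine ⟨fun a => hper'.lift a.1 a.2, fun γ => ?_⟩
  obtain ⟨g, hg⟩ := exists_pathLift (ContinuousMap.fst.comp γ)
  have h1 := hP (g.prodMk ⟨fun t => ((γ t).2 : ℝ), by fun_prop⟩)
  have hg' : ∀ t, (γ t).1 = (g t : UnitAddCircle) := hg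
  have e : F.comp (g.prodMk ⟨fun t => ((γ t).2 : ℝ), by fun_prop⟩) = γ := by
    ext t
    · exact (hg t).symm
    · simp [hF]
  rw [comap_apply, e] at h1
  have h2 : ∀ t, hper'.lift (γ t).1 (γ t).2 = P (g t, (γ t).2) := fun t => by
    rw [hg', Function.Periodic.lift_coe]
  exact h1.trans (congrArg₂ (· - ·) (h2 1).symm (h2 0).symm)

/-- A cocycle on the circle which vanishes on the circle has a primitive. -/
theorem exists_isPrimitive_circle (φ : PathCocycle UnitAddCircle) (h : φ circleLoop = 0) :
    ∃ Q, φ.IsPrimitive Q := by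
  obtain ⟨Q, hQ⟩ := exists_isPrimitive_annulus (φ.comap ContinuousMap.fst) 0 h
  exact ⟨fun θ => Q (θ, 0), fun γ => hQ (γ.prodMk (.const I 0))⟩

/-- The total change of the angle along a path in the circle. -/
noncomputable def angle (γ : C(I, UnitAddCircle)) : ℝ :=
  (exists_pathLift γ).choose 1 - (exists_pathLift γ).choose 0

theorem angle_eq {γ : C(I, UnitAddCircle)} {g : I → ℝ} (hc : Continuous g)
    (h : ∀ t, γ t = (g t : UnitAddCircle)) : angle γ = g 1 - g 0 := by
  have hγ := (exists_pathLift γ).choose_spec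
  rw [angle]
  set f := (exists_pathLift γ).choose
  have h0 : ∀ t, circleMk (g t - g 0 + f 0) = γ t := fun t => by
    rw [circleMk_apply, AddCircle.coe_add, AddCircle.coe_sub, ← h, ← h, ← hγ]
    abel
  have h1 := (isCoveringMap_circleMk.eq_liftPath_iff' (γ := γ) (e := f 0) (γ_0 := hγ 0)
    (Γ := f)).2 ⟨funext fun t => (hγ t).symm, rfl⟩
  have h2 := (isCoveringMap_circleMk.eq_liftPath_iff' (γ := γ) (e := f 0) (γ_0 := hγ 0)
    (Γ := ⟨fun t => g t - g 0 + f 0, by fun_prop⟩)).2 ⟨funext h0, by simp⟩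
  have h3 := DFunLike.congr_fun (h1.trans h2.symm) 1
  rw [h3]
  simp

/-- The change of the angle, as a cocycle: the angular form of the circle. -/
noncomputable def angular : PathCocycle UnitAddCircle where
  toFun γ := angle γ
  triangle F := by
    obtain ⟨f, hf⟩ := exists_pathLift ⟨fun a => F (0, a), by fun_prop⟩
    set G := isCoveringMap_circleMk.liftHomotopy F f hf with hG
    have h : ∀ p, F p = (G p : UnitAddCircle) := fun p =>
      (congrFun (isCoveringMap_circleMk.liftHomotopy_lifts F f hf) p).symm
    rw [angle_eq (g := fun t => G (t, 0)) (by fun_prop) fun t => h _,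
      angle_eq (g := fun t => G (1, t)) (by fun_prop) fun t => h _,
      angle_eq (g := fun t => G (t, t)) (by fun_prop) fun t => h _]
    push_cast
    ring

theorem angular_eq {γ : C(I, UnitAddCircle)} {g : I → ℝ} (hc : Continuous g)
    (h : ∀ t, γ t = (g t : UnitAddCircle)) : angular γ = (g 1 : ℂ) - g 0 := by
  have h1 : angular γ = (angle γ : ℂ) := rfl
  rw [h1, angle_eq hc h]
  push_cast
  rfl

/-- The homology of the circle is spanned by the class of the circle. -/
theorem exists_circleClass : ∃ u₀ : H1 UnitAddCircle,
    (∀ φ : PathCocycle UnitAddCircle, eval φ u₀ = φ circleLoop) ∧ ∀ u, ∃ a : ℂ, u = a • u₀ := by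
  have hl : circleLoop 0 = circleLoop 1 := (AddCircle.coe_period (1 : ℝ)).symm
  obtain ⟨u₀, h⟩ := exists_class circleLoop hl
  refine ⟨u₀, h, fun u => ?_⟩
  by_contra hu
  have hu' : u ∉ Submodule.span ℂ {u₀} := fun hm => by
    obtain ⟨a, ha⟩ := Submodule.mem_span_singleton.1 hm
    exact hu ⟨a, ha.symm⟩
  obtain ⟨L, hL, hL'⟩ := Submodule.exists_le_ker_of_notMem hu'
  obtain ⟨φ, rfl⟩ := exists_eval_eq L
  obtain ⟨Q, hQ⟩ := exists_isPrimitive_circle φ (by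
    rw [← h]
    exact hL' (Submodule.mem_span_singleton_self _))
  exact hL (by rw [eval_eq_zero hQ, LinearMap.zero_apply])

end PathCocycle

/-! ### Cocycles on the plumbed surface -/

namespace PlumbedSurface

variable {N : ℕ}

theorem exists_annulus_eq (x : PlumbedSurface N) : ∃ k a, annulus k a = x := by
  obtain ⟨⟨k, a⟩, rfl⟩ := Quotient.exists_rep x
  exact ⟨k, a, rfl⟩

theorem annulus_outSquare {i j : Fin N} (h : (i : ℕ) + 1 = j) (s t : I) :
    annulus i (outSquare s t) = annulus j (inSquare s t) :=
  annulus_eq_iff.2 (Or.inr (Or.inl ⟨h, s, t, rfl, rfl⟩))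

/-- The function on the surface that is given by compatible functions on the annuli. -/
def descFun {Z : Type} (f : Fin N → Annulus → Z) (h : ∀ i j : Fin N, (i : ℕ) + 1 = j → ∀ s t,
    f i (outSquare s t) = f j (inSquare s t)) : PlumbedSurface N → Z :=
  Quotient.lift (fun p => f p.1 p.2) (by
    have key : ∀ x y : Fin N × Annulus, Plumbed x y → f x.1 x.2 = f y.1 y.2 := by
      rintro ⟨i, a⟩ ⟨j, b⟩ ⟨hij, s, t, ha, hb⟩
      simp only at hij ha hb ⊢
      rw [ha, hb, h i j hij]
    rintro x y (rfl | hxy | hxy)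
    exacts [rfl, key _ _ hxy, (key _ _ hxy).symm])

theorem descFun_annulus {Z : Type} (f : Fin N → Annulus → Z)
    (h : ∀ i j : Fin N, (i : ℕ) + 1 = j → ∀ s t, f i (outSquare s t) = f j (inSquare s t))
    (k : Fin N) (a : Annulus) : descFun f h (annulus k a) = f k a := rfl

/-- The continuous map on the surface that is given by compatible continuous maps on the annuli. -/
def desc {Z : Type} [TopologicalSpace Z] (f : Fin N → C(Annulus, Z))
    (h : ∀ i j : Fin N, (i : ℕ) + 1 = j → ∀ s t, f i (outSquare s t) = f j (inSquare s t)) :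
    C(PlumbedSurface N, Z) :=
  ⟨descFun (fun k => f k) h, by
    have hq : Topology.IsQuotientMap (Quotient.mk (plumbingSetoid N)) := isQuotientMap_quotient_mk'
    exact hq.continuous_iff.2 (continuous_prod_of_discrete_left.2 fun k => (f k).continuous)⟩

theorem desc_annulus {Z : Type} [TopologicalSpace Z] (f : Fin N → C(Annulus, Z))
    (h : ∀ i j : Fin N, (i : ℕ) + 1 = j → ∀ s t, f i (outSquare s t) = f j (inSquare s t))
    (k : Fin N) (a : Annulus) : desc f h (annulus k a) = f k a := rfl

theorem isOpen_iff {C : Set (PlumbedSurface N)} : IsOpen C ↔ ∀ k, IsOpen (annulus k ⁻¹' C) := by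
  refine ⟨fun h k => h.preimage (annulus k).continuous, fun h => ?_⟩
  have hq : Topology.IsQuotientMap (Y := PlumbedSurface N) (Quotient.mk (plumbingSetoid N)) :=
    isQuotientMap_quotient_mk'
  have hc : Continuous fun x => x ∈ C :=
    hq.continuous_iff.2 (continuous_prod_of_discrete_left.2 fun k => continuous_Prop.2 (h k))
  exact continuous_Prop.1 hc

theorem isClosed_iff {C : Set (PlumbedSurface N)} :
    IsClosed C ↔ ∀ k, IsClosed (annulus k ⁻¹' C) := by
  rw [← isOpen_compl_iff, isOpen_iff]
  exact forall_congr' fun k => isOpen_compl_iff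

theorem annulus_mem_image {j k : Fin N} {a : Annulus} {C : Set Annulus} :
    annulus j a ∈ annulus k '' C ↔ (j = k ∧ a ∈ C) ∨
      ((k : ℕ) + 1 = j ∧ ∃ s t, outSquare s t ∈ C ∧ inSquare s t = a) ∨
      ((j : ℕ) + 1 = k ∧ ∃ s t, inSquare s t ∈ C ∧ outSquare s t = a) := by
  constructor
  · rintro ⟨b, hb, h⟩
    rcases annulus_eq_iff.1 h with h | ⟨h, s, t, h1, h2⟩ | ⟨h, s, t, h1, h2⟩
    · obtain ⟨rfl, rfl⟩ := Prod.ext_iff.1 h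
      exact Or.inl ⟨rfl, hb⟩
    · simp only at h h1 h2
      exact Or.inr (Or.inl ⟨h, s, t, h1 ▸ hb, h2.symm⟩)
    · simp only at h h1 h2
      exact Or.inr (Or.inr ⟨h, s, t, h2 ▸ hb, h1.symm⟩)
  · rintro (⟨rfl, h⟩ | ⟨h, s, t, h1, rfl⟩ | ⟨h, s, t, h1, rfl⟩)
    · exact ⟨a, h, rfl⟩
    · exact ⟨_, h1, annulus_outSquare h s t⟩
    · exact ⟨_, h1, (annulus_outSquare h s t).symm⟩

theorem isClosedMap_annulus (k : Fin N) : IsClosedMap (annulus k) := by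
  intro C hC
  refine isClosed_iff.2 fun j => ?_
  have h : annulus j ⁻¹' (annulus k '' C) = {a | j = k ∧ a ∈ C} ∪
      ({a | (k : ℕ) + 1 = j ∧ a ∈ (fun p : I × I => inSquare p.1 p.2) ''
        ((fun p : I × I => outSquare p.1 p.2) ⁻¹' C)} ∪
      {a | (j : ℕ) + 1 = k ∧ a ∈ (fun p : I × I => outSquare p.1 p.2) ''
        ((fun p : I × I => inSquare p.1 p.2) ⁻¹' C)}) := by
    ext a
    rw [Set.mem_preimage, annulus_mem_image]
    simp
  have h' : ∀ (p : Prop) {D : Set Annulus}, IsClosed D → IsClosed {a | p ∧ a ∈ D} :=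
    fun p D hD => isClosed_const.and hD
  rw [h]
  refine (h' _ hC).union ((h' _ ?_).union (h' _ ?_))
  · exact ((hC.preimage continuous_outSquare).isCompact.image continuous_inSquare).isClosed
  · exact ((hC.preimage continuous_inSquare).isCompact.image continuous_outSquare).isClosed

theorem isClosedEmbedding_annulus (k : Fin N) : Topology.IsClosedEmbedding (annulus k) :=
  .of_continuous_injective_isClosedMap (annulus k).continuous (annulus_injective k)
    (isClosedMap_annulus k)

/-- The annulus without its boundary is open in the surface. -/
theorem isOpen_image_annulus (k : Fin N) :
    IsOpen (annulus k '' {a : Annulus | (a.2 : ℝ) ∈ Set.Ioo 0 1}) := by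
  refine isOpen_iff.2 fun j => ?_
  have h : annulus j ⁻¹' (annulus k '' {a : Annulus | (a.2 : ℝ) ∈ Set.Ioo 0 1}) =
      {a | j = k ∧ a ∈ {a : Annulus | (a.2 : ℝ) ∈ Set.Ioo 0 1}} ∪
      ({a | (k : ℕ) + 1 = j ∧ a ∈ (Prod.fst : Annulus → _) ⁻¹'
        ((fun x : ℝ => (x : UnitAddCircle)) '' Set.Ioo 0 (1 / 4))} ∪
      {a | (j : ℕ) + 1 = k ∧ a ∈ (Prod.fst : Annulus → _) ⁻¹'
        ((fun x : ℝ => (x : UnitAddCircle)) '' Set.Ioo (1 / 2) (3 / 4))}) := by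
    ext a
    rw [Set.mem_preimage, annulus_mem_image]
    refine or_congr Iff.rfl (or_congr (and_congr_right fun _ => ?_) (and_congr_right fun _ => ?_))
    · constructor
      · rintro ⟨s, t, ⟨h1, h2⟩, rfl⟩
        simp only [outSquare] at h1 h2
        exact ⟨t / 4, ⟨by linarith, by linarith⟩, rfl⟩
      · rintro ⟨x, ⟨h1, h2⟩, h⟩
        refine ⟨σ a.2, ⟨4 * x, by linarith, by linarith⟩, ⟨?_, ?_⟩, Prod.ext ?_ (by simp [inSquare])⟩
        · simp only [outSquare]; linarith
        · simp only [outSquare]; linarith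
        · simpa [inSquare] using h
    · constructor
      · rintro ⟨s, t, ⟨h1, h2⟩, rfl⟩
        simp only [inSquare, unitInterval.coe_symm_eq] at h1 h2
        exact ⟨1 / 2 + s / 4, ⟨by linarith, by linarith⟩, rfl⟩
      · rintro ⟨x, ⟨h1, h2⟩, h⟩
        refine ⟨⟨4 * x - 2, by linarith, by linarith⟩, a.2, ⟨?_, ?_⟩, Prod.ext ?_ (by simp [outSquare])⟩
        · simp only [inSquare, unitInterval.coe_symm_eq]; linarith
        · simp only [inSquare, unitInterval.coe_symm_eq]; linarith
        · have e : 1 / 2 + (4 * x - 2) / 4 = x := by ring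
          simpa only [outSquare, e] using h
  have h' : ∀ (p : Prop) {D : Set Annulus}, IsOpen D → IsOpen {a | p ∧ a ∈ D} :=
    fun p D hD => isOpen_const.and hD
  have hmk : IsOpenMap fun x : ℝ => (x : UnitAddCircle) := QuotientAddGroup.isOpenMap_coe
  rw [h]
  refine (h' _ ?_).union ((h' _ ?_).union (h' _ ?_))
  · exact isOpen_Ioo.preimage (continuous_subtype_val.comp continuous_snd)
  · exact (hmk _ isOpen_Ioo).preimage continuous_fst
  · exact (hmk _ isOpen_Ioo).preimage continuous_fst

/-- The contraction of the unit interval towards the points of `[1/4, 3/4]`. -/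
noncomputable def shrinkInterval (τ s : I) : I :=
  ⟨s + τ * (1 / 4 - s / 2), by
    have h1 := s.2.1
    have h2 := s.2.2
    have h3 := τ.2.1
    have h4 := τ.2.2
    constructor <;> nlinarith⟩

theorem shrinkInterval_symm (τ s : I) : shrinkInterval τ (σ s) = σ (shrinkInterval τ s) := by
  refine Subtype.ext ?_
  simp only [shrinkInterval, unitInterval.coe_symm_eq]
  ring

/-- The displacement of the points of the circle under a contraction of the arcs `[0, 1/4]` and
`[1/2, 3/4]` towards their middle. -/
noncomputable def displacement (θ : UnitAddCircle) : ℝ := -(1 / 16) + |1 / 4 - ‖θ‖| / 2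

theorem displacement_in (t : I) : displacement ((t / 4 : ℝ) : UnitAddCircle) = 1 / 16 - t / 8 := by
  have h1 := t.2.1
  have h2 := t.2.2
  have h : ‖((t / 4 : ℝ) : UnitAddCircle)‖ = t / 4 := by
    have h3 : |(t / 4 : ℝ)| = t / 4 := abs_of_nonneg (by linarith)
    rw [(AddCircle.norm_coe_eq_abs_iff (1 : ℝ) one_ne_zero).2 (by rw [h3, abs_one]; linarith), h3]
  rw [displacement, h, abs_of_nonneg (by linarith)]
  ring

theorem displacement_out (s : I) :
    displacement ((1 / 2 + s / 4 : ℝ) : UnitAddCircle) = 1 / 16 - s / 8 := by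
  have h1 := s.2.1
  have h2 := s.2.2
  have h : ‖((1 / 2 + s / 4 : ℝ) : UnitAddCircle)‖ = 1 / 2 - s / 4 := by
    have h0 : ((1 / 2 + s / 4 : ℝ) : UnitAddCircle) = ((s / 4 - 1 / 2 : ℝ) : UnitAddCircle) := by
      rw [← AddCircle.coe_add_period 1 (s / 4 - 1 / 2 : ℝ)]
      congr 1
      ring
    have h3 : |(s / 4 - 1 / 2 : ℝ)| = 1 / 2 - s / 4 := by
      rw [abs_of_nonpos (by linarith)]; ring
    rw [h0, (AddCircle.norm_coe_eq_abs_iff (1 : ℝ) one_ne_zero).2 (by rw [h3, abs_one]; linarith), h3]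
  rw [displacement, h, abs_of_nonpos (by linarith)]
  ring

/-- A deformation of the annulus which pushes it off its boundary, and which on the two plumbing
squares is the same contraction towards the middle. -/
noncomputable def shrinkAnnulus (τ : I) (a : Annulus) : Annulus :=
  (a.1 + ((τ * displacement a.1 : ℝ) : UnitAddCircle), shrinkInterval τ a.2)

theorem continuous_shrinkAnnulus : Continuous fun p : Annulus × I => shrinkAnnulus p.2 p.1 := by
  have hc : Continuous fun x : ℝ => (x : UnitAddCircle) := AddCircle.continuous_mk' 1
  have hd : Continuous displacement := by unfold displacement; fun_prop
  have h1 : Continuous fun p : Annulus × I => ((p.2 * displacement p.1.1 : ℝ) : UnitAddCircle) :=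
    hc.comp (by fun_prop)
  have h2 : Continuous fun p : Annulus × I => shrinkInterval p.2 p.1.2 :=
    Continuous.subtype_mk (by fun_prop) _
  exact ((continuous_fst.fst).add h1).prodMk h2

theorem shrinkAnnulus_outSquare (τ s t : I) : shrinkAnnulus τ (outSquare s t) =
    outSquare (shrinkInterval τ s) (shrinkInterval τ t) := by
  refine Prod.ext ?_ rfl
  simp only [shrinkAnnulus, outSquare, displacement_out]
  rw [← AddCircle.coe_add]
  congr 1
  simp only [shrinkInterval]
  ring

theorem shrinkAnnulus_inSquare (τ s t : I) : shrinkAnnulus τ (inSquare s t) =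
    inSquare (shrinkInterval τ s) (shrinkInterval τ t) := by
  refine Prod.ext ?_ (shrinkInterval_symm τ s)
  simp only [shrinkAnnulus, inSquare, displacement_in]
  rw [← AddCircle.coe_add]
  congr 1
  simp only [shrinkInterval]
  ring

/-- The tracks of the deformation of the surface that is given by the deformations of the annuli. -/
noncomputable def shrink : C(PlumbedSurface N, C(I, PlumbedSurface N)) :=
  desc (fun k => ((annulus k).comp ⟨_, continuous_shrinkAnnulus⟩).curry) fun i j hij s t =>
    ContinuousMap.ext fun τ => by
      simp only [ContinuousMap.curry_apply, ContinuousMap.comp_apply, ContinuousMap.coe_mk,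
        shrinkAnnulus_outSquare, shrinkAnnulus_inSquare, annulus_outSquare hij]

theorem shrink_annulus (k : Fin N) (a : Annulus) (τ : I) :
    shrink (annulus k a) τ = annulus k (shrinkAnnulus τ a) := rfl

theorem shrink_zero (x : PlumbedSurface N) : shrink x 0 = x := by
  obtain ⟨k, a, rfl⟩ := exists_annulus_eq x
  rw [shrink_annulus]
  congr 1
  refine Prod.ext ?_ (Subtype.ext ?_)
  · simp [shrinkAnnulus]
  · simp [shrinkAnnulus, shrinkInterval]

theorem exists_shrink_one_mem (x : PlumbedSurface N) :
    ∃ k, shrink x 1 ∈ annulus k '' {a : Annulus | (a.2 : ℝ) ∈ Set.Ioo 0 1} := by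
  obtain ⟨k, a, rfl⟩ := exists_annulus_eq x
  refine ⟨k, _, ?_, rfl⟩
  have h1 := a.2.2.1
  have h2 := a.2.2.2
  constructor <;> simp [shrinkAnnulus, shrinkInterval] <;> linarith

open PathCocycle

/-- Primitives on the annuli, adjusted by constants to agree on the plumbing squares. -/
theorem exists_primitive_annuli (φ : PathCocycle (PlumbedSurface N))
    (h : ∀ k, ∃ P, (φ.comap (annulus k)).IsPrimitive P) :
    ∃ P : PlumbedSurface N → ℂ, ∀ k, (φ.comap (annulus k)).IsPrimitive fun a => P (annulus k a) := by
  choose P hP using h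
  let d : ℕ → ℂ := fun m => if h : m + 1 < N then
    P ⟨m, by omega⟩ (outSquare 0 0) - P ⟨m + 1, h⟩ (inSquare 0 0) else 0
  let c : ℕ → ℂ := fun m => ∑ r ∈ Finset.range m, d r
  refine ⟨descFun (fun k a => P k a + c k) ?_, fun k γ => ?_⟩
  · intro i j hij s t
    obtain ⟨i, hi⟩ := i
    obtain ⟨j, hj⟩ := j
    simp only at hij
    subst hij
    have hd : d i = P ⟨i, hi⟩ (outSquare 0 0) - P ⟨i + 1, hj⟩ (inSquare 0 0) := dif_pos hj
    have hc : c (i + 1) = c i + d i := Finset.sum_range_succ _ _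
    -- the primitives on the two annuli change equally along the segment from `(0, 0)` to `(s, t)`
    let ℓ : C(I, I × I) := ⟨fun r => (r * s, r * t), by fun_prop⟩
    have h1 := hP ⟨i, hi⟩ ((⟨_, continuous_outSquare⟩ : C(I × I, Annulus)).comp ℓ)
    have h2 := hP ⟨i + 1, hj⟩ ((⟨_, continuous_inSquare⟩ : C(I × I, Annulus)).comp ℓ)
    have e : (annulus ⟨i, hi⟩).comp ((⟨_, continuous_outSquare⟩ : C(I × I, Annulus)).comp ℓ) =
        (annulus ⟨i + 1, hj⟩).comp ((⟨_, continuous_inSquare⟩ : C(I × I, Annulus)).comp ℓ) :=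
      ContinuousMap.ext fun r => annulus_outSquare rfl _ _
    rw [comap_apply] at h1 h2
    rw [e] at h1
    have h3 := h1.symm.trans h2
    have l0 : ℓ 0 = (0, 0) := by simp [ℓ]
    have l1 : ℓ 1 = (s, t) := by simp [ℓ]
    simp only [ContinuousMap.comp_apply, ContinuousMap.coe_mk, l0, l1] at h3
    simp only [hc, hd]
    linear_combination h3
  · simp only [descFun_annulus]
    rw [hP k γ]
    ring

/-- A cocycle on the surface which vanishes on the cores of the annuli has a primitive. -/
theorem exists_isPrimitive (φ : PathCocycle (PlumbedSurface N))
    (h : ∀ k, (φ.comap (core k)) circleLoop = 0) : ∃ Q, φ.IsPrimitive Q := by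
  obtain ⟨P, hP⟩ := exists_primitive_annuli φ fun k =>
    exists_isPrimitive_annulus (φ.comap (annulus k)) ⟨1 / 2, by norm_num, by norm_num⟩ (h k)
  have hs : Continuous fun x : PlumbedSurface N => shrink x 1 := by fun_prop
  refine ⟨fun x => P (shrink x 1) - φ (shrink x), φ.isPrimitive_of_local _ fun x => ?_⟩
  obtain ⟨k, hk⟩ := exists_shrink_one_mem x
  refine ⟨(fun x => shrink x 1) ⁻¹' _, (isOpen_image_annulus k).preimage hs, hk, fun γ hγ => ?_⟩
  choose δ _ hδ using hγ
  have hδc : Continuous δ := by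
    rw [(isClosedEmbedding_annulus k).isInducing.continuous_iff]
    exact (hs.comp γ.continuous).congr fun t => (hδ t).symm
  have h1 := hP k ⟨δ, hδc⟩
  have h2 := φ.square ⟨fun p => shrink (γ p.1) p.2, by fun_prop⟩
  have e1 : (annulus k).comp ⟨δ, hδc⟩ = ⟨fun t => shrink (γ t) 1, by fun_prop⟩ :=
    ContinuousMap.ext hδ
  have e2 : (⟨fun t => shrink (γ t) 0, by fun_prop⟩ : C(I, PlumbedSurface N)) = γ :=
    ContinuousMap.ext fun t => shrink_zero _
  have e3 : ∀ t, (⟨fun r => shrink (γ t) r, by fun_prop⟩ : C(I, PlumbedSurface N)) = shrink (γ t) :=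
    fun t => rfl
  rw [comap_apply, e1] at h1
  simp only [ContinuousMap.coe_mk, e2, e3, hδ] at h1 h2
  rw [h1] at h2
  linear_combination h2

end PlumbedSurface

/-! ### Dual classes and the action of the Dehn twists -/

namespace PlumbedSurface

open PathCocycle

/-- The retraction of the line onto the unit interval. -/
def clamp (x : ℝ) : ℝ := max 0 (min 1 x)

theorem clamp_of_nonpos {x : ℝ} (h : x ≤ 0) : clamp x = 0 := by
  rw [clamp, max_eq_left ((min_le_right _ _).trans h)]

theorem clamp_of_one_le {x : ℝ} (h : 1 ≤ x) : clamp x = 1 := by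
  rw [clamp, min_eq_left h, max_eq_right zero_le_one]

theorem clamp_of_mem {x : ℝ} (h0 : 0 ≤ x) (h1 : x ≤ 1) : clamp x = x := by
  rw [clamp, min_eq_right h1, max_eq_right h0]

theorem continuous_clamp : Continuous clamp := by unfold clamp; fun_prop

theorem coe_one_circle : ((1 : ℝ) : UnitAddCircle) = 0 := AddCircle.coe_period 1

/-- A map of degree one of the circle to itself that is constant outside of the arc from `1/4` to
`1/2`. -/
noncomputable def bump : C(UnitAddCircle, UnitAddCircle) :=
  ⟨AddCircle.liftIco 1 0 fun x => ((clamp (4 * x - 1) : ℝ) : UnitAddCircle),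
    AddCircle.liftIco_continuous (by
      rw [clamp_of_nonpos (by norm_num), clamp_of_one_le (by norm_num), coe_one_circle,
        AddCircle.coe_zero])
      ((circleMk.continuous.comp (continuous_clamp.comp (by fun_prop))).continuousOn)⟩

theorem bump_coe {x : ℝ} (h0 : 0 ≤ x) (h1 : x < 1) :
    bump (x : UnitAddCircle) = ((clamp (4 * x - 1) : ℝ) : UnitAddCircle) :=
  AddCircle.liftIco_coe_apply (p := (1 : ℝ)) (a := 0)
    (f := fun x : ℝ => ((clamp (4 * x - 1) : ℝ) : UnitAddCircle)) ⟨h0, by rwa [zero_add]⟩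

/-- A lift of `bump` to the line, on `[0, 2]`. -/
def bumpLift (x : ℝ) : ℝ := clamp (4 * x - 1) + clamp (4 * x - 5)

theorem continuous_bumpLift : Continuous bumpLift := by
  have := continuous_clamp
  unfold bumpLift
  fun_prop

theorem bump_eq {x : ℝ} (h0 : 0 ≤ x) (h1 : x < 2) :
    bump (x : UnitAddCircle) = ((bumpLift x : ℝ) : UnitAddCircle) := by
  rcases lt_or_ge x 1 with h | h
  · rw [bump_coe h0 h, bumpLift, clamp_of_nonpos (x := 4 * x - 5) (by linarith), add_zero]
  · have e : (x : UnitAddCircle) = ((x - 1 : ℝ) : UnitAddCircle) := by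
      rw [AddCircle.coe_sub, coe_one_circle, sub_zero]
    rw [e, bump_coe (by linarith) (by linarith), bumpLift,
      clamp_of_one_le (x := 4 * x - 1) (by linarith), AddCircle.coe_add, coe_one_circle, zero_add]
    congr 2
    ring

theorem angular_circleLoop (h : C(UnitAddCircle, UnitAddCircle)) {L : ℝ → ℝ} (hL : Continuous L)
    (n : ℤ) (h1 : L 1 = L 0 + n) (h2 : ∀ x : ℝ, 0 ≤ x → x < 1 → h (x : UnitAddCircle) = (L x : ℝ)) :
    angular.comap h circleLoop = n := by
  have h3 : ∀ t : I, (h.comp circleLoop) t = ((L t : ℝ) : UnitAddCircle) := by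
    intro t
    change h ((t : ℝ) : UnitAddCircle) = _
    rcases t.2.2.lt_or_eq with ht | ht
    · exact h2 t t.2.1 ht
    · have e : ((n : ℝ) : UnitAddCircle) = 0 := by
        rw [AddCircle.coe_eq_zero_iff]
        exact ⟨n, by simp⟩
      rw [ht, h1, AddCircle.coe_add, e, add_zero, ← h2 0 le_rfl one_pos, coe_one_circle,
        AddCircle.coe_zero]
  rw [comap_apply, angular_eq (hL.comp continuous_subtype_val) h3]
  simp [h1]

variable {N : ℕ}

/-- The map of the surface to the circle which winds around once along the `k`-th annulus, and which
is constant on the other annuli. -/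
noncomputable def winding (k : Fin N) : C(PlumbedSurface N, UnitAddCircle) :=
  desc (fun j => if j = k then bump.comp ContinuousMap.fst else .const _ 0) fun i j hij s t => by
    have hs1 := s.2.1
    have hs2 := s.2.2
    have ht1 := t.2.1
    have ht2 := t.2.2
    have h1 : bump (outSquare s t).1 = 0 := by
      rw [outSquare, bump_coe (by linarith) (by linarith), clamp_of_one_le (by linarith),
        coe_one_circle]
    have h2 : bump (inSquare s t).1 = 0 := by
      rw [inSquare, bump_coe (by linarith) (by linarith), clamp_of_nonpos (by linarith),
        AddCircle.coe_zero]
    split_ifs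
    · exact h1.trans h2.symm
    · exact h1
    · exact h2.symm
    · rfl

theorem winding_annulus_self (k : Fin N) (a : Annulus) : winding k (annulus k a) = bump a.1 := by
  rw [winding, desc_annulus, if_pos rfl]
  rfl

theorem winding_annulus_of_ne {j k : Fin N} (h : j ≠ k) (a : Annulus) :
    winding k (annulus j a) = 0 := by
  rw [winding, desc_annulus, if_neg h]
  rfl

theorem core_apply (k : Fin N) (θ : UnitAddCircle) :
    core k θ = annulus k (θ, ⟨1 / 2, by norm_num, by norm_num⟩) := rfl

/-- The winding numbers of the core curves. -/
theorem winding_core (k j : Fin N) :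
    angular.comap ((winding k).comp (core j)) circleLoop = if j = k then 1 else 0 := by
  split_ifs with h
  · subst h
    rw [angular_circleLoop _ (L := fun x => clamp (4 * x - 1))
      (continuous_clamp.comp (by fun_prop)) 1]
    · simp
    · rw [clamp_of_one_le (by norm_num), clamp_of_nonpos (by norm_num)]
      simp
    · intro x h0 h1
      rw [ContinuousMap.comp_apply, core_apply, winding_annulus_self, bump_coe h0 h1]
  · rw [angular_circleLoop _ (L := fun _ => 0) continuous_const 0]
    · simp
    · simp
    · intro x h0 h1
      rw [ContinuousMap.comp_apply, core_apply, winding_annulus_of_ne h, AddCircle.coe_zero]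

theorem dehnTwist_annulus (i : Fin N) (a : Annulus) :
    dehnTwist i (annulus i a) = annulus i (annulusTwist a) := twistFun_annulus i a

theorem dehnTwist_core_self (i : Fin N) (x : ℝ) :
    dehnTwist i (core i (x : UnitAddCircle)) = core i ((x + 1 / 2 : ℝ) : UnitAddCircle) := by
  rw [core_apply, dehnTwist_annulus]
  rfl

theorem dehnTwist_of_forall_ne {i j : Fin N} (h : j ≠ i) {a : Annulus}
    (h1 : (i : ℕ) + 1 = j → ∀ s t, inSquare s t ≠ a)
    (h2 : (j : ℕ) + 1 = i → ∀ s t, outSquare s t ≠ a) :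
    dehnTwist i (annulus j a) = annulus j a := by
  refine twistFun_of_notMem i fun b hb => ?_
  have h3 : annulus j a ∈ annulus i '' Set.univ := ⟨b, trivial, hb⟩
  rcases annulus_mem_image.1 h3 with ⟨e, -⟩ | ⟨e, s, t, -, e'⟩ | ⟨e, s, t, -, e'⟩
  exacts [h e, h1 e s t e', h2 e s t e']

/-- The twist about the preceding curve, on the arc of the core that it moves. -/
theorem dehnTwist_core_succ_of_le {i j : Fin N} (hij : (i : ℕ) + 1 = j) {x : ℝ} (h0 : 0 ≤ x)
    (h1 : x ≤ 1 / 4) : ∃ t, dehnTwist i (core j (x : UnitAddCircle)) =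
      annulus i (((5 / 8 + 4 * x : ℝ) : UnitAddCircle), t) := by
  let s : I := ⟨1 / 2, by norm_num, by norm_num⟩
  let t : I := ⟨4 * x, by linarith, by linarith⟩
  have e : core j (x : UnitAddCircle) = annulus j (inSquare s t) := by
    rw [core_apply]
    congr 1
    refine Prod.ext ?_ (Subtype.ext ?_)
    · simp [inSquare, t]
    · simp only [inSquare, unitInterval.coe_symm_eq, s]; norm_num
  refine ⟨t, ?_⟩
  rw [e, ← annulus_outSquare hij, dehnTwist_annulus]
  congr 1
  refine Prod.ext ?_ rfl
  simp only [annulusTwist, outSquare]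
  rw [← AddCircle.coe_add]
  congr 1
  simp only [s, t]
  ring

theorem dehnTwist_core_succ_of_lt {i j : Fin N} (hij : (i : ℕ) + 1 = j) {x : ℝ} (h0 : 1 / 4 < x)
    (h1 : x < 1) : dehnTwist i (core j (x : UnitAddCircle)) = core j (x : UnitAddCircle) := by
  rw [core_apply]
  refine dehnTwist_of_forall_ne (fun h => by rw [h] at hij; omega) (fun _ s t h => ?_)
    (fun h => by omega)
  have h2 := coe_inj (in_mem t) ⟨by linarith, h1⟩ (congrArg Prod.fst h)
  have := t.2.2
  linarith

theorem dehnTwist_core_pred_of_mem {i j : Fin N} (hij : (j : ℕ) + 1 = i) {x : ℝ} (h0 : 1 / 2 ≤ x)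
    (h1 : x ≤ 3 / 4) : ∃ t, dehnTwist i (core j (x : UnitAddCircle)) =
      annulus i (((9 / 8 - (4 * x - 2) : ℝ) : UnitAddCircle), t) := by
  let s : I := ⟨4 * x - 2, by linarith, by linarith⟩
  let t : I := ⟨1 / 2, by norm_num, by norm_num⟩
  have e : core j (x : UnitAddCircle) = annulus j (outSquare s t) := by
    rw [core_apply]
    congr 1
    refine Prod.ext ?_ rfl
    simp only [outSquare, s]
    congr 1
    ring
  refine ⟨σ s, ?_⟩
  rw [e, annulus_outSquare hij, dehnTwist_annulus]
  congr 1
  refine Prod.ext ?_ rfl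
  simp only [annulusTwist, inSquare]
  rw [← AddCircle.coe_add]
  congr 1
  simp only [s, t, unitInterval.coe_symm_eq]
  ring

theorem dehnTwist_core_pred_of_notMem {i j : Fin N} (hij : (j : ℕ) + 1 = i) {x : ℝ} (h0 : 0 ≤ x)
    (h1 : x < 1) (h2 : x < 1 / 2 ∨ 3 / 4 < x) :
    dehnTwist i (core j (x : UnitAddCircle)) = core j (x : UnitAddCircle) := by
  rw [core_apply]
  refine dehnTwist_of_forall_ne (fun h => by rw [h] at hij; omega) (fun h => by omega)
    (fun _ s t h => ?_)
  have h2 := coe_inj (out_mem s) ⟨h0, h1⟩ (congrArg Prod.fst h)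
  have h3 := s.2.1
  have h4 := s.2.2
  rcases ‹_ ∨ _› with h | h <;> linarith

/-- The winding numbers of the images of the core curves under the twists. -/
theorem winding_dehnTwist_core (k i j : Fin N) :
    angular.comap ((winding k).comp ((dehnTwist i).comp (core j))) circleLoop =
      (if j = k then 1 else 0) + ((if j.val = i + 1 then 1 else 0) - if i.val = j + 1 then 1 else 0) *
        if i = k then 1 else 0 := by
  have hself : ∀ x : ℝ, 0 ≤ x → x < 1 → winding j (core j (x : UnitAddCircle)) =
      ((clamp (4 * x - 1) : ℝ) : UnitAddCircle) := fun x h0 h1 => by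
    rw [core_apply, winding_annulus_self, bump_coe h0 h1]
  have hne : ∀ m, m ≠ k → ∀ θ, winding k (core m θ) = 0 := fun m hm θ =>
    winding_annulus_of_ne hm _
  have hc : Continuous fun x : ℝ => clamp (4 * x - 1) := continuous_clamp.comp (by fun_prop)
  have hc0 : clamp (4 * 0 - 1) = 0 := clamp_of_nonpos (by norm_num)
  have hc1 : clamp (4 * 1 - 1) = 1 := clamp_of_one_le (by norm_num)
  rcases eq_or_ne j i with rfl | hji
  · -- the twist rotates the core by a half turn
    rw [if_neg (c := j.val = j + 1) (by omega), sub_self, zero_mul, add_zero]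
    split_ifs with h
    · subst h
      rw [angular_circleLoop _ (L := fun x => bumpLift (x + 1 / 2))
        (continuous_bumpLift.comp (by fun_prop)) 1]
      · simp
      · simp only [bumpLift]
        rw [clamp_of_one_le (by norm_num), clamp_of_one_le (by norm_num), clamp_of_one_le (by norm_num),
          clamp_of_nonpos (by norm_num)]
        norm_num
      · intro x h0 h1
        rw [ContinuousMap.comp_apply, ContinuousMap.comp_apply, dehnTwist_core_self, core_apply,
          winding_annulus_self, bump_eq (by linarith) (by linarith)]
    · rw [angular_circleLoop _ (L := fun _ => 0) continuous_const 0]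
      · simp
      · simp
      · intro x h0 h1
        rw [ContinuousMap.comp_apply, ContinuousMap.comp_apply, dehnTwist_core_self, hne _ h,
          AddCircle.coe_zero]
  by_cases h1 : (i : ℕ) + 1 = j
  · rw [if_pos h1.symm, if_neg (c := i.val = j + 1) (by omega), sub_zero, one_mul]
    by_cases hik : i = k
    · subst hik
      rw [if_neg hji, if_pos rfl, angular_circleLoop _ (L := fun x => bumpLift (5 / 8 + clamp (4 * x)))
        (continuous_bumpLift.comp (continuous_const.add (continuous_clamp.comp (by fun_prop)))) 1]
      · simp
      · rw [clamp_of_one_le (x := 4 * 1) (by norm_num), clamp_of_nonpos (x := 4 * 0) (by norm_num)]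
        simp only [bumpLift]
        rw [clamp_of_one_le (by norm_num), clamp_of_one_le (by norm_num), clamp_of_one_le (by norm_num),
          clamp_of_nonpos (by norm_num)]
        norm_num
      · intro x hx0 hx1
        rw [ContinuousMap.comp_apply, ContinuousMap.comp_apply]
        rcases le_or_gt x (1 / 4) with hx | hx
        · obtain ⟨t, ht⟩ := dehnTwist_core_succ_of_le h1 hx0 hx
          rw [ht, winding_annulus_self, bump_eq (by linarith) (by linarith),
            clamp_of_mem (by linarith) (by linarith)]
        · rw [dehnTwist_core_succ_of_lt h1 hx hx1, hne _ hji, clamp_of_one_le (by linarith), bumpLift,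
            clamp_of_one_le (by norm_num), clamp_of_one_le (by norm_num), AddCircle.coe_add,
            coe_one_circle, add_zero]
    · rw [if_neg hik, add_zero]
      split_ifs with hjk
      · subst hjk
        rw [angular_circleLoop _ hc 1]
        · simp
        · rw [hc1, hc0]
          norm_num
        · intro x hx0 hx1
          rw [ContinuousMap.comp_apply, ContinuousMap.comp_apply]
          rcases le_or_gt x (1 / 4) with hx | hx
          · obtain ⟨t, ht⟩ := dehnTwist_core_succ_of_le h1 hx0 hx
            rw [ht, winding_annulus_of_ne hik, clamp_of_nonpos (by linarith), AddCircle.coe_zero]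
          · rw [dehnTwist_core_succ_of_lt h1 hx hx1, hself x hx0 hx1]
      · rw [angular_circleLoop _ (L := fun _ => 0) continuous_const 0]
        · simp
        · simp
        · intro x hx0 hx1
          rw [ContinuousMap.comp_apply, ContinuousMap.comp_apply, AddCircle.coe_zero]
          rcases le_or_gt x (1 / 4) with hx | hx
          · obtain ⟨t, ht⟩ := dehnTwist_core_succ_of_le h1 hx0 hx
            rw [ht, winding_annulus_of_ne hik]
          · rw [dehnTwist_core_succ_of_lt h1 hx hx1, hne _ hjk]
  by_cases h2 : (j : ℕ) + 1 = i
  · rw [if_neg (c := j.val = i + 1) (by omega), if_pos h2.symm, zero_sub]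
    have hcases : ∀ x : ℝ, (1 / 2 ≤ x ∧ x ≤ 3 / 4) ∨ (x < 1 / 2 ∨ 3 / 4 < x) := fun x => by
      rcases lt_or_ge x (1 / 2) with hx | hx
      · exact Or.inr (Or.inl hx)
      rcases le_or_gt x (3 / 4) with hx' | hx'
      · exact Or.inl ⟨hx, hx'⟩
      · exact Or.inr (Or.inr hx')
    by_cases hik : i = k
    · subst hik
      rw [if_neg hji, if_pos rfl,
        angular_circleLoop _ (L := fun x => bumpLift (9 / 8 - clamp (4 * x - 2)))
        (continuous_bumpLift.comp (continuous_const.sub (continuous_clamp.comp (by fun_prop)))) (-1)]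
      · simp
      · rw [clamp_of_one_le (x := 4 * 1 - 2) (by norm_num),
          clamp_of_nonpos (x := 4 * 0 - 2) (by norm_num)]
        simp only [bumpLift]
        rw [clamp_of_nonpos (by norm_num), clamp_of_nonpos (by norm_num), clamp_of_one_le (by norm_num),
          clamp_of_nonpos (by norm_num)]
        norm_num
      · intro x hx0 hx1
        rw [ContinuousMap.comp_apply, ContinuousMap.comp_apply]
        rcases hcases x with ⟨hx, hx'⟩ | hx
        · obtain ⟨t, ht⟩ := dehnTwist_core_pred_of_mem h2 hx hx'
          rw [ht, winding_annulus_self, bump_eq (by linarith) (by linarith),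
            clamp_of_mem (by linarith) (by linarith)]
        · rw [dehnTwist_core_pred_of_notMem h2 hx0 hx1 hx, hne _ hji]
          rcases hx with hx | hx
          · rw [clamp_of_nonpos (by linarith), bumpLift, clamp_of_one_le (by norm_num),
              clamp_of_nonpos (by norm_num), add_zero, coe_one_circle]
          · rw [clamp_of_one_le (by linarith), bumpLift, clamp_of_nonpos (by norm_num),
              clamp_of_nonpos (by norm_num), add_zero, AddCircle.coe_zero]
    · rw [if_neg hik, mul_zero, add_zero]
      split_ifs with hjk
      · subst hjk
        rw [angular_circleLoop _ hc 1]
        · simp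
        · rw [hc1, hc0]
          norm_num
        · intro x hx0 hx1
          rw [ContinuousMap.comp_apply, ContinuousMap.comp_apply]
          rcases hcases x with ⟨hx, hx'⟩ | hx
          · obtain ⟨t, ht⟩ := dehnTwist_core_pred_of_mem h2 hx hx'
            rw [ht, winding_annulus_of_ne hik, clamp_of_one_le (by linarith), coe_one_circle]
          · rw [dehnTwist_core_pred_of_notMem h2 hx0 hx1 hx, hself x hx0 hx1]
      · rw [angular_circleLoop _ (L := fun _ => 0) continuous_const 0]
        · simp
        · simp
        · intro x hx0 hx1
          rw [ContinuousMap.comp_apply, ContinuousMap.comp_apply, AddCircle.coe_zero]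
          rcases hcases x with ⟨hx, hx'⟩ | hx
          · obtain ⟨t, ht⟩ := dehnTwist_core_pred_of_mem h2 hx hx'
            rw [ht, winding_annulus_of_ne hik]
          · rw [dehnTwist_core_pred_of_notMem h2 hx0 hx1 hx, hne _ hjk]
  · -- the twist fixes the core
    have e : (dehnTwist i).comp (core j) = core j := ContinuousMap.ext fun θ =>
      dehnTwist_of_forall_ne hji (fun h => absurd h h1) (fun h => absurd h h2)
    rw [e, winding_core, if_neg (c := j.val = i + 1) (by omega),
      if_neg (c := i.val = j + 1) (by omega), sub_zero, zero_mul, add_zero]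

end PlumbedSurface

open PlumbedSurface PathCocycle in
/-- The cores of the annuli are a basis of the homology of the surface, on which the Dehn twists act
by transvections. -/
theorem exists_chainBasis (g : ℕ) : ∃ (u₀ : H1 UnitAddCircle)
    (c : Module.Basis (Fin (2 * g)) ℂ (SurfaceH1 g)), (∀ u, ∃ a : ℂ, u = a • u₀) ∧
    (∀ i, c i = coreClass g u₀ i) ∧ ∀ i j : Fin (2 * g), H1.map (PlumbedSurface.dehnTwist i) (c j) =
      c j + ((if j.val = i + 1 then (1 : ℂ) else 0) - if i.val = j + 1 then 1 else 0) • c i := by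
  obtain ⟨u₀, hu, hspan⟩ := exists_circleClass
  let D : Fin (2 * g) → SurfaceH1 g →ₗ[ℂ] ℂ := fun k => eval (angular.comap (winding k))
  have hD : ∀ k j, D k (coreClass g u₀ j) = if j = k then 1 else 0 := fun k j => by
    rw [← winding_core k j, coreClass]
    simp only [D]
    rw [eval_map, hu]
    rfl
  have hDt : ∀ k i j, D k (H1.map (dehnTwist i) (coreClass g u₀ j)) =
      (if j = k then 1 else 0) + ((if j.val = i + 1 then 1 else 0) - if i.val = j + 1 then 1 else 0) *
        if i = k then 1 else 0 := fun k i j => by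
    rw [← winding_dehnTwist_core k i j, coreClass]
    simp only [D]
    rw [eval_map, eval_map, hu]
    rfl
  have hli : LinearIndependent ℂ (coreClass g u₀) := by
    rw [Fintype.linearIndependent_iff]
    intro a ha k
    have := congrArg (D k) ha
    simpa [hD] using this
  have htop : ⊤ ≤ Submodule.span ℂ (Set.range (coreClass g u₀)) := by
    by_contra hne
    obtain ⟨L, hL, hL'⟩ := Submodule.exists_le_ker_of_lt_top _ (lt_top_iff_ne_top.2 fun h => hne h.ge)
    obtain ⟨φ, rfl⟩ := exists_eval_eq L
    obtain ⟨Q, hQ⟩ := PlumbedSurface.exists_isPrimitive φ fun k => by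
      rw [← hu, ← eval_map]
      exact hL' (Submodule.subset_span ⟨k, rfl⟩)
    exact hL (eval_eq_zero hQ)
  let c := Module.Basis.mk hli htop
  have hc : ∀ i, c i = coreClass g u₀ i := fun i => Module.Basis.mk_apply hli htop i
  have hrepr : ∀ x k, c.repr x k = D k x := fun x k => by
    have h : c.coord k = D k := c.ext fun j => by
      rw [Module.Basis.coord_apply, Module.Basis.repr_self, hc, hD, Finsupp.single_apply]
    exact LinearMap.congr_fun h x
  refine ⟨u₀, c, hspan, hc, fun i j => c.ext_elem fun k => ?_⟩
  rw [hrepr, hrepr, hc, hc, hDt, map_add, map_smul, hD, hD, smul_eq_mul]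

/-! ### The homological representation -/

section

open ChainBasis ExteriorAlgebra

variable {g : ℕ} {u₀ : H1 UnitAddCircle} {c : Module.Basis (Fin (2 * g)) ℂ (SurfaceH1 g)}

theorem omega_smul (hc : ∀ i, c i = coreClass g u₀ i) (a : ℂ) :
    omega g (a • u₀) = a ^ 2 • (frame c).bivector := by
  have h1 : ∀ i, coreClass g (a • u₀) i = a • c i := fun i => by
    rw [hc, coreClass, map_smul, coreClass]
  have h2 : ∀ k : Fin g, ∑ j ∈ Finset.univ.filter (fun j : Fin g => j ≤ k),
      coreClass g (a • u₀) ⟨2 * j, by omega⟩ = a • (frame c).a k := by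
    intro k
    rw [show (frame c).a k = ∑ j ∈ Finset.range (k + 1), vec c (2 * j) from rfl, Finset.smul_sum]
    refine Finset.sum_nbij' (fun j => j.val) (fun j => if h : j < g then ⟨j, h⟩ else k) ?_ ?_ ?_ ?_ ?_
    · intro j hj
      rw [Finset.mem_filter, Fin.le_def] at hj
      exact Finset.mem_range.2 (by omega)
    · intro j hj
      rw [Finset.mem_range] at hj
      rw [dif_pos (by omega)]
      exact Finset.mem_filter.2 ⟨Finset.mem_univ _, Fin.le_def.2 (by simp only; omega)⟩
    · intro j _
      rw [dif_pos j.2]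
    · intro j hj
      rw [Finset.mem_range] at hj
      rw [dif_pos (by omega)]
    · intro j _
      rw [h1, vec_of_lt c (by omega)]
  rw [omega, SymplecticFrame.bivector, Finset.smul_sum]
  refine Finset.sum_congr rfl fun k _ => ?_
  rw [h2, h1, map_smul, map_smul, smul_mul_smul_comm, ← sq]
  congr 3
  exact (vec_of_lt c (by omega)).symm

theorem omegaWedge_eq (hu : ∀ u, ∃ a : ℂ, u = a • u₀) (hc : ∀ i, c i = coreClass g u₀ i) (l : ℕ) :
    omegaWedge g l = (frame c).wedgeImage l := by
  refine le_antisymm (Submodule.span_mono ?_) (Submodule.span_mono ?_)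
  · rintro y ⟨u, k, hk, x, hx, e⟩
    obtain ⟨a, rfl⟩ := hu u
    refine ⟨k, hk, a ^ 2 • x, Submodule.smul_mem _ _ hx, ?_⟩
    rw [e, omega_smul hc, smul_mul_assoc, mul_smul_comm]
  · rintro y ⟨k, hk, x, hx, e⟩
    refine ⟨u₀, k, hk, x, hx, ?_⟩
    have := omega_smul hc 1
    rw [one_smul, one_pow, one_smul] at this
    rw [e, this]

end

theorem exists_homologicalRepresentation {n d l : ℕ} (hn : 2 * n + 1 = 2 * l + d) :
    ∃ ρ : Representation ℂ (BraidGroup (2 * n + 1)) (HomologicalModule n l),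
      (∀ (i : Fin (2 * n)) (x : ⋀[ℂ]^l (SurfaceH1 n)),
        ρ (BraidGroup.gen i) ((omegaWedge n l).mkQ x) =
          (omegaWedge n l).mkQ (twistExteriorPower n l i x)) ∧
      ∀ A : ℂˣ, (A : ℂ) ^ 4 = -1 →
        Nonempty ((LinkDiagram.jonesRep (2 * n + 1) d A).Equiv ρ) := by
  obtain ⟨u₀, c, hu, hc, hT⟩ := exists_chainBasis n
  have ht : ∀ (i : Fin (2 * n)) x, H1.map (PlumbedSurface.dehnTwist i) x =
      x + (ChainBasis.frame c).pairing (c i) x • c i := by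
    intro i x
    have : H1.map (PlumbedSurface.dehnTwist i) = LinearMap.id +
        ((ChainBasis.frame c).pairing (c i)).smulRight (c i) := by
      refine c.ext fun j => ?_
      rw [hT, LinearMap.add_apply, LinearMap.id_apply, LinearMap.smulRight_apply,
        ← ChainBasis.vec_fin c i, ← ChainBasis.vec_fin c j, ChainBasis.pairing_vec c i.2 j.2]
    rw [this]
    rfl
  have hP : ∃ A : ℂˣ, (A : ℂ) ^ 4 = -1 := by
    obtain ⟨a, ha⟩ := IsAlgClosed.exists_pow_nat_eq (-1 : ℂ) (n := 4) (by norm_num)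
    have ha0 : a ≠ 0 := by rintro rfl; norm_num at ha
    exact ⟨Units.mk0 a ha0, ha⟩
  unfold HomologicalModule
  rw [omegaWedge_eq hu hc]
  obtain ⟨ρ, h1, h2⟩ := LinkDiagram.exists_representation (n := 2 * n + 1) (d := d)
    (P := fun A : ℂˣ => (A : ℂ) ^ 4 = -1)
    (fun i : Fin (2 * n) => ((ChainBasis.frame c).wedgeImage l).mapQ _
      (exteriorPower.map l (H1.map (PlumbedSurface.dehnTwist i)))
        ((ChainBasis.frame c).wedgeImage_le_comap (ht i) l)) hP
    (fun A hA => ChainBasis.exists_linearEquiv c hn hA _ ht)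
  exact ⟨ρ, fun i x => by rw [h1]; rfl, h2⟩

theorem theorem1p2 (n d l : ℕ) (hn : 1 ≤ n) (hl : 2 * l + d = 2 * n + 1) :
    -- the Jones representations over the Laurent polynomials and for each complex parameter `A ≠ 0`,
    -- and the homological representation
    ∃ (J₀ : Representation ℤ[T;T⁻¹] (BraidGroup (2 * n + 1))
          (LinkDiagram.Span ℤ[T;T⁻¹] (2 * n + 1) d))
      (J : ∀ _ : ℂˣ, Representation ℂ (BraidGroup (2 * n + 1)) (LinkDiagram.Span ℂ (2 * n + 1) d))
      (ρ : Representation ℂ (BraidGroup (2 * n + 1)) (HomologicalModule n l)),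
      -- the braid generators act by the Kauffman bracket, respectively by the Dehn twists
      (∀ i : Fin (2 * n), J₀ (BraidGroup.gen i) = LinkDiagram.jonesGen laurentVar i) ∧
      (∀ (A : ℂˣ) (i : Fin (2 * n)), J A (BraidGroup.gen i) = LinkDiagram.jonesGen A i) ∧
      (∀ (i : Fin (2 * n)) (x : ⋀[ℂ]^l (SurfaceH1 n)),
        ρ (BraidGroup.gen i) ((omegaWedge n l).mkQ x) =
          (omegaWedge n l).mkQ (twistExteriorPower n l i x)) ∧
      -- the matrix entries of `J A` are integral Laurent polynomials in `A`
      (∀ (A : ℂˣ) (b : BraidGroup (2 * n + 1)) (D E : LinkDiagram (2 * n + 1) d),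
        J A b (Finsupp.single D 1) E =
          LaurentPolynomial.eval₂ (Int.castRingHom ℂ) A (J₀ b (Finsupp.single D 1) E)) ∧
      -- at regular `q = A ^ 4` they are the representation of the two-row Young diagram
      (∀ q : ℂ, IsRegularParameter (2 * n + 1) q →
        ∃ π : Representation ℂ (BraidGroup (2 * n + 1))
            (StandardTableau (twoRowDiagram l d) (2 * n + 1) →₀ ℂ),
          (∀ i : Fin (2 * n), π (BraidGroup.gen i) = StandardTableau.heckeGen q i) ∧
          ∀ A : ℂˣ, (A : ℂ) ^ 4 = q → Nonempty ((J A).Equiv π)) ∧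
      -- at `q = A ^ 4 = -1` they are the homological representation
      (∀ A : ℂˣ, (A : ℂ) ^ 4 = -1 → Nonempty ((J A).Equiv ρ)) := by
  obtain ⟨ρ, h1, h2⟩ := exists_homologicalRepresentation (n := n) (d := d) (l := l) hl.symm
  exact ⟨LinkDiagram.jonesRep _ _ laurentVar, LinkDiagram.jonesRep _ _, ρ,
    LinkDiagram.jonesRep_gen (n := 2 * n + 1) laurentVar,
    fun A i => LinkDiagram.jonesRep_gen (n := 2 * n + 1) A i, h1, LinkDiagram.jonesRep_laurent,
    fun q hq => LinkDiagram.exists_heckeRepresentation hl.symm (by omega) hq, h2⟩
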